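/- **Theorem 1.2.** For a finite simple graph $G$ and $p\in(0,1)$ let $G_p$ be the random subgraph of $G$ on the same vertex set in which each edge of $G$ is, independently, retained with probability $p$ and erased with probability $1-p$; let $\mathbf{CO}(G_p)$ be the collection of its connected components. For $\mathcal C\in\mathbf{CO}(G_p)$ let $|\mathcal C|$ be its number of vertices, $\mathcal E(\mathcal C)$ its edge set, $\operatorname{diam}(\mathcal C)$ its graph diameter, and $$T_{\mathrm{mix}}(\mathcal C)=\min\Big\{t\in\mathbb N:\ \max_{B\subseteq \mathcal C}|\mathbf p^t(x,B)-\pi(B)|\le \tfrac14\ \text{ for all } x\in\mathcal C\Big\}$$ the mixing time of the lazy simple random walk on $\mathcal C$, which has transition probabilities $\mathbf p(x,x)=\frac12$, $\mathbf p(x,y)=\frac1{2\deg(x)}$ if $xy\in\mathcal E(\mathcal C)$, and $\mathbf p(x,y)=0$ otherwise, and stationary distribution $\pi(x)=\frac{\deg(x)}{2|\mathcal E(\mathcal C)|}$, degrees being taken in $\mathcal C$. Let $\lambda\in\mathbb R$, $\varepsilon>0$ and $\beta>0$. Then there exist $A=A(\varepsilon,\beta,\lambda)\in(0,\infty)$ and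 $N=N(\varepsilon,\beta,\lambda)$ such that for all $n\ge N$, all $d\in[3,n-1]$, every graph $G$ on $n$ vertices with maximum degree at most $d$, and every $p\in(0,1)$ with $p\le\frac{1+\lambda n^{-1/3}}{d-1}$: (a) $\mathbf P\big(\exists\,\mathcal C\in\mathbf{CO}(G_p)$ with $|\mathcal C|>\beta n^{2/3}$ and $\operatorname{diam}(\mathcal C)\notin[A^{-1}n^{1/3},An^{1/3}]\big)<\varepsilon$; (b) $\mathbf P\big(\exists\,\mathcal C\in\mathbf{CO}(G_p)$ with $|\mathcal E(\mathcal C)|>An^{2/3}\big)<\varepsilon$; (c) $\mathbf P\big(\exists\,\mathcal C\in\mathbf{CO}(G_p)$ with $|\mathcal C|>\beta n^{2/3}$ and $T_{\mathrm{mix}}(\mathcal C)\notin[A^{-1}n,An]\big)<\varepsilon$. -/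

import Mathlib

open MeasureTheory ProbabilityTheory

namespace SimpleGraph

/-- The law of the percolation subgraph `G_p`: each edge of `G` is retained, independently of all
the others, with probability `p`, and erased with probability `1 - p`. It is a measure on the simple
graphs with vertex set `V`: the random graph whose edge set is the set of retained edges, where
`setBernoulli G.edgeSet p` is Mathlib's product of Bernoulli laws over the edges of `G`. -/
noncomputable def percolation {V : Type*} (G : SimpleGraph V) (p : unitInterval) :
    Measure (SimpleGraph V) :=
  (setBernoulli G.edgeSet p).map fromEdgeSet

instance {V : Type*} (G : SimpleGraph V) (p : unitInterval) :
    IsProbabilityMeasure (G.percolation p) :=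
  Measure.isProbabilityMeasure_map measurable_fromEdgeSet.aemeasurable

open Classical in
/-- Transition matrix of the lazy simple random walk on `H`: the walk stays put with probability
`1/2`, and moves from `x` to each neighbour of `x` with probability `1 / (2 deg x)`. -/
noncomputable def lazyWalk {V : Type*} (H : SimpleGraph V) : Matrix V V ℝ :=
  Matrix.of fun x y =>
    if x = y then 1 / 2 else if H.Adj x y then 1 / (2 * (H.neighborSet x).ncard) else 0

/-- The stationary distribution `π(x) = deg x / (2 |E|)` of the lazy simple random walk on `H`. -/
noncomputable def walkStationary {V : Type*} (H : SimpleGraph V) : V → ℝ :=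
  fun x => (H.neighborSet x).ncard / (2 * H.edgeSet.ncard)

/-- Total variation distance of two distributions on a finite set, given by their point masses:
the maximum over sets `A` of the difference of the masses of `A`. -/
noncomputable def tvDist {V : Type*} (μ ν : V → ℝ) : ℝ :=
  ⨆ A : Finset V, |∑ x ∈ A, μ x - ∑ x ∈ A, ν x|

open Classical in
/-- Mixing time of the lazy simple random walk on a finite connected graph `H` with at least two
vertices: the least `t` such that, from every starting vertex, the law after `t` steps is within
`1/4` of the stationary distribution in total variation. (The set is then nonempty; for other
graphs `sInf ∅ = 0` would be a default value.) -/
noncomputable def mixingTime {V : Type*} [Finite V] (H : SimpleGraph V) : ℕ :=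
  letI := Fintype.ofFinite V
  sInf {t : ℕ | ∀ x : V, tvDist (fun y => (H.lazyWalk ^ t) x y) H.walkStationary ≤ 1 / 4}

end SimpleGraph

/-! Put `L = n^(1/3)`. Breadth-first exploration of a component behaves at worst like a branching
process with mean offspring `M = 1 + |λ| / L`, and the powers of `M` stay bounded by `E = exp (4
|λ|)` up to generation `4L`. Two estimates follow. Spheres have bounded mean size
(`NearCritical.bernEx_card_bfsLevel_le`), and distance `k` is reached with probability `O(1/k)`
(`NearCritical.survives_le`). For the second, self-avoiding continuations through different
neighbours are increasing events, so by FKG they all fail at least as often as if they were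
independent. The reciprocal of the survival bound then gains `1/4` per step, up to division by `M`.

Probabilities pass from vertices to components by a first moment: if each vertex is bad with
probability at most `η / L`, the `L^3` vertices include on average at most `η L^2` bad ones, so a
component with more than `β L^2` vertices, all bad, has probability at most `η / β`
(`exists_component_bad_le`).

Edges: removing an open edge `vw` from a component with many edges leaves `v` or `w` in a large
component, an event independent of `vw`; counting such edges gives (b). Diameter: if it is small,
the component fits in a short ball around each of its vertices, and such balls are small on average.
If it is large while the volume is `O(L^2)`, each vertex sees a thin sphere that nevertheless
survives for a further distance `L`, which is unlikely (`small_level_le`).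

Mixing, upper bound: the squared `L²` distance to stationarity satisfies `u² ≤ 4R (u_t - u_{t+1})`
with `R` the diameter, hence decays like `4R / t`, and the mixing time is at most `128 |E| R`.
Mixing, lower bound: a function equal to 1 on a ball of radius `s = δL` and 0 off the ball of radius
`3s` forces the mixing time to be at least the volume of the small ball divided by the Dirichlet
energy (`sum_rdeg_le_mul_dirichlet`). The function averages the cuts at radii in `[s, 2s)` formed by
lanes, the edges that continue for a distance `s`. Lanes are bounded in mean, so the energy is
`O(1/s)` (`dirichlet_laneFun_le`), while the small ball typically has order `s^2` vertices; the
quotient has order `L^3`. -/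

set_option linter.unusedSectionVars false

/-! ### Finite product Bernoulli measures: independence, FKG, domain Markov property -/

section Bernoulli

open Classical in
/-- The indicator of a proposition, as a real number. -/
noncomputable def ind (Q : Prop) : ℝ := if Q then 1 else 0

theorem ind_of {Q : Prop} (h : Q) : ind Q = 1 := if_pos h

theorem ind_of_not {Q : Prop} (h : ¬ Q) : ind Q = 0 := if_neg h

theorem ind_nonneg (Q : Prop) : 0 ≤ ind Q := by
  unfold ind; split_ifs <;> norm_num

theorem ind_le_one (Q : Prop) : ind Q ≤ 1 := by
  unfold ind; split_ifs <;> norm_num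

theorem ind_mono {Q R : Prop} (h : Q → R) : ind Q ≤ ind R := by
  by_cases hQ : Q
  · rw [ind_of hQ, ind_of (h hQ)]
  · rw [ind_of_not hQ]; exact ind_nonneg R

theorem ind_and (Q R : Prop) : ind (Q ∧ R) = ind Q * ind R := by
  by_cases hQ : Q <;> by_cases hR : R <;> simp [ind, hQ, hR]

theorem ind_not (Q : Prop) : ind (¬ Q) = 1 - ind Q := by
  by_cases hQ : Q <;> simp [ind, hQ]

theorem ind_ne_zero {Q : Prop} : ind Q ≠ 0 ↔ Q := by
  by_cases hQ : Q <;> simp [ind, hQ]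

theorem ind_or_le (Q R : Prop) : ind (Q ∨ R) ≤ ind Q + ind R := by
  by_cases hQ : Q <;> by_cases hR : R <;> simp [ind, hQ, hR]

variable {ι : Type*} [Fintype ι] [DecidableEq ι]

/-- The weight of `S` when each `e` is put into `S` independently with probability `P e`. -/
noncomputable def bernWt (P : ι → ℝ) (S : Finset ι) : ℝ :=
  ∏ e, if e ∈ S then P e else 1 - P e

/-- Expectation over a random subset containing each `e` independently with probability `P e`. -/
noncomputable def bernEx (P : ι → ℝ) (f : Finset ι → ℝ) : ℝ :=
  ∑ S, bernWt P S * f S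

/-- Probability of an event for a random subset containing each `e` independently with
probability `P e`. -/
noncomputable def bernPr (P : ι → ℝ) (Q : Finset ι → Prop) : ℝ :=
  bernEx P fun S => ind (Q S)

/-- `f` only depends on the coordinates in `D`. -/
def DepOn {α : Type*} (f : Finset ι → α) (D : Set ι) : Prop :=
  ∀ S T : Finset ι, (∀ e ∈ D, e ∈ S ↔ e ∈ T) → f S = f T

variable {P : ι → ℝ}

theorem bernWt_nonneg (hP : ∀ e, P e ∈ Set.Icc (0 : ℝ) 1) (S : Finset ι) : 0 ≤ bernWt P S := by
  refine Finset.prod_nonneg fun e _ => ?_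
  have := hP e
  split_ifs
  · exact this.1
  · linarith [this.2]

theorem bernWt_sum (P : ι → ℝ) : ∑ S, bernWt P S = 1 := by
  have h := Finset.prod_add P (fun e => 1 - P e) (Finset.univ : Finset ι)
  simp only [add_sub_cancel, Finset.prod_const_one, Finset.powerset_univ] at h
  rw [h]
  refine Finset.sum_congr rfl fun S _ => ?_
  rw [bernWt, Finset.prod_ite]
  congr 1
  · exact Finset.prod_congr (by ext; simp) fun _ _ => rfl
  · exact Finset.prod_congr (by ext; simp) fun _ _ => rfl

theorem bernEx_const (P : ι → ℝ) (c : ℝ) : bernEx P (fun _ => c) = c := by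
  rw [bernEx, ← Finset.sum_mul, bernWt_sum, one_mul]

theorem bernEx_mono (hP : ∀ e, P e ∈ Set.Icc (0 : ℝ) 1) {f g : Finset ι → ℝ}
    (h : ∀ S, f S ≤ g S) : bernEx P f ≤ bernEx P g :=
  Finset.sum_le_sum fun S _ => mul_le_mul_of_nonneg_left (h S) (bernWt_nonneg hP S)

theorem bernEx_nonneg (hP : ∀ e, P e ∈ Set.Icc (0 : ℝ) 1) {f : Finset ι → ℝ}
    (h : ∀ S, 0 ≤ f S) : 0 ≤ bernEx P f :=
  Finset.sum_nonneg fun S _ => mul_nonneg (bernWt_nonneg hP S) (h S)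

theorem bernEx_add (f g : Finset ι → ℝ) :
    bernEx P (fun S => f S + g S) = bernEx P f + bernEx P g := by
  simp only [bernEx, mul_add, Finset.sum_add_distrib]

theorem bernEx_sub (f g : Finset ι → ℝ) :
    bernEx P (fun S => f S - g S) = bernEx P f - bernEx P g := by
  simp only [bernEx, mul_sub, Finset.sum_sub_distrib]

theorem bernEx_sum {κ : Type*} (s : Finset κ) (f : κ → Finset ι → ℝ) :
    bernEx P (fun S => ∑ k ∈ s, f k S) = ∑ k ∈ s, bernEx P (f k) := by
  simp only [bernEx, Finset.mul_sum]
  exact Finset.sum_comm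

theorem bernEx_mul_left (c : ℝ) (f : Finset ι → ℝ) :
    bernEx P (fun S => c * f S) = c * bernEx P f := by
  simp only [bernEx, Finset.mul_sum]
  exact Finset.sum_congr rfl fun _ _ => by ring

theorem bernPr_nonneg (hP : ∀ e, P e ∈ Set.Icc (0 : ℝ) 1) (Q : Finset ι → Prop) :
    0 ≤ bernPr P Q :=
  bernEx_nonneg hP fun _ => ind_nonneg _

theorem bernPr_mono (hP : ∀ e, P e ∈ Set.Icc (0 : ℝ) 1) {Q R : Finset ι → Prop}
    (h : ∀ S, Q S → R S) : bernPr P Q ≤ bernPr P R :=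
  bernEx_mono hP fun S => ind_mono (h S)

theorem bernPr_le_one (hP : ∀ e, P e ∈ Set.Icc (0 : ℝ) 1) (Q : Finset ι → Prop) :
    bernPr P Q ≤ 1 := by
  rw [← bernEx_const P 1]
  exact bernEx_mono hP fun S => ind_le_one _

theorem bernPr_or_le (hP : ∀ e, P e ∈ Set.Icc (0 : ℝ) 1) (Q R : Finset ι → Prop) :
    bernPr P (fun S => Q S ∨ R S) ≤ bernPr P Q + bernPr P R := by
  rw [bernPr, bernPr, bernPr, ← bernEx_add]
  exact bernEx_mono hP fun S => ind_or_le _ _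

theorem bernPr_exists_le (hP : ∀ e, P e ∈ Set.Icc (0 : ℝ) 1) {κ : Type*} (s : Finset κ)
    (Q : κ → Finset ι → Prop) :
    bernPr P (fun S => ∃ k ∈ s, Q k S) ≤ ∑ k ∈ s, bernPr P (Q k) := by
  simp only [bernPr]
  rw [← bernEx_sum]
  refine bernEx_mono hP fun S => ?_
  by_cases h : ∃ k ∈ s, Q k S
  · rw [ind_of h]
    obtain ⟨k, hk, hQ⟩ := h
    rw [← ind_of hQ]
    exact Finset.single_le_sum (f := fun k => ind (Q k S)) (fun k _ => ind_nonneg _) hk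
  · rw [ind_of_not h]
    exact Finset.sum_nonneg fun k _ => ind_nonneg _

theorem bernPr_not (Q : Finset ι → Prop) : bernPr P (fun S => ¬ Q S) = 1 - bernPr P Q := by
  rw [bernPr, bernPr, ← bernEx_const P 1, ← bernEx_sub]
  simp only [ind_not]

/-- Markov's inequality. -/
theorem bernPr_le_div (hP : ∀ e, P e ∈ Set.Icc (0 : ℝ) 1) {f : Finset ι → ℝ}
    (hf : ∀ S, 0 ≤ f S) {a : ℝ} (ha : 0 < a) (Q : Finset ι → Prop) (hQ : ∀ S, Q S → a ≤ f S) :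
    bernPr P Q ≤ bernEx P f / a := by
  rw [le_div_iff₀ ha, mul_comm, bernPr, ← bernEx_mul_left]
  refine bernEx_mono hP fun S => ?_
  by_cases h : Q S
  · simpa [ind, h] using hQ S h
  · simpa [ind, h] using hf S

/-- Take two independent copies and exchange their coordinates outside `D`. This involution
preserves the product weight and turns `f` of the first copy times `g` of the second into `f * g` of
a single copy. -/
theorem bernEx_mul_of_depOn {f g : Finset ι → ℝ} {D : Set ι} (hf : DepOn f D) (hg : DepOn g Dᶜ) :
    bernEx P (fun S => f S * g S) = bernEx P f * bernEx P g := by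
  classical
  let mix : Finset ι → Finset ι → Finset ι := fun S T => S.filter (· ∈ D) ∪ T.filter (· ∉ D)
  have hmem : ∀ S T e, e ∈ mix S T ↔ (e ∈ D ∧ e ∈ S) ∨ (e ∉ D ∧ e ∈ T) := by
    intro S T e
    simp only [mix, Finset.mem_union, Finset.mem_filter]
    tauto
  have hmix : ∀ S T, mix (mix S T) (mix T S) = S := by
    intro S T
    ext e
    rw [hmem, hmem, hmem]
    tauto
  let σ : Finset ι × Finset ι ≃ Finset ι × Finset ι :=
    { toFun := fun x => (mix x.1 x.2, mix x.2 x.1)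
      invFun := fun x => (mix x.1 x.2, mix x.2 x.1)
      left_inv := fun x => Prod.ext (hmix _ _) (hmix _ _)
      right_inv := fun x => Prod.ext (hmix _ _) (hmix _ _) }
  have hw : ∀ S T, bernWt P (mix S T) * bernWt P (mix T S) = bernWt P S * bernWt P T := by
    intro S T
    simp only [bernWt, ← Finset.prod_mul_distrib]
    refine Finset.prod_congr rfl fun e _ => ?_
    by_cases he : e ∈ D <;> by_cases h1 : e ∈ S <;> by_cases h2 : e ∈ T <;>
      simp [hmem, he, h1, h2, mul_comm]
  have key : bernEx P f * bernEx P g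
      = ∑ x : Finset ι × Finset ι, bernWt P x.1 * bernWt P x.2 * (f x.1 * g x.1) := by
    rw [bernEx, bernEx, Finset.sum_mul_sum, ← Finset.univ_product_univ, ← Finset.sum_product',
      Finset.univ_product_univ]
    refine Fintype.sum_equiv σ _ _ fun x => ?_
    have h1 : f (mix x.1 x.2) = f x.1 := hf _ _ fun e he => by rw [hmem]; tauto
    have h2 : g (mix x.1 x.2) = g x.2 := hg _ _ fun e he => by
      rw [hmem]; have : e ∉ D := he; tauto
    simp only [σ, Equiv.coe_fn_mk, hw, h1, h2]
    ring
  rw [key, ← Finset.univ_product_univ, Finset.sum_product]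
  refine Finset.sum_congr rfl fun S _ => ?_
  simp only
  rw [← Finset.sum_mul, ← Finset.mul_sum, bernWt_sum, mul_one]

theorem bernPr_and_of_depOn {Q R : Finset ι → Prop} {D : Set ι} (hQ : DepOn Q D)
    (hR : DepOn R Dᶜ) : bernPr P (fun S => Q S ∧ R S) = bernPr P Q * bernPr P R := by
  simp only [bernPr, ind_and]
  exact bernEx_mul_of_depOn (D := D) (fun S T h => by rw [hQ S T h]) fun S T h => by rw [hR S T h]

/-- On the sets containing `e`, the weight is `P e` times the weight for the probabilities modified
to be 1 at `e`; the modified weights have total mass 1. -/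
theorem bernPr_mem (P : ι → ℝ) (e : ι) : bernPr P (fun S => e ∈ S) = P e := by
  have h : ∀ S : Finset ι, bernWt P S * ind (e ∈ S)
      = bernWt (fun i => if i = e then 1 else P i) S * P e := by
    intro S
    have h1 : ∀ x ∈ Finset.univ.erase e, (if x ∈ S then (if x = e then (1 : ℝ) else P x)
          else 1 - (if x = e then (1 : ℝ) else P x)) = if x ∈ S then P x else 1 - P x := by
      intro x hx
      simp [Finset.ne_of_mem_erase hx]
    have h2 : bernWt (fun i => if i = e then 1 else P i) S
        = (if e ∈ S then 1 else 0) *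
          ∏ x ∈ Finset.univ.erase e, if x ∈ S then P x else 1 - P x := by
      rw [bernWt, ← Finset.mul_prod_erase _ _ (Finset.mem_univ e), Finset.prod_congr rfl h1]
      simp
    rw [h2, bernWt, ← Finset.mul_prod_erase _ _ (Finset.mem_univ e)]
    by_cases he : e ∈ S
    · simp [he, ind]; ring
    · simp [he, ind]
  rw [bernPr, bernEx, Finset.sum_congr rfl fun S _ => h S, ← Finset.sum_mul, bernWt_sum, one_mul]

/-- Positive correlation of the complements of increasing events. -/
theorem bernPr_not_and_not_ge (hP : ∀ e, P e ∈ Set.Icc (0 : ℝ) 1) {Q R : Finset ι → Prop}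
    (hQ : Monotone Q) (hR : Monotone R) :
    bernPr P (fun S => ¬ Q S) * bernPr P (fun S => ¬ R S)
      ≤ bernPr P (fun S => ¬ Q S ∧ ¬ R S) := by
  -- The lattice condition of the FKG inequality holds with equality for a product weight. Passing
  -- to complements afterwards is inclusion-exclusion.
  have h : (∑ a, bernWt P a * ind (Q a)) * ∑ a, bernWt P a * ind (R a)
      ≤ (∑ a, bernWt P a) * ∑ a, bernWt P a * (ind (Q a) * ind (R a)) :=
    fkg (fun S => ind (Q S)) (fun S => ind (R S)) (bernWt P) (fun S => bernWt_nonneg hP S)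
      (fun S => ind_nonneg _) (fun S => ind_nonneg _) (fun S T hST => ind_mono (hQ hST))
      (fun S T hST => ind_mono (hR hST)) (by
        intro S T
        simp only [bernWt, ← Finset.prod_mul_distrib]
        refine le_of_eq (Finset.prod_congr rfl fun e _ => ?_)
        by_cases h1 : e ∈ S <;> by_cases h2 : e ∈ T <;> simp [h1, h2, mul_comm])
  rw [bernWt_sum, one_mul] at h
  change bernPr P Q * bernPr P R ≤ bernEx P (fun S => ind (Q S) * ind (R S)) at h
  have h3 : bernPr P (fun S => ¬ Q S ∧ ¬ R S) = 1 - bernPr P Q - bernPr P R +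
      bernEx P (fun S => ind (Q S) * ind (R S)) := by
    rw [bernPr, bernPr, bernPr, ← bernEx_const P 1, ← bernEx_sub, ← bernEx_sub, ← bernEx_add]
    congr 1
    ext S
    rw [ind_and, ind_not, ind_not]
    ring
  rw [h3, bernPr_not, bernPr_not]
  nlinarith

/-- Events are split off one at a time: the union of the remaining ones is again increasing, so the
inequality for two events applies. -/
theorem bernPr_forall_not_ge (hP : ∀ e, P e ∈ Set.Icc (0 : ℝ) 1) {κ : Type*} (s : Finset κ)
    (Q : κ → Finset ι → Prop) (hQ : ∀ k, Monotone (Q k)) :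
    ∏ k ∈ s, (1 - bernPr P (Q k)) ≤ bernPr P (fun S => ∀ k ∈ s, ¬ Q k S) := by
  classical
  induction s using Finset.induction_on with
  | empty => simp [bernPr, bernEx_const, ind]
  | insert a s ha ih =>
    rw [Finset.prod_insert ha]
    have h1 : Monotone (fun S => ∃ k ∈ s, Q k S) := by
      rintro S T hST ⟨k, hk, h⟩
      exact ⟨k, hk, hQ k hST h⟩
    have h2 := bernPr_not_and_not_ge hP (hQ a) h1
    have h3 : bernPr P (fun S => ∀ k ∈ insert a s, ¬ Q k S)
        = bernPr P (fun S => ¬ Q a S ∧ ¬ ∃ k ∈ s, Q k S) := by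
      congr 1
      ext S
      simp
    have h4 : bernPr P (fun S => ∀ k ∈ s, ¬ Q k S) = bernPr P (fun S => ¬ ∃ k ∈ s, Q k S) := by
      congr 1
      ext S
      simp
    rw [h3]
    refine le_trans ?_ h2
    rw [← h4, bernPr_not]
    exact mul_le_mul_of_nonneg_left ih (by linarith [bernPr_le_one hP (Q a)])

/-- Domain Markov property: `X` is the outcome of an exploration which examines exactly the
coordinates in `D (X S)`. -/
theorem bernEx_mul_le_of_stopping (hP : ∀ e, P e ∈ Set.Icc (0 : ℝ) 1) {α : Type*}
    (X : Finset ι → α) (D : α → Set ι) (f : Finset ι → ℝ) (g : α → Finset ι → ℝ) (c : ℝ)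
    (hX : ∀ S T, (∀ e ∈ D (X S), e ∈ S ↔ e ∈ T) → X T = X S ∧ f T = f S)
    (hf : ∀ S, 0 ≤ f S) (hg : ∀ S, f S ≠ 0 → DepOn (g (X S)) (D (X S))ᶜ)
    (hc : ∀ S, f S ≠ 0 → bernEx P (g (X S)) ≤ c) :
    bernEx P (fun S => f S * g (X S) S) ≤ c * bernEx P f := by
  classical
  let I : Finset α := Finset.univ.image X
  have hsplit : ∀ h : Finset ι → ℝ, bernEx P h
      = ∑ a ∈ I, bernEx P (fun S => (if X S = a then 1 else 0) * h S) := by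
    intro h
    rw [← bernEx_sum]
    congr 1
    ext S
    rw [← Finset.sum_mul, Finset.sum_ite_eq, if_pos (by simp [I]), one_mul]
  rw [hsplit, hsplit f, Finset.mul_sum]
  refine Finset.sum_le_sum fun a _ => ?_
  -- Outcomes `a` on which `f` vanishes contribute nothing, and have to be set aside because `hg`
  -- and `hc` are available only where `f` is nonzero. For the others, `f` restricted to `X = a`
  -- depends on `D a` and `g a` on its complement.
  by_cases ha : ∃ S, X S = a ∧ f S ≠ 0
  swap
  · push Not at ha
    have : ∀ S, (if X S = a then (1 : ℝ) else 0) * f S = 0 := by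
      intro S
      by_cases h : X S = a
      · simp [ha S h]
      · simp [h]
    simp only [← mul_assoc, this, zero_mul, bernEx_const, mul_zero, le_refl]
  obtain ⟨S₀, hS₀, hf₀⟩ := ha
  have h1 : bernEx P (fun S => (if X S = a then 1 else 0) * (f S * g (X S) S))
      = bernEx P (fun S => ((if X S = a then 1 else 0) * f S) * g a S) := by
    congr 1
    ext S
    by_cases h : X S = a <;> simp [h]
  rw [h1, bernEx_mul_of_depOn (D := D a), mul_comm]
  · refine mul_le_mul_of_nonneg_right ?_ (bernEx_nonneg hP fun S => mul_nonneg ?_ (hf S))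
    · rw [← hS₀]; exact hc S₀ hf₀
    · split_ifs <;> norm_num
  · intro S T hST
    by_cases hS : X S = a
    · have := hX S T (by rw [hS]; exact hST)
      simp [this.1, this.2]
    · by_cases hT : X T = a
      · have := hX T S (by rw [hT]; exact fun e he => (hST e he).symm)
        simp [this.1, this.2]
      · simp [hS, hT]
  · rw [← hS₀]; exact hg S₀ hf₀

end Bernoulli

namespace SimpleGraph

variable {V : Type*} [Fintype V] [DecidableEq V]

/-! ### Breadth-first search: balls, spheres, forward edges and self-avoiding survival -/

section Exploration

variable (H : SimpleGraph V)

open Classical in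
/-- The ball of radius `j` around `v`, by breadth first search. -/
noncomputable def bfsBall (v : V) : ℕ → Finset V
  | 0 => {v}
  | j + 1 => bfsBall v j ∪ Finset.univ.filter fun w => ∃ u ∈ bfsBall v j, H.Adj u w

/-- The open ball of radius `j` around `v`. -/
noncomputable def bfsInner (v : V) : ℕ → Finset V
  | 0 => ∅
  | j + 1 => H.bfsBall v j

/-- The sphere of radius `j` around `v`. -/
noncomputable def bfsLevel (v : V) (j : ℕ) : Finset V := H.bfsBall v j \ H.bfsInner v j

open Classical in
/-- The neighbours of `x` outside `A`. -/
noncomputable def nbrsOff (A : Finset V) (x : V) : Finset V :=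
  Finset.univ.filter fun y => y ∉ A ∧ H.Adj x y

/-- There is a self-avoiding path with `k` edges from `v` which avoids `A` after its start. -/
def Survives : ℕ → Finset V → V → Prop
  | 0, _, _ => True
  | k + 1, A, v => ∃ w, w ∉ A ∧ H.Adj v w ∧ Survives k (insert v A) w

/-- The number of edges from the sphere of radius `i` to the complement of the open ball. -/
noncomputable def bfsForward (v : V) (i : ℕ) : ℕ :=
  ∑ x ∈ H.bfsLevel v i, (H.nbrsOff (H.bfsInner v i) x).card

open Classical in
/-- The number of edges which leave the ball of radius `i` and can be continued to a
self-avoiding path with `t` further edges outside the ball. -/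
noncomputable def bfsLanes (v : V) (i t : ℕ) : ℕ :=
  ∑ x ∈ H.bfsLevel v i,
    ((H.nbrsOff (H.bfsBall v i) x).filter fun y => H.Survives t (H.bfsBall v i) y).card

variable {H}

theorem mem_nbrsOff {A : Finset V} {x y : V} : y ∈ H.nbrsOff A x ↔ y ∉ A ∧ H.Adj x y := by
  simp [nbrsOff]

theorem mem_bfsBall_succ {v w : V} {j : ℕ} :
    w ∈ H.bfsBall v (j + 1) ↔ w ∈ H.bfsBall v j ∨ ∃ u ∈ H.bfsBall v j, H.Adj u w := by
  simp [bfsBall]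

theorem mem_bfsBall_self (v : V) : ∀ j, v ∈ H.bfsBall v j
  | 0 => by simp [bfsBall]
  | j + 1 => mem_bfsBall_succ.2 (Or.inl (mem_bfsBall_self v j))

theorem bfsBall_mono (v : V) : Monotone (H.bfsBall v) :=
  monotone_nat_of_le_succ fun _ _ h => mem_bfsBall_succ.2 (Or.inl h)

theorem bfsInner_subset (v : V) (j : ℕ) : H.bfsInner v j ⊆ H.bfsBall v j := by
  cases j with
  | zero => simp [bfsInner]
  | succ j => exact bfsBall_mono v (Nat.le_succ j)

theorem bfsBall_subset_inner (v : V) {i j : ℕ} (h : i < j) : H.bfsBall v i ⊆ H.bfsInner v j := by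
  cases j with
  | zero => omega
  | succ j => exact bfsBall_mono v (by omega)

theorem bfsInner_mono (v : V) : Monotone (H.bfsInner v) := by
  intro i j h
  rcases h.eq_or_lt with rfl | h
  · exact le_rfl
  · exact (bfsInner_subset v i).trans (bfsBall_subset_inner v h)

theorem mem_bfsLevel {v w : V} {j : ℕ} :
    w ∈ H.bfsLevel v j ↔ w ∈ H.bfsBall v j ∧ w ∉ H.bfsInner v j := by
  simp [bfsLevel]

theorem exists_mem_bfsLevel {v w : V} {j : ℕ} (h : w ∈ H.bfsBall v j) :
    ∃ i ≤ j, w ∈ H.bfsLevel v i := by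
  induction j with
  | zero => exact ⟨0, le_rfl, mem_bfsLevel.2 ⟨h, by simp [bfsInner]⟩⟩
  | succ j ih =>
    by_cases h' : w ∈ H.bfsBall v j
    · obtain ⟨i, hi, hw⟩ := ih h'
      exact ⟨i, hi.trans (Nat.le_succ j), hw⟩
    · exact ⟨j + 1, le_rfl, mem_bfsLevel.2 ⟨h, h'⟩⟩

theorem exists_adj_of_mem_bfsLevel_succ {v w : V} {j : ℕ} (h : w ∈ H.bfsLevel v (j + 1)) :
    ∃ u ∈ H.bfsLevel v j, H.Adj u w := by
  obtain ⟨h1, h2⟩ := mem_bfsLevel.1 h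
  rcases mem_bfsBall_succ.1 h1 with h1 | ⟨u, hu, ha⟩
  · exact absurd h1 h2
  · refine ⟨u, mem_bfsLevel.2 ⟨hu, fun hu' => h2 ?_⟩, ha⟩
    cases j with
    | zero => simp [bfsInner] at hu'
    | succ j => exact mem_bfsBall_succ.2 (Or.inr ⟨u, hu', ha⟩)

theorem bfsLevel_nonempty_of_le {v : V} {i j : ℕ} (hij : i ≤ j)
    (h : (H.bfsLevel v j).Nonempty) : (H.bfsLevel v i).Nonempty := by
  induction j, hij using Nat.le_induction with
  | base => exact h
  | succ j _ ih =>
    obtain ⟨w, hw⟩ := h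
    obtain ⟨u, hu, -⟩ := exists_adj_of_mem_bfsLevel_succ hw
    exact ih ⟨u, hu⟩

theorem card_bfsBall_le (v : V) (k : ℕ) :
    (H.bfsBall v k).card ≤ ∑ i ∈ Finset.range (k + 1), (H.bfsLevel v i).card := by
  refine (Finset.card_le_card (t := (Finset.range (k + 1)).biUnion (H.bfsLevel v)) ?_).trans
    Finset.card_biUnion_le
  intro w hw
  obtain ⟨i, hi, h⟩ := exists_mem_bfsLevel hw
  exact Finset.mem_biUnion.2 ⟨i, by simp; omega, h⟩

theorem sum_card_bfsLevel_le (v : V) (s : Finset ℕ) (k : ℕ) (hs : ∀ i ∈ s, i ≤ k) :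
    ∑ i ∈ s, (H.bfsLevel v i).card ≤ (H.bfsBall v k).card := by
  rw [← Finset.card_biUnion]
  · refine Finset.card_le_card (Finset.biUnion_subset.2 fun i hi w hw => ?_)
    exact bfsBall_mono v (hs i hi) (mem_bfsLevel.1 hw).1
  · have key : ∀ i j, i < j → Disjoint (H.bfsLevel v i) (H.bfsLevel v j) := by
      intro i j hij
      rw [Finset.disjoint_left]
      intro w hw hw'
      exact (mem_bfsLevel.1 hw').2 (bfsBall_subset_inner v hij (mem_bfsLevel.1 hw).1)
    intro i _ j _ hij
    rcases lt_or_gt_of_ne hij with h | h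
    · exact key i j h
    · exact (key j i h).symm

/-- Each edge with an endpoint in the ball is a forward edge from one of its endpoints. -/
theorem sum_degree_bfsBall_le (v : V) (k : ℕ) :
    ∑ x ∈ H.bfsBall v k, (H.nbrsOff ∅ x).card
      ≤ 2 * ∑ i ∈ Finset.range (k + 1), H.bfsForward v i := by
  classical
  let F : Finset (V × V) := (Finset.range (k + 1)).biUnion fun i =>
    (H.bfsLevel v i).biUnion fun x => (H.nbrsOff (H.bfsInner v i) x).image fun y => (x, y)
  have hF : ∀ i ≤ k, ∀ x ∈ H.bfsLevel v i, ∀ y, y ∉ H.bfsInner v i → H.Adj x y → (x, y) ∈ F := by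
    intro i hi x hx y hy ha
    refine Finset.mem_biUnion.2 ⟨i, by simp; omega, Finset.mem_biUnion.2 ⟨x, hx, ?_⟩⟩
    exact Finset.mem_image_of_mem _ (mem_nbrsOff.2 ⟨hy, ha⟩)
  have hcard : F.card ≤ ∑ i ∈ Finset.range (k + 1), H.bfsForward v i := by
    refine Finset.card_biUnion_le.trans (Finset.sum_le_sum fun i _ => ?_)
    exact Finset.card_biUnion_le.trans (Finset.sum_le_sum fun x _ => Finset.card_image_le)
  have hsub : ((H.bfsBall v k).biUnion fun x => (H.nbrsOff ∅ x).image fun y => (x, y))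
      ⊆ F ∪ F.image Prod.swap := by
    rintro ⟨a, b⟩ hab
    simp only [Finset.mem_biUnion, Finset.mem_image, mem_nbrsOff, Prod.mk.injEq] at hab
    obtain ⟨x, hx, y, ⟨-, ha⟩, rfl, rfl⟩ := hab
    obtain ⟨i, hi, hxi⟩ := exists_mem_bfsLevel hx
    -- If `y` lies strictly closer to `v` than `x` does, the edge is forward when read from `y`, so
    -- its reversal is in `F`.
    by_cases hy : y ∈ H.bfsInner v i
    · obtain ⟨j, hj, hyj⟩ : ∃ j, j < i ∧ y ∈ H.bfsLevel v j := by
        cases i with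
        | zero => simp [bfsInner] at hy
        | succ i =>
          obtain ⟨j, hj, hyj⟩ := exists_mem_bfsLevel hy
          exact ⟨j, by omega, hyj⟩
      refine Finset.mem_union_right _ (Finset.mem_image.2 ⟨(y, x), hF j (by omega) y hyj x ?_ ha.symm,
        rfl⟩)
      exact fun hx' => (mem_bfsLevel.1 hxi).2 (bfsInner_mono v hj.le hx')
    · exact Finset.mem_union_left _ (hF i hi x hxi y hy ha)
  have h1 := Finset.card_le_card hsub
  rw [Finset.card_biUnion] at h1
  · have h2 := Finset.card_union_le F (F.image Prod.swap)
    have h3 : (F.image Prod.swap).card ≤ F.card := Finset.card_image_le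
    have h4 : ∀ x ∈ H.bfsBall v k, ((H.nbrsOff ∅ x).image fun y => (x, y)).card
        = (H.nbrsOff ∅ x).card := fun x _ =>
      Finset.card_image_of_injective _ (Prod.mk_right_injective x)
    rw [Finset.sum_congr rfl h4] at h1
    omega
  · intro x _ x' _ hxx
    rw [Function.onFun, Finset.disjoint_left]
    rintro ⟨a, b⟩ h h'
    simp only [Finset.mem_image, Prod.mk.injEq] at h h'
    obtain ⟨_, _, rfl, _⟩ := h
    obtain ⟨_, _, h5, _⟩ := h'
    exact hxx h5.symm

theorem Walk.mem_bfsBall {v : V} : ∀ {u w : V} (p : H.Walk u w) {j : ℕ},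
    u ∈ H.bfsBall v j → w ∈ H.bfsBall v (j + p.length)
  | _, _, .nil, j, h => h
  | _, _, .cons ha p, j, h => by
    have := p.mem_bfsBall (mem_bfsBall_succ.2 (Or.inr ⟨_, h, ha⟩))
    rw [Walk.length_cons]
    convert this using 2
    omega

theorem exists_walk_of_mem_bfsBall {v w : V} {j : ℕ} (h : w ∈ H.bfsBall v j) :
    ∃ p : H.Walk v w, p.length ≤ j := by
  induction j generalizing w with
  | zero =>
    obtain rfl : w = v := by simpa [bfsBall] using h
    exact ⟨.nil, le_rfl⟩
  | succ j ih =>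
    rcases mem_bfsBall_succ.1 h with h | ⟨u, hu, ha⟩
    · obtain ⟨p, hp⟩ := ih h
      exact ⟨p, by omega⟩
    · obtain ⟨p, hp⟩ := ih hu
      exact ⟨p.concat ha, by rw [Walk.length_concat]; omega⟩

theorem reachable_of_mem_bfsBall {v w : V} {j : ℕ} (h : w ∈ H.bfsBall v j) : H.Reachable v w :=
  (exists_walk_of_mem_bfsBall h).elim fun p _ => p.reachable

theorem mem_bfsBall_iff_of_reachable {v w : V} (h : H.Reachable v w) {j : ℕ} :
    w ∈ H.bfsBall v j ↔ H.dist v w ≤ j := by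
  constructor
  · intro h'
    obtain ⟨p, hp⟩ := exists_walk_of_mem_bfsBall h'
    exact (dist_le p).trans hp
  · intro h'
    obtain ⟨p, hp⟩ := h.exists_walk_length_eq_dist
    have := p.mem_bfsBall (mem_bfsBall_self (H := H) v 0)
    exact bfsBall_mono v (by omega) this

/-- If the sphere of radius `k + 1` is empty then the ball of radius `k` is the component. -/
theorem mem_bfsBall_of_reachable_of_level_empty {v w : V} {k : ℕ}
    (hk : H.bfsLevel v (k + 1) = ∅) (h : H.Reachable v w) : w ∈ H.bfsBall v k := by
  obtain ⟨p⟩ := h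
  suffices ∀ u w (p : H.Walk u w), u ∈ H.bfsBall v k → w ∈ H.bfsBall v k from
    this _ _ p (mem_bfsBall_self v k)
  intro u w p
  induction p with
  | nil => exact id
  | @cons u u' w ha p ih =>
    intro hu
    refine ih ?_
    by_contra hu'
    have : u' ∈ H.bfsLevel v (k + 1) :=
      mem_bfsLevel.2 ⟨mem_bfsBall_succ.2 (Or.inr ⟨u, hu, ha⟩), hu'⟩
    simp [hk] at this

theorem Walk.survives : ∀ {z u : V} (p : H.Walk z u), p.IsPath → ∀ {k : ℕ} {A : Finset V},
    (∀ x ∈ p.support, x ∉ A) → k ≤ p.length → H.Survives k A z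
  | _, _, .nil, _, k, A, _, hk => by
    obtain rfl : k = 0 := by simpa using hk
    trivial
  | _, _, .cons (v := w) ha p, hp, k, A, hA, hk => by
    cases k with
    | zero => trivial
    | succ k =>
      rw [Walk.cons_isPath_iff] at hp
      refine ⟨w, hA w (by simp), ha, p.survives hp.1 ?_ ?_⟩
      · intro x hx hx'
        rcases Finset.mem_insert.1 hx' with rfl | hx'
        · exact hp.2 hx
        · exact hA x (by simp [hx]) hx'
      · rw [Walk.length_cons] at hk; omega

/-- A geodesic from the sphere of radius `j` to `w` moves to a new sphere at every step, so it never
re-enters the ball. Allowing every `A` inside the ball lets the induction enlarge `A` by visited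
vertices, and covers both `∅` and the open ball. -/
theorem exists_survives_of_mem_bfsLevel {v : V} {i : ℕ} :
    ∀ {j : ℕ} {w : V}, w ∈ H.bfsLevel v (j + i) →
      ∃ u ∈ H.bfsLevel v j, ∀ A ⊆ H.bfsBall v j, H.Survives i A u := by
  induction i with
  | zero => exact fun {j w} hw => ⟨w, hw, fun _ _ => trivial⟩
  | succ i ih =>
    intro j w hw
    obtain ⟨u', hu', hs⟩ := ih (j := j + 1) (w := w) (by convert hw using 2; omega)
    obtain ⟨u, hu, ha⟩ := exists_adj_of_mem_bfsLevel_succ hu'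
    refine ⟨u, hu, fun A hA => ⟨u', fun h => (mem_bfsLevel.1 hu').2 (hA h), ha, hs _ ?_⟩⟩
    intro x hx
    rcases Finset.mem_insert.1 hx with rfl | hx
    · exact bfsBall_mono v (Nat.le_succ j) (mem_bfsLevel.1 hu).1
    · exact bfsBall_mono v (Nat.le_succ j) (hA hx)

theorem Survives.mono {H' : SimpleGraph V} (hH : H ≤ H') : ∀ {k : ℕ} {A : Finset V} {v : V},
    H.Survives k A v → H'.Survives k A v
  | 0, _, _, _ => trivial
  | _ + 1, _, _, ⟨w, hw, ha, hs⟩ => ⟨w, hw, hH ha, hs.mono hH⟩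

theorem survives_congr {H' : SimpleGraph V} {B : Finset V}
    (hH : ∀ x y, x ∉ B → y ∉ B → H.Adj x y → H'.Adj x y) :
    ∀ {k : ℕ} {A : Finset V} {v : V}, B ⊆ A → v ∉ B → H.Survives k A v → H'.Survives k A v
  | 0, _, _, _, _, _ => trivial
  | _ + 1, _, _, hA, hv, ⟨w, hw, ha, hs⟩ =>
    have hw' := fun h => hw (hA h)
    ⟨w, hw, hH _ _ hv hw' ha, survives_congr hH (hA.trans (Finset.subset_insert _ _)) hw' hs⟩

/-- The search up to radius `j` inspects only edges at vertices of the open ball. This makes it a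
stopping exploration. -/
theorem bfsBall_congr {H' : SimpleGraph V} {v : V} {j : ℕ}
    (h : ∀ x ∈ H.bfsInner v j, ∀ y, H.Adj x y ↔ H'.Adj x y) :
    ∀ i ≤ j, H'.bfsBall v i = H.bfsBall v i := by
  intro i
  induction i with
  | zero => simp [bfsBall]
  | succ i ih =>
    intro hi
    ext w
    rw [mem_bfsBall_succ, mem_bfsBall_succ, ih (by omega)]
    refine or_congr_right (exists_congr fun u => and_congr_right fun hu => ?_)
    exact (h u (bfsBall_subset_inner v (by omega) hu) w).symm

theorem bfsInner_congr {H' : SimpleGraph V} {v : V} {j : ℕ}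
    (h : ∀ x ∈ H.bfsInner v j, ∀ y, H.Adj x y ↔ H'.Adj x y) :
    ∀ i ≤ j, H'.bfsInner v i = H.bfsInner v i := by
  intro i hi
  cases i with
  | zero => rfl
  | succ i => exact bfsBall_congr h i (by omega)

theorem bfsLevel_congr {H' : SimpleGraph V} {v : V} {j : ℕ}
    (h : ∀ x ∈ H.bfsInner v j, ∀ y, H.Adj x y ↔ H'.Adj x y) :
    ∀ i ≤ j, H'.bfsLevel v i = H.bfsLevel v i := by
  intro i hi
  rw [bfsLevel, bfsLevel, bfsBall_congr h i hi, bfsInner_congr h i hi]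

end Exploration

/-! ### The retained subgraph and the edges on which survival depends -/

section Percolation

variable (G : SimpleGraph V)

/-- The subgraph of `G` with the edges in `S` retained. -/
def retain (S : Finset (Sym2 V)) : SimpleGraph V where
  Adj x y := G.Adj x y ∧ s(x, y) ∈ S
  symm := ⟨fun x y h => ⟨h.1.symm, by rw [Sym2.eq_swap]; exact h.2⟩⟩
  loopless := ⟨fun x h => G.loopless.irrefl x h.1⟩

/-- The set of edges with an endpoint in `A`. -/
def touching (A : Finset V) : Set (Sym2 V) := {e | ∃ x ∈ A, x ∈ e}

variable {G}

theorem retain_adj {S : Finset (Sym2 V)} {x y : V} :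
    (G.retain S).Adj x y ↔ G.Adj x y ∧ s(x, y) ∈ S := Iff.rfl

theorem retain_mono : Monotone G.retain := fun _ _ h _ _ ha => ⟨ha.1, h ha.2⟩

theorem mk_mem_touching {A : Finset V} {x y : V} : s(x, y) ∈ touching A ↔ x ∈ A ∨ y ∈ A := by
  simp only [touching, Set.mem_ofPred_eq, Sym2.mem_iff]
  constructor
  · rintro ⟨z, hz, rfl | rfl⟩
    · exact Or.inl hz
    · exact Or.inr hz
  · rintro (h | h)
    · exact ⟨x, h, Or.inl rfl⟩
    · exact ⟨y, h, Or.inr rfl⟩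

theorem retain_adj_congr {A : Finset V} {S T : Finset (Sym2 V)}
    (h : ∀ e ∈ touching A, e ∈ S ↔ e ∈ T) :
    ∀ x ∈ A, ∀ y, (G.retain S).Adj x y ↔ (G.retain T).Adj x y := fun x hx y => by
  rw [retain_adj, retain_adj, h _ (mk_mem_touching.2 (Or.inl hx))]

/-- A path that starts outside `B` and avoids `A ⊇ B` uses no edge with an endpoint in `B`. -/
theorem depOn_survives {A B : Finset V} (hAB : B ⊆ A) {v : V} (hv : v ∉ B) (k : ℕ) :
    DepOn (fun S => (G.retain S).Survives k A v) (touching B)ᶜ := by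
  have key : ∀ S T : Finset (Sym2 V), (∀ e ∈ (touching B)ᶜ, e ∈ S ↔ e ∈ T) →
      (G.retain S).Survives k A v → (G.retain T).Survives k A v := by
    intro S T h
    refine survives_congr (B := B) (fun x y hx hy ha => ?_) hAB hv
    refine ⟨ha.1, (h _ ?_).1 ha.2⟩
    rw [Set.mem_compl_iff, mk_mem_touching]
    tauto
  exact fun S T h => propext ⟨key S T h, key T S fun e he => (h e he).symm⟩

end Percolation

end SimpleGraph

/-! ### One-arm estimate and moments of the exploration -/

namespace SimpleGraph

/-- With `q = 1 - (1 - x)^D` this says `1/q ≥ 1/(Dx) + 1/4` when `x > 0` (and `q > 0`): the additive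
`1/4` is the source of the `1/k` decay of survival. It fails for `D = 1`, which is where `d ≥ 3`
enters. -/
theorem one_sub_pow_ge {x : ℝ} (h0 : 0 ≤ x) (h1 : x ≤ 1) {D : ℕ} (hD : 2 ≤ D) :
    1 - D * x / (1 + D * x / 4) ≤ (1 - x) ^ D := by
  induction D, hD using Nat.le_induction with
  | base =>
    have : (0 : ℝ) < 1 + (2 : ℕ) * x / 4 := by push_cast; linarith
    rw [sub_le_iff_le_add, ← sub_le_iff_le_add', le_div_iff₀ this]
    push_cast
    nlinarith [mul_nonneg h0 h0, mul_nonneg (mul_nonneg h0 h0) h0]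
  | succ D hD ih =>
    have hD' : (2 : ℝ) ≤ D := by exact_mod_cast hD
    have h2 : (1 - x) * (1 - D * x / (1 + D * x / 4)) ≤ (1 - x) ^ (D + 1) := by
      rw [pow_succ, mul_comm]
      exact mul_le_mul_of_nonneg_right ih (by linarith)
    refine le_trans ?_ h2
    have hp1 : (0 : ℝ) < 1 + D * x / 4 := by positivity
    have hp2 : (0 : ℝ) < 1 + ((D + 1 : ℕ) : ℝ) * x / 4 := by positivity
    have e1 : (1 - x) * (1 - D * x / (1 + D * x / 4))
        = 1 - x * (1 + D - 3 * D * x / 4) / (1 + D * x / 4) := by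
      field_simp
      ring
    rw [e1, sub_le_sub_iff_left, div_le_div_iff₀ hp1 hp2]
    push_cast
    have : 0 ≤ x * (x * ((2 * D - 1) / 4) + 3 * D * (D + 1) * x ^ 2 / 16) :=
      mul_nonneg h0 (add_nonneg (mul_nonneg h0 (by linarith)) (by positivity))
    nlinarith

section

variable {V : Type*} [Fintype V] [DecidableEq V] {G : SimpleGraph V} {P : Sym2 V → ℝ}

theorem retain_nbrsOff_card (A : Finset V) (x : V) (S : Finset (Sym2 V)) :
    (((G.retain S).nbrsOff A x).card : ℝ) = ∑ y ∈ G.nbrsOff A x, ind (s(x, y) ∈ S) := by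
  classical
  have : (G.retain S).nbrsOff A x = (G.nbrsOff A x).filter fun y => s(x, y) ∈ S := by
    ext y
    simp only [mem_nbrsOff, Finset.mem_filter, retain_adj]
    tauto
  rw [this, Finset.card_filter]
  push_cast
  exact Finset.sum_congr rfl fun y _ => by simp [ind]

theorem depOn_mem_edge {x y : V} {D : Set (Sym2 V)} (h : s(x, y) ∈ D) :
    DepOn (fun S : Finset (Sym2 V) => s(x, y) ∈ S) D :=
  fun _ _ hST => propext (hST _ h)

/-- The edge touches `B` at `x`, whereas survival from `y` depends only on edges that do not touch
`B`; hence independence. -/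
theorem bernPr_edge_and_survives {x y : V} {A B : Finset V} (hAB : B ⊆ A) (hx : x ∈ B)
    (hy : y ∉ B) (t : ℕ) :
    bernPr P (fun S => s(x, y) ∈ S ∧ (G.retain S).Survives t A y)
      = P s(x, y) * bernPr P (fun S => (G.retain S).Survives t A y) := by
  rw [bernPr_and_of_depOn (D := touching B) (depOn_mem_edge (mk_mem_touching.2 (Or.inl hx)))
    (depOn_survives hAB hy t), bernPr_mem]

theorem survives_succ_iff {S : Finset (Sym2 V)} {A : Finset V} {v : V} {k : ℕ} :
    (G.retain S).Survives (k + 1) A v ↔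
      ∃ w ∈ G.nbrsOff A v, s(v, w) ∈ S ∧ (G.retain S).Survives k (insert v A) w := by
  constructor
  · rintro ⟨w, hw, ha, hs⟩
    exact ⟨w, mem_nbrsOff.2 ⟨hw, ha.1⟩, ha.2, hs⟩
  · rintro ⟨w, hw, ha, hs⟩
    rw [mem_nbrsOff] at hw
    exact ⟨w, hw.1, ⟨hw.2, ha⟩, hs⟩

theorem notMem_insert_of_mem_nbrsOff {A : Finset V} {v w : V} (h : w ∈ G.nbrsOff A v) :
    w ∉ insert v A := by
  rw [mem_nbrsOff] at h
  rw [Finset.mem_insert]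
  rintro (rfl | h')
  · exact G.loopless.irrefl _ h.2
  · exact h.1 h'

/-- Cycles of `G` make the continuations through different neighbours dependent, but they are
increasing events, so by FKG their joint failure is at least as likely as under independence. This
is the comparison with a tree. -/
theorem bernPr_survives_succ_le (hP : ∀ e, P e ∈ Set.Icc (0 : ℝ) 1) (A : Finset V) (v : V)
    (k : ℕ) :
    bernPr P (fun S => (G.retain S).Survives (k + 1) A v) ≤
      1 - ∏ w ∈ G.nbrsOff A v,
        (1 - P s(v, w) * bernPr P (fun S => (G.retain S).Survives k (insert v A) w)) := by
  have h := bernPr_forall_not_ge hP (G.nbrsOff A v)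
    (fun w S => s(v, w) ∈ S ∧ (G.retain S).Survives k (insert v A) w)
    (fun w S T hST h => ⟨hST h.1, h.2.mono (retain_mono hST)⟩)
  have h2 : ∏ w ∈ G.nbrsOff A v, (1 - bernPr P
      (fun S => s(v, w) ∈ S ∧ (G.retain S).Survives k (insert v A) w)) =
      ∏ w ∈ G.nbrsOff A v, (1 - P s(v, w) *
        bernPr P (fun S => (G.retain S).Survives k (insert v A) w)) :=
    Finset.prod_congr rfl fun w hw => by
      rw [bernPr_edge_and_survives (B := insert v A) le_rfl (Finset.mem_insert_self _ _)
        (notMem_insert_of_mem_nbrsOff hw)]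
  rw [h2] at h
  have h3 : bernPr P (fun S => (G.retain S).Survives (k + 1) A v) = 1 - bernPr P (fun S =>
      ∀ w ∈ G.nbrsOff A v, ¬ (s(v, w) ∈ S ∧ (G.retain S).Survives k (insert v A) w)) := by
    rw [← bernPr_not]
    congr 1
    ext S
    rw [survives_succ_iff]
    push Not
    rfl
  rw [h3]
  linarith

theorem nbrsOff_card_le_of_adj {A : Finset V} {x y : V} {D : ℕ}
    (hdeg : (G.nbrsOff ∅ x).card ≤ D + 1) (hy : y ∈ A) (ha : G.Adj x y) :
    (G.nbrsOff A x).card ≤ D := by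
  have h : G.nbrsOff A x ⊆ (G.nbrsOff ∅ x).erase y := by
    intro z hz
    rw [mem_nbrsOff] at hz
    refine Finset.mem_erase.2 ⟨fun h => hz.1 (h ▸ hy), mem_nbrsOff.2 ⟨by simp, hz.2⟩⟩
  have h1 := Finset.card_le_card h
  rw [Finset.card_erase_of_mem (mem_nbrsOff.2 ⟨by simp, ha⟩)] at h1
  omega

theorem nbrsOff_anti {A B : Finset V} (h : A ⊆ B) (x : V) : G.nbrsOff B x ⊆ G.nbrsOff A x :=
  fun _ hz => mem_nbrsOff.2 ⟨fun hz' => (mem_nbrsOff.1 hz).1 (h hz'), (mem_nbrsOff.1 hz).2⟩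

/-- A percolation model with retention probabilities `P e ≤ p` on a graph whose degrees are at
most `D + 1`, where the mean offspring `D * p` is at most `M`. -/
structure NearCritical (G : SimpleGraph V) (P : Sym2 V → ℝ) (D : ℕ) (p M : ℝ) : Prop where
  mem : ∀ e, P e ∈ Set.Icc (0 : ℝ) 1
  le : ∀ e, P e ≤ p
  nonneg : 0 ≤ p
  le_one : p ≤ 1
  two_le : 2 ≤ D
  deg : ∀ x, (G.nbrsOff ∅ x).card ≤ D + 1
  mul_le : D * p ≤ M
  one_le : 1 ≤ M

variable {D : ℕ} {p M : ℝ}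

theorem NearCritical.succ_mul_le (h : NearCritical G P D p M) : (D + 1 : ℕ) * p ≤ 2 * M := by
  have h1 : (2 : ℝ) ≤ D := by exact_mod_cast h.two_le
  push_cast
  nlinarith [h.nonneg, h.mul_le]

/-- Recursive lower bound for the reciprocal of the survival probability. -/
noncomputable def survRecip (M : ℝ) : ℕ → ℝ
  | 0 => 1
  | k + 1 => survRecip M k / M + 1 / 4

theorem survRecip_ge {M : ℝ} (hM : 1 ≤ M) (k : ℕ) : (k : ℝ) / (4 * M ^ k) ≤ survRecip M k := by
  have hM0 : (0 : ℝ) < M := by linarith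
  induction k with
  | zero => simp [survRecip]
  | succ k ih =>
    rw [survRecip]
    have h1 : (k : ℝ) / (4 * M ^ (k + 1)) ≤ survRecip M k / M := by
      rw [le_div_iff₀ hM0]
      refine le_trans (le_of_eq ?_) ih
      rw [pow_succ]
      field_simp
    have h2 : (1 : ℝ) / (4 * M ^ (k + 1)) ≤ 1 / 4 := by
      apply one_div_le_one_div_of_le (by norm_num)
      have := one_le_pow₀ hM (n := k + 1)
      linarith
    push_cast
    rw [add_div]
    linarith

theorem survRecip_pos {M : ℝ} (hM : 1 ≤ M) (k : ℕ) : 0 < survRecip M k := by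
  induction k with
  | zero => simp [survRecip]
  | succ k ih => rw [survRecip]; positivity

/-- With at most `D` available neighbours, the bound `q` for `k` steps gives `1 - (1 - pq)^D` for `k
+ 1`, and `one_sub_pow_ge` turns this into the recursion for reciprocals. The hypothesis passes to a
neighbour `w`, for which `v` is no longer available. -/
theorem NearCritical.survives_le_recip (h : NearCritical G P D p M) (k : ℕ) :
    ∀ (A : Finset V) (v : V), (G.nbrsOff A v).card ≤ D →
      bernPr P (fun S => (G.retain S).Survives k A v) ≤ 1 / survRecip M k := by
  induction k with
  | zero =>
    intro A v _
    simp only [survRecip, div_one]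
    exact bernPr_le_one h.mem _
  | succ k ih =>
    intro A v hv
    refine (bernPr_survives_succ_le h.mem A v k).trans ?_
    have ha := survRecip_pos h.one_le k
    have hM0 : (0 : ℝ) < M := by linarith [h.one_le]
    -- The reciprocal bound can exceed 1 for small `k`; the cap keeps `p * q` in `[0, 1]`.
    set q := min 1 (1 / survRecip M k) with hq
    have hq0 : 0 ≤ q := le_min zero_le_one (by positivity)
    have hpq : p * q ≤ 1 := mul_le_one₀ h.le_one hq0 (min_le_left _ _)
    have hpq0 : 0 ≤ p * q := mul_nonneg h.nonneg hq0
    have h1 : (1 - p * q) ^ D ≤ ∏ w ∈ G.nbrsOff A v, (1 - P s(v, w) *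
        bernPr P (fun S => (G.retain S).Survives k (insert v A) w)) := by
      refine (pow_le_pow_of_le_one (by linarith) (by linarith) hv).trans ?_
      rw [← Finset.prod_const]
      refine Finset.prod_le_prod (fun _ _ => by linarith) fun w hw => ?_
      have h2 : bernPr P (fun S => (G.retain S).Survives k (insert v A) w) ≤ q := by
        refine le_min (bernPr_le_one h.mem _) (ih _ _ ?_)
        exact nbrsOff_card_le_of_adj (h.deg w) (Finset.mem_insert_self v A)
          (mem_nbrsOff.1 hw).2.symm
      have := mul_le_mul (h.le s(v, w)) h2 (bernPr_nonneg h.mem _) h.nonneg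
      linarith
    have h3 := one_sub_pow_ge hpq0 hpq h.two_le
    have h4 : (D : ℝ) * (p * q) ≤ M / survRecip M k := by
      rw [← mul_assoc, div_eq_mul_one_div]
      exact mul_le_mul h.mul_le (min_le_right _ _) hq0 hM0.le
    have h5 : (D : ℝ) * (p * q) / (1 + D * (p * q) / 4) ≤ 1 / survRecip M (k + 1) := by
      have h6 : 0 ≤ (D : ℝ) * (p * q) := by positivity
      have h7 : 1 / survRecip M (k + 1) =
          (M / survRecip M k) / (1 + (M / survRecip M k) / 4) := by
        rw [survRecip]
        field_simp
      rw [h7, div_le_div_iff₀ (by positivity) (by positivity)]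
      nlinarith
    linarith

/-- The starting vertex may have `D + 1` neighbours, so its first step is treated by a union bound
costing `(D + 1) p ≤ 2M`. The remaining steps give `4 M^k / k`, and `k + 1 ≤ 2k` turns 8 into 16. -/
theorem NearCritical.survives_le (h : NearCritical G P D p M) {k : ℕ} (hk : 1 ≤ k)
    (A : Finset V) (v : V) :
    bernPr P (fun S => (G.retain S).Survives k A v) ≤ 16 * M ^ k / k := by
  obtain ⟨k, rfl⟩ : ∃ j, k = j + 1 := ⟨k - 1, by omega⟩
  have hM0 : (0 : ℝ) < M := by linarith [h.one_le]
  have h1 : bernPr P (fun S => (G.retain S).Survives (k + 1) A v) ≤ 2 * M * (1 / survRecip M k) := by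
    have h2 : bernPr P (fun S => (G.retain S).Survives (k + 1) A v) ≤
        ∑ w ∈ G.nbrsOff A v, p * (1 / survRecip M k) := by
      have h3 : bernPr P (fun S => (G.retain S).Survives (k + 1) A v) = bernPr P (fun S =>
          ∃ w ∈ G.nbrsOff A v, s(v, w) ∈ S ∧ (G.retain S).Survives k (insert v A) w) := by
        congr 1
        ext S
        rw [survives_succ_iff]
      rw [h3]
      refine (bernPr_exists_le h.mem _ _).trans (Finset.sum_le_sum fun w hw => ?_)
      rw [bernPr_edge_and_survives (B := insert v A) le_rfl (Finset.mem_insert_self _ _)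
        (notMem_insert_of_mem_nbrsOff hw)]
      refine mul_le_mul (h.le _) (h.survives_le_recip k _ _ ?_) (bernPr_nonneg h.mem _) h.nonneg
      exact nbrsOff_card_le_of_adj (h.deg w) (Finset.mem_insert_self v A)
        (mem_nbrsOff.1 hw).2.symm
    refine h2.trans ?_
    rw [Finset.sum_const, nsmul_eq_mul, ← mul_assoc]
    refine mul_le_mul_of_nonneg_right ?_ (one_div_nonneg.2 (survRecip_pos h.one_le k).le)
    refine le_trans (mul_le_mul_of_nonneg_right ?_ h.nonneg) h.succ_mul_le
    exact_mod_cast (Finset.card_le_card (nbrsOff_anti (Finset.empty_subset A) v)).trans (h.deg v)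
  refine h1.trans ?_
  have hpow : M ≤ M ^ (k + 1) := le_self_pow₀ h.one_le (by omega)
  rcases Nat.eq_zero_or_pos k with rfl | hk0
  · simp only [survRecip]
    norm_num
    linarith
  · have hk1 : (1 : ℝ) ≤ k := by exact_mod_cast hk0
    have h8 : 1 / survRecip M k ≤ 4 * M ^ k / k := by
      rw [div_le_div_iff₀ (survRecip_pos h.one_le k) (by positivity), one_mul]
      have := survRecip_ge h.one_le k
      rw [div_le_iff₀ (by positivity)] at this
      linarith
    refine (mul_le_mul_of_nonneg_left h8 (by positivity)).trans ?_
    push_cast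
    rw [mul_div_assoc', div_le_div_iff₀ (by positivity) (by positivity), pow_succ]
    have : 0 < M ^ k := by positivity
    nlinarith [mul_pos this hM0]

/-- Domain Markov property for the exploration of a ball: the edges examined are those touching
the open ball. -/
theorem bernEx_level_le (hP : ∀ e, P e ∈ Set.Icc (0 : ℝ) 1) (v : V) (j : ℕ)
    (F : Finset (Sym2 V) → ℝ) (g : Finset V → Finset V → V → Finset (Sym2 V) → ℝ) (c : ℝ)
    (hF0 : ∀ S, 0 ≤ F S)
    (hF : ∀ S T, (∀ e ∈ touching ((G.retain S).bfsInner v j), e ∈ S ↔ e ∈ T) → F T = F S)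
    (hg : ∀ S x, x ∈ (G.retain S).bfsLevel v j →
      DepOn (g ((G.retain S).bfsInner v j) ((G.retain S).bfsBall v j) x)
        (touching ((G.retain S).bfsInner v j))ᶜ)
    (hc : ∀ S x, x ∈ (G.retain S).bfsLevel v j →
      bernEx P (g ((G.retain S).bfsInner v j) ((G.retain S).bfsBall v j) x) ≤ c) :
    bernEx P (fun S => F S * ∑ x ∈ (G.retain S).bfsLevel v j,
        g ((G.retain S).bfsInner v j) ((G.retain S).bfsBall v j) x S)
      ≤ c * bernEx P (fun S => F S * ((G.retain S).bfsLevel v j).card) := by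
  have h1 : ∀ (a : V → ℝ) (S : Finset (Sym2 V)), ∑ x ∈ (G.retain S).bfsLevel v j, a x
      = ∑ x, ind (x ∈ (G.retain S).bfsLevel v j) * a x := by
    intro a S
    rw [← Finset.sum_filter_add_sum_filter_not Finset.univ (· ∈ (G.retain S).bfsLevel v j)]
    rw [Finset.filter_univ_mem, Finset.sum_congr (s₁ := Finset.univ.filter _) rfl
      (g := fun _ => (0 : ℝ))]
    · rw [Finset.sum_const_zero, add_zero]
      exact Finset.sum_congr rfl fun x hx => by rw [ind_of hx, one_mul]
    · intro x hx
      rw [ind_of_not (Finset.mem_filter.1 hx).2, zero_mul]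
  have h2 : ∀ S, (((G.retain S).bfsLevel v j).card : ℝ)
      = ∑ x, ind (x ∈ (G.retain S).bfsLevel v j) := by
    intro S
    have := h1 (fun _ => 1) S
    simpa using this
  simp only [h1, h2, Finset.mul_sum, bernEx_sum]
  refine Finset.sum_le_sum fun x _ => ?_
  simp only [← mul_assoc]
  -- The outcome records both balls: `g` may refer to the closed ball, although only edges touching
  -- the open ball have been examined.
  refine bernEx_mul_le_of_stopping hP
    (fun S => ((G.retain S).bfsInner v j, (G.retain S).bfsBall v j)) (fun a => touching a.1)
    (fun S => F S * ind (x ∈ (G.retain S).bfsLevel v j)) (fun a => g a.1 a.2 x) c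
    ?_ (fun S => mul_nonneg (hF0 S) (ind_nonneg _)) ?_ ?_
  · intro S T h
    have hadj := retain_adj_congr (G := G) h
    rw [bfsBall_congr hadj j le_rfl, bfsInner_congr hadj j le_rfl, bfsLevel_congr hadj j le_rfl,
      hF S T h]
    exact ⟨rfl, rfl⟩
  · intro S hS
    exact hg S x (ind_ne_zero.1 (right_ne_zero_of_mul hS))
  · intro S hS
    exact hc S x (ind_ne_zero.1 (right_ne_zero_of_mul hS))

theorem bernEx_card_nbrsOff_le (h : NearCritical G P D p M) (A : Finset V) (x : V) :
    bernEx P (fun S => (((G.retain S).nbrsOff A x).card : ℝ)) ≤ (G.nbrsOff A x).card * p := by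
  simp only [retain_nbrsOff_card]
  rw [bernEx_sum, ← nsmul_eq_mul]
  refine Finset.sum_le_card_nsmul _ _ _ fun y _ => ?_
  exact (bernPr_mem P s(x, y)).trans_le (h.le _)

theorem depOn_card_nbrsOff {A B : Finset V} (hBA : B ⊆ A) {x : V} (hx : x ∉ B) :
    DepOn (fun S => (((G.retain S).nbrsOff A x).card : ℝ)) (touching B)ᶜ := by
  intro S T hST
  simp only [retain_nbrsOff_card]
  refine Finset.sum_congr rfl fun y hy => ?_
  have : s(x, y) ∈ S ↔ s(x, y) ∈ T := by
    refine hST _ ?_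
    rw [Set.mem_compl_iff, mk_mem_touching]
    rintro (h | h)
    · exact hx h
    · exact (mem_nbrsOff.1 hy).1 (hBA h)
  rw [this]

theorem NearCritical.bernEx_card_nbrsOff_le (h : NearCritical G P D p M) (A : Finset V) (x : V) :
    bernEx P (fun S => (((G.retain S).nbrsOff A x).card : ℝ)) ≤ 2 * M := by
  refine (SimpleGraph.bernEx_card_nbrsOff_le h A x).trans ?_
  refine le_trans (mul_le_mul_of_nonneg_right ?_ h.nonneg) h.succ_mul_le
  exact_mod_cast (Finset.card_le_card (nbrsOff_anti (Finset.empty_subset A) x)).trans (h.deg x)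

theorem card_bfsLevel_succ_le (H : SimpleGraph V) (v : V) (j : ℕ) :
    (H.bfsLevel v (j + 1)).card ≤ ∑ x ∈ H.bfsLevel v j, (H.nbrsOff (H.bfsBall v j) x).card := by
  refine (Finset.card_le_card (t := (H.bfsLevel v j).biUnion
    (H.nbrsOff (H.bfsBall v j))) ?_).trans Finset.card_biUnion_le
  intro w hw
  obtain ⟨u, hu, ha⟩ := exists_adj_of_mem_bfsLevel_succ hw
  exact Finset.mem_biUnion.2 ⟨u, hu, mem_nbrsOff.2 ⟨(mem_bfsLevel.1 hw).2, ha⟩⟩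

theorem NearCritical.bernEx_bfsLevel_succ_le (h : NearCritical G P D p M) (v : V) (j : ℕ) {c : ℝ}
    (hc : ∀ S x, x ∈ (G.retain S).bfsLevel v j →
      ((G.nbrsOff ((G.retain S).bfsBall v j) x).card : ℝ) * p ≤ c) :
    bernEx P (fun S => (((G.retain S).bfsLevel v (j + 1)).card : ℝ)) ≤
      c * bernEx P (fun S => (((G.retain S).bfsLevel v j).card : ℝ)) := by
  have := bernEx_level_le (G := G) h.mem v j (fun _ => 1)
    (fun _ A x S => (((G.retain S).nbrsOff A x).card : ℝ)) c (fun _ => zero_le_one)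
    (fun _ _ _ => rfl)
    (fun S x hx => depOn_card_nbrsOff (bfsInner_subset v j) (mem_bfsLevel.1 hx).2)
    (fun S x hx => (SimpleGraph.bernEx_card_nbrsOff_le h _ x).trans (hc S x hx))
  simp only [one_mul] at this
  refine (bernEx_mono h.mem fun S => ?_).trans this
  exact_mod_cast card_bfsLevel_succ_le _ v j

/-- Every vertex of a sphere of positive radius has a neighbour in the ball, so at most `D` edges
lead on and the sphere grows by a factor `M` in mean. Only the root can have `D + 1`, whence the
single factor 2. -/
theorem NearCritical.bernEx_card_bfsLevel_le (h : NearCritical G P D p M) (v : V) (j : ℕ) :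
    bernEx P (fun S => (((G.retain S).bfsLevel v j).card : ℝ)) ≤ 2 * M ^ j := by
  have hM0 : (0 : ℝ) < M := by linarith [h.one_le]
  rcases j with _ | j
  · have : ∀ S, (((G.retain S).bfsLevel v 0).card : ℝ) = 1 := by
      intro S; simp [bfsLevel, bfsBall, bfsInner]
    simp only [this, bernEx_const]
    norm_num
  · induction j with
    | zero =>
      have h1 := h.bernEx_bfsLevel_succ_le v 0 (c := 2 * M) (fun S x _ => by
        refine le_trans (mul_le_mul_of_nonneg_right ?_ h.nonneg) h.succ_mul_le
        exact_mod_cast (Finset.card_le_card (nbrsOff_anti (Finset.empty_subset _) x)).trans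
          (h.deg x))
      have : ∀ S, (((G.retain S).bfsLevel v 0).card : ℝ) = 1 := by
        intro S; simp [bfsLevel, bfsBall, bfsInner]
      simp only [this, bernEx_const] at h1
      simpa using h1
    | succ j ih =>
      have h1 := h.bernEx_bfsLevel_succ_le v (j + 1) (c := M) (fun S x hx => by
        obtain ⟨u, hu, ha⟩ := exists_adj_of_mem_bfsLevel_succ hx
        refine le_trans (mul_le_mul_of_nonneg_right ?_ h.nonneg) h.mul_le
        exact_mod_cast nbrsOff_card_le_of_adj (h.deg x)
          (bfsBall_mono v (Nat.le_succ j) (mem_bfsLevel.1 hu).1) ha.symm.1)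
      refine h1.trans ((mul_le_mul_of_nonneg_left ih hM0.le).trans (le_of_eq ?_))
      ring

theorem NearCritical.bernEx_bfsForward_le (h : NearCritical G P D p M) (v : V) (j : ℕ) :
    bernEx P (fun S => ((G.retain S).bfsForward v j : ℝ)) ≤ 4 * M ^ (j + 1) := by
  have hM0 : (0 : ℝ) < M := by linarith [h.one_le]
  have := bernEx_level_le (G := G) h.mem v j (fun _ => 1)
    (fun A _ x S => (((G.retain S).nbrsOff A x).card : ℝ)) (2 * M) (fun _ => zero_le_one)
    (fun _ _ _ => rfl)
    (fun S x hx => depOn_card_nbrsOff le_rfl (mem_bfsLevel.1 hx).2)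
    (fun S x hx => h.bernEx_card_nbrsOff_le _ x)
  simp only [one_mul] at this
  simp only [bfsForward, Nat.cast_sum]
  refine this.trans ((mul_le_mul_of_nonneg_left (h.bernEx_card_bfsLevel_le v j)
    (by positivity)).trans (le_of_eq ?_))
  ring

theorem retain_lanes_card (A : Finset V) (x : V) (t : ℕ) (S : Finset (Sym2 V))
    [DecidablePred fun y => (G.retain S).Survives t A y] :
    ((((G.retain S).nbrsOff A x).filter fun y => (G.retain S).Survives t A y).card : ℝ)
      = ∑ y ∈ G.nbrsOff A x, ind (s(x, y) ∈ S ∧ (G.retain S).Survives t A y) := by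
  classical
  have : ((G.retain S).nbrsOff A x).filter (fun y => (G.retain S).Survives t A y)
      = (G.nbrsOff A x).filter fun y => s(x, y) ∈ S ∧ (G.retain S).Survives t A y := by
    ext y
    simp only [mem_nbrsOff, Finset.mem_filter, retain_adj]
    tauto
  rw [this, Finset.card_filter]
  push_cast
  exact Finset.sum_congr rfl fun y _ => by simp [ind]

/-- Given the open ball, the retention of `xy` and the survival of `y` off the closed ball are
independent, of probability at most `p * (16 M^t / t)`. There are at most `D + 1` choices of `y`,
giving the factor `2M`, and the sphere has mean size at most `2 M^j`. -/
theorem NearCritical.bernEx_bfsLanes_le (h : NearCritical G P D p M) (v : V) (j : ℕ) {t : ℕ}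
    (ht : 1 ≤ t) :
    bernEx P (fun S => ((G.retain S).bfsLanes v j t : ℝ)) ≤ 64 * M ^ (j + 1 + t) / t := by
  classical
  have hM0 : (0 : ℝ) < M := by linarith [h.one_le]
  have := bernEx_level_le (G := G) h.mem v j (fun _ => 1)
    (fun _ A x S => ∑ y ∈ G.nbrsOff A x, ind (s(x, y) ∈ S ∧ (G.retain S).Survives t A y))
    (2 * M * (16 * M ^ t / t)) (fun _ => zero_le_one) (fun _ _ _ => rfl)
    (fun S x hx T T' hT => by
      refine Finset.sum_congr rfl fun y hy => ?_
      have hy' : y ∉ (G.retain S).bfsInner v j :=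
        fun h => (mem_nbrsOff.1 hy).1 (bfsInner_subset v j h)
      have h1 : (s(x, y) ∈ T) = (s(x, y) ∈ T') := depOn_mem_edge (by
        rw [Set.mem_compl_iff, mk_mem_touching]
        rintro (h | h)
        · exact (mem_bfsLevel.1 hx).2 h
        · exact hy' h) T T' hT
      have h2 := depOn_survives (G := G) (bfsInner_subset (H := G.retain S) v j) hy' t T T' hT
      simp only at h2
      rw [h1, h2])
    (fun S x hx => by
      rw [bernEx_sum]
      refine (Finset.sum_le_card_nsmul _ _ (p * (16 * M ^ t / t)) fun y hy => ?_).trans ?_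
      · refine (bernPr_edge_and_survives (B := (G.retain S).bfsBall v j) le_rfl
          (mem_bfsLevel.1 hx).1 (mem_nbrsOff.1 hy).1 t).trans_le ?_
        exact mul_le_mul (h.le _) (h.survives_le ht _ _) (bernPr_nonneg h.mem _) h.nonneg
      · rw [nsmul_eq_mul, ← mul_assoc]
        refine mul_le_mul_of_nonneg_right ?_ (by positivity)
        refine le_trans (mul_le_mul_of_nonneg_right ?_ h.nonneg) h.succ_mul_le
        exact_mod_cast (Finset.card_le_card (nbrsOff_anti (Finset.empty_subset _) x)).trans
          (h.deg x))
  simp only [one_mul] at this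
  simp only [bfsLanes, Nat.cast_sum, retain_lanes_card]
  refine this.trans ((mul_le_mul_of_nonneg_left (h.bernEx_card_bfsLevel_le v j)
    (by positivity)).trans (le_of_eq ?_))
  field_simp
  ring

theorem NearCritical.bernPr_bfsLevel_nonempty_le (h : NearCritical G P D p M) (v : V) {k : ℕ}
    (hk : 1 ≤ k) :
    bernPr P (fun S => ((G.retain S).bfsLevel v k).Nonempty) ≤ 16 * M ^ k / k := by
  refine (bernPr_mono h.mem fun S hS => ?_).trans (h.survives_le hk ∅ v)
  obtain ⟨w, hw⟩ := hS
  obtain ⟨u, hu, hs⟩ := exists_survives_of_mem_bfsLevel (j := 0) (i := k) (by simpa using hw)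
  obtain rfl : u = v := by simpa [bfsLevel, bfsBall, bfsInner] using hu
  exact hs ∅ (by simp)

/-- A sphere with few vertices is unlikely to be continued. -/
theorem NearCritical.bernPr_small_level_le (h : NearCritical G P D p M) (v : V) {a b t R : ℕ}
    (ht : 1 ≤ t) (hR : b + t ≤ R) {s : ℝ} (hs : 0 ≤ s) :
    bernPr P (fun S => ((G.retain S).bfsLevel v R).Nonempty ∧
        ∃ j, a ≤ j ∧ j ≤ b ∧ (((G.retain S).bfsLevel v j).card : ℝ) ≤ s)
      ≤ s * (16 * M ^ t / t) * bernPr P (fun S => ((G.retain S).bfsLevel v a).Nonempty) := by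
  have hM0 : (0 : ℝ) < M := by linarith [h.one_le]
  let small : ℕ → Finset (Sym2 V) → Prop := fun j S => (((G.retain S).bfsLevel v j).card : ℝ) ≤ s
  -- Splitting according to the first small sphere gives disjoint events, each decided by the
  -- exploration up to that sphere. Their probabilities sum to at most that of the sphere of radius
  -- `a` being nonempty, so there is no loss of the number of radii.
  let first : ℕ → Finset (Sym2 V) → Prop := fun j S =>
    ((G.retain S).bfsLevel v j).Nonempty ∧ small j S ∧ ∀ i, a ≤ i → i < j → ¬ small i S
  have hdep : ∀ j S T, (∀ e ∈ touching ((G.retain S).bfsInner v j), e ∈ S ↔ e ∈ T) →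
      (first j T ↔ first j S) := by
    intro j S T hST
    have hadj := bfsLevel_congr (retain_adj_congr (G := G) hST)
    simp only [first, small, hadj j le_rfl]
    refine and_congr_right fun _ => and_congr_right fun _ => forall_congr' fun i =>
      forall_congr' fun _ => forall_congr' fun hij => ?_
    rw [hadj i hij.le]
  have h1 : ∀ j ∈ Finset.Icc a b, bernPr P (fun S => first j S ∧
      ∃ x ∈ (G.retain S).bfsLevel v j, (G.retain S).Survives t ((G.retain S).bfsInner v j) x)
      ≤ s * (16 * M ^ t / t) * bernPr P (first j) := by
    intro j _
    have := bernEx_level_le (G := G) h.mem v j (fun S => ind (first j S))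
      (fun A _ x S => ind ((G.retain S).Survives t A x)) (16 * M ^ t / t)
      (fun S => ind_nonneg _) (fun S T hST => by rw [hdep j S T hST])
      (fun S x hx T T' hT => by
        have := depOn_survives (G := G) (B := (G.retain S).bfsInner v j) le_rfl
          (mem_bfsLevel.1 hx).2 t T T' hT
        exact congrArg ind this)
      (fun S x hx => h.survives_le ht _ _)
    refine (bernEx_mono h.mem fun S => ?_).trans (this.trans ?_)
    · rw [ind_and]
      refine mul_le_mul_of_nonneg_left ?_ (ind_nonneg _)
      by_cases hex : ∃ x ∈ (G.retain S).bfsLevel v j,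
          (G.retain S).Survives t ((G.retain S).bfsInner v j) x
      · rw [ind_of hex]
        obtain ⟨x, hx, hsx⟩ := hex
        rw [← ind_of hsx]
        exact Finset.single_le_sum
          (f := fun x => ind ((G.retain S).Survives t ((G.retain S).bfsInner v j) x))
          (fun _ _ => ind_nonneg _) hx
      · rw [ind_of_not hex]
        exact Finset.sum_nonneg fun _ _ => ind_nonneg _
    · rw [mul_comm s, mul_assoc]
      refine mul_le_mul_of_nonneg_left ?_ (by positivity)
      rw [bernPr, ← bernEx_mul_left]
      refine bernEx_mono h.mem fun S => ?_
      by_cases hf : first j S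
      · rw [ind_of hf, one_mul, mul_one]; exact hf.2.1
      · simp [ind_of_not hf]
  calc _ ≤ bernPr P (fun S => ∃ j ∈ Finset.Icc a b, first j S ∧
      ∃ x ∈ (G.retain S).bfsLevel v j,
        (G.retain S).Survives t ((G.retain S).bfsInner v j) x) := by
        refine bernPr_mono h.mem fun S hS => ?_
        obtain ⟨⟨w, hw⟩, hex⟩ := hS
        classical
        have hne : ∃ j, a ≤ j ∧ j ≤ b ∧ small j S := hex
        have hf := Nat.find_spec hne
        set j := Nat.find hne
        refine ⟨j, Finset.mem_Icc.2 ⟨hf.1, hf.2.1⟩, ⟨?_, hf.2.2, ?_⟩, ?_⟩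
        · exact bfsLevel_nonempty_of_le (by omega) ⟨w, hw⟩
        · intro i hai hij hsm
          exact Nat.find_min hne hij ⟨hai, by omega, hsm⟩
        · obtain ⟨w', hw'⟩ := bfsLevel_nonempty_of_le (i := j + t) (by omega) ⟨w, hw⟩
          obtain ⟨u, hu, hsu⟩ := exists_survives_of_mem_bfsLevel hw'
          exact ⟨u, hu, hsu _ (bfsInner_subset v j)⟩
    _ ≤ ∑ j ∈ Finset.Icc a b, s * (16 * M ^ t / t) * bernPr P (first j) :=
        (bernPr_exists_le h.mem _ _).trans (Finset.sum_le_sum h1)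
    _ ≤ _ := by
        rw [← Finset.mul_sum]
        refine mul_le_mul_of_nonneg_left ?_ (by positivity)
        simp only [bernPr]
        rw [← bernEx_sum]
        refine bernEx_mono h.mem fun S => ?_
        by_cases hex : ∃ j ∈ Finset.Icc a b, first j S
        · obtain ⟨j, hj, hfj⟩ := hex
          rw [ind_of (bfsLevel_nonempty_of_le (Finset.mem_Icc.1 hj).1 hfj.1),
            Finset.sum_eq_single_of_mem j hj, ind_of hfj]
          intro i hi hij
          refine ind_of_not fun hfi => ?_
          rcases lt_or_gt_of_ne hij with hlt | hlt
          · exact hfj.2.2 i (Finset.mem_Icc.1 hi).1 hlt hfi.2.1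
          · exact hfi.2.2 j (Finset.mem_Icc.1 hj).1 hlt hfj.2.1
        · push Not at hex
          rw [Finset.sum_eq_zero fun j hj => ind_of_not (hex j hj)]
          exact ind_nonneg _

end

end SimpleGraph

namespace SimpleGraph

variable {W : Type*} [Fintype W] [DecidableEq W] (H : SimpleGraph W)

/-! ### The lazy walk as a positive self-adjoint operator: Dirichlet form and decay -/

section WalkOperator

open Matrix

/-- The degree, as a real number. -/
noncomputable def rdeg (x : W) : ℝ := (H.neighborSet x).ncard

/-- The indicator of adjacency. -/
noncomputable def adjInd (x y : W) : ℝ := ind (H.Adj x y)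

/-- The inner product weighted by degrees. -/
noncomputable def degInner (f g : W → ℝ) : ℝ := ∑ x, H.rdeg x * (f x * g x)

/-- The sum of the squared differences along all oriented edges. -/
noncomputable def dirichlet (f : W → ℝ) : ℝ := ∑ x, ∑ y, H.adjInd x y * (f x - f y) ^ 2

variable {H}

theorem adjInd_comm (x y : W) : H.adjInd x y = H.adjInd y x := by
  rw [adjInd, adjInd, H.adj_comm]

theorem rdeg_eq_sum (x : W) : H.rdeg x = ∑ y, H.adjInd x y := by
  classical
  have : H.neighborSet x = ((Finset.univ.filter fun y => H.Adj x y : Finset W) : Set W) := by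
    ext y; simp
  rw [rdeg, this, Set.ncard_coe_finset, Finset.card_filter]
  push_cast
  exact Finset.sum_congr rfl fun y _ => by simp [adjInd, ind]

theorem rdeg_nonneg (x : W) : 0 ≤ H.rdeg x := by rw [rdeg]; positivity

theorem rdeg_mul_lazyWalk (hd : ∀ x, 0 < H.rdeg x) (x y : W) :
    H.rdeg x * H.lazyWalk x y = (if x = y then H.rdeg x / 2 else 0) + H.adjInd x y / 2 := by
  have h := hd x
  have h' : ((H.neighborSet x).ncard : ℝ) ≠ 0 := h.ne'
  simp only [lazyWalk, Matrix.of_apply, adjInd, ind]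
  by_cases hxy : x = y
  · subst hxy
    simp
    ring
  · by_cases ha : H.Adj x y
    · simp only [hxy, ha, if_false, if_true, rdeg]
      field_simp
      ring
    · simp [hxy, ha]

theorem lazyWalk_row_sum (hd : ∀ x, 0 < H.rdeg x) (x : W) : ∑ y, H.lazyWalk x y = 1 := by
  have h : H.rdeg x * ∑ y, H.lazyWalk x y = H.rdeg x := by
    rw [Finset.mul_sum, Finset.sum_congr rfl fun y _ => rdeg_mul_lazyWalk hd x y,
      Finset.sum_add_distrib, Finset.sum_ite_eq, if_pos (Finset.mem_univ x), ← Finset.sum_div,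
      ← rdeg_eq_sum]
    ring
  exact mul_left_cancel₀ (hd x).ne' (by rw [h, mul_one])

theorem lazyWalk_nonneg (x y : W) : 0 ≤ H.lazyWalk x y := by
  simp only [lazyWalk, Matrix.of_apply]
  split_ifs <;> positivity

theorem lazyWalk_pow_nonneg (t : ℕ) (x y : W) : 0 ≤ (H.lazyWalk ^ t) x y := by
  induction t generalizing x y with
  | zero =>
    rw [pow_zero, Matrix.one_apply]
    split_ifs <;> norm_num
  | succ t ih =>
    rw [pow_succ, Matrix.mul_apply]
    exact Finset.sum_nonneg fun z _ => mul_nonneg (ih x z) (lazyWalk_nonneg z y)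

theorem lazyWalk_pow_mulVec_one (hd : ∀ x, 0 < H.rdeg x) (t : ℕ) :
    (H.lazyWalk ^ t) *ᵥ (fun _ => (1 : ℝ)) = fun _ => 1 := by
  induction t with
  | zero => simp
  | succ t ih =>
    rw [pow_succ, ← Matrix.mulVec_mulVec]
    have : H.lazyWalk *ᵥ (fun _ => (1 : ℝ)) = fun _ => 1 := by
      ext x
      simp [Matrix.mulVec, dotProduct, lazyWalk_row_sum hd]
    rw [this, ih]

theorem degInner_comm (f g : W → ℝ) : H.degInner f g = H.degInner g f := by
  simp only [degInner, mul_comm (f _)]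

theorem degInner_sub_right (f g k : W → ℝ) :
    H.degInner f (g - k) = H.degInner f g - H.degInner f k := by
  simp only [degInner, ← Finset.sum_sub_distrib, Pi.sub_apply]
  exact Finset.sum_congr rfl fun _ _ => by ring

theorem degInner_sub_left (f g k : W → ℝ) :
    H.degInner (f - g) k = H.degInner f k - H.degInner g k := by
  rw [degInner_comm, degInner_sub_right, degInner_comm k, degInner_comm k]

theorem degInner_self_nonneg (f : W → ℝ) : 0 ≤ H.degInner f f :=
  Finset.sum_nonneg fun x _ => mul_nonneg (rdeg_nonneg x) (mul_self_nonneg _)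

theorem degInner_lazyWalk (hd : ∀ x, 0 < H.rdeg x) (f g : W → ℝ) :
    H.degInner f (H.lazyWalk *ᵥ g)
      = H.degInner f g / 2 + (∑ x, ∑ y, H.adjInd x y * (f x * g y)) / 2 := by
  have h : ∀ x, H.rdeg x * (f x * (H.lazyWalk *ᵥ g) x)
      = H.rdeg x * (f x * g x) / 2 + (∑ y, H.adjInd x y * (f x * g y)) / 2 := by
    intro x
    have h1 : H.rdeg x * (f x * (H.lazyWalk *ᵥ g) x)
        = ∑ y, (H.rdeg x * H.lazyWalk x y) * (f x * g y) := by
      simp only [Matrix.mulVec, dotProduct, Finset.mul_sum]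
      exact Finset.sum_congr rfl fun _ _ => by ring
    rw [h1, Finset.sum_congr rfl fun y _ => by rw [rdeg_mul_lazyWalk hd, add_mul, ite_mul, zero_mul],
      Finset.sum_add_distrib, Finset.sum_ite_eq, if_pos (Finset.mem_univ x), Finset.sum_div]
    congr 1
    · ring
    · exact Finset.sum_congr rfl fun _ _ => by ring
  rw [degInner, Finset.sum_congr rfl fun x _ => h x, Finset.sum_add_distrib, ← Finset.sum_div,
    ← Finset.sum_div, degInner]

theorem sum_adjInd_comm (F : W → W → ℝ) :
    ∑ x, ∑ y, H.adjInd x y * F x y = ∑ x, ∑ y, H.adjInd x y * F y x := by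
  rw [Finset.sum_comm]
  exact Finset.sum_congr rfl fun x _ => Finset.sum_congr rfl fun y _ => by rw [adjInd_comm]

theorem degInner_lazyWalk_comm (hd : ∀ x, 0 < H.rdeg x) (f g : W → ℝ) :
    H.degInner f (H.lazyWalk *ᵥ g) = H.degInner (H.lazyWalk *ᵥ f) g := by
  rw [degInner_comm (H.lazyWalk *ᵥ f), degInner_lazyWalk hd, degInner_lazyWalk hd,
    degInner_comm f g, sum_adjInd_comm fun x y => f x * g y]
  simp only [mul_comm (f _)]

theorem degInner_self_eq (f : W → ℝ) :
    2 * H.degInner f f = ∑ x, ∑ y, H.adjInd x y * (f x ^ 2 + f y ^ 2) := by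
  have h : H.degInner f f = ∑ x, ∑ y, H.adjInd x y * f x ^ 2 := by
    refine Finset.sum_congr rfl fun x _ => ?_
    rw [rdeg_eq_sum, Finset.sum_mul]
    exact Finset.sum_congr rfl fun _ _ => by ring
  have h' := sum_adjInd_comm (H := H) fun x _ => f x ^ 2
  simp only [mul_add, Finset.sum_add_distrib]
  rw [← h', ← h]
  ring

theorem degInner_sub_lazyWalk (hd : ∀ x, 0 < H.rdeg x) (f : W → ℝ) :
    H.degInner f f - H.degInner f (H.lazyWalk *ᵥ f) = H.dirichlet f / 4 := by
  have h1 := degInner_self_eq (H := H) f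
  have h2 : H.dirichlet f = ∑ x, ∑ y, H.adjInd x y * (f x ^ 2 + f y ^ 2)
      - 2 * ∑ x, ∑ y, H.adjInd x y * (f x * f y) := by
    simp only [dirichlet, Finset.mul_sum, ← Finset.sum_sub_distrib]
    exact Finset.sum_congr rfl fun _ _ => Finset.sum_congr rfl fun _ _ => by ring
  rw [degInner_lazyWalk hd, h2, ← h1]
  ring

/-- This is where laziness matters: the form equals one quarter of the sum of `(f x + f y)^2` over
oriented edges. -/
theorem degInner_lazyWalk_nonneg (hd : ∀ x, 0 < H.rdeg x) (f : W → ℝ) :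
    0 ≤ H.degInner f (H.lazyWalk *ᵥ f) := by
  have h1 := degInner_self_eq (H := H) f
  have h2 : (0 : ℝ) ≤ ∑ x, ∑ y, H.adjInd x y * (f x + f y) ^ 2 :=
    Finset.sum_nonneg fun _ _ => Finset.sum_nonneg fun _ _ =>
      mul_nonneg (ind_nonneg _) (sq_nonneg _)
  have h3 : ∑ x, ∑ y, H.adjInd x y * (f x + f y) ^ 2
      = ∑ x, ∑ y, H.adjInd x y * (f x ^ 2 + f y ^ 2)
      + 2 * ∑ x, ∑ y, H.adjInd x y * (f x * f y) := by
    simp only [Finset.mul_sum, ← Finset.sum_add_distrib]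
    exact Finset.sum_congr rfl fun _ _ => Finset.sum_congr rfl fun _ _ => by ring
  rw [degInner_lazyWalk hd]
  linarith

theorem degInner_pow_comm (hd : ∀ x, 0 < H.rdeg x) (t : ℕ) (f g : W → ℝ) :
    H.degInner f ((H.lazyWalk ^ t) *ᵥ g) = H.degInner ((H.lazyWalk ^ t) *ᵥ f) g := by
  induction t generalizing f g with
  | zero => simp
  | succ t ih =>
    rw [pow_succ, ← Matrix.mulVec_mulVec, ih, degInner_lazyWalk_comm hd, Matrix.mulVec_mulVec,
      ← pow_succ', pow_succ]

theorem degInner_pow_add (hd : ∀ x, 0 < H.rdeg x) (s t : ℕ) (f : W → ℝ) :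
    H.degInner f ((H.lazyWalk ^ (s + t)) *ᵥ f)
      = H.degInner ((H.lazyWalk ^ s) *ᵥ f) ((H.lazyWalk ^ t) *ᵥ f) := by
  rw [pow_add, ← Matrix.mulVec_mulVec, degInner_pow_comm hd]

theorem degInner_pow_nonneg (hd : ∀ x, 0 < H.rdeg x) (t : ℕ) (f : W → ℝ) :
    0 ≤ H.degInner f ((H.lazyWalk ^ t) *ᵥ f) := by
  rcases Nat.even_or_odd' t with ⟨u, rfl | rfl⟩
  · rw [two_mul, degInner_pow_add hd]
    exact degInner_self_nonneg _
  · rw [two_mul, add_assoc, degInner_pow_add hd, pow_succ', ← Matrix.mulVec_mulVec]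
    exact degInner_lazyWalk_nonneg hd _

/-- The decrements of `t ↦ ⟪f, P ^ t f⟫` are non-increasing. -/
theorem degInner_pow_convex (hd : ∀ x, 0 < H.rdeg x) (t : ℕ) (f : W → ℝ) :
    H.degInner f ((H.lazyWalk ^ (t + 1)) *ᵥ f) - H.degInner f ((H.lazyWalk ^ (t + 2)) *ᵥ f)
      ≤ H.degInner f ((H.lazyWalk ^ t) *ᵥ f) - H.degInner f ((H.lazyWalk ^ (t + 1)) *ᵥ f) := by
  -- The second difference of the sequence is the form of `P^t` evaluated at `f - P f`.
  have h := degInner_pow_nonneg hd t (f - H.lazyWalk *ᵥ f)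
  rw [Matrix.mulVec_sub, degInner_sub_right, degInner_sub_left, degInner_sub_left,
    Matrix.mulVec_mulVec, ← pow_succ, ← degInner_lazyWalk_comm hd, ← degInner_lazyWalk_comm hd,
    Matrix.mulVec_mulVec, Matrix.mulVec_mulVec, ← pow_succ', ← pow_succ'] at h
  linarith

theorem degInner_pow_sub_even (hd : ∀ x, 0 < H.rdeg x) (u : ℕ) (f : W → ℝ) :
    H.degInner f ((H.lazyWalk ^ (2 * u)) *ᵥ f) - H.degInner f ((H.lazyWalk ^ (2 * u + 1)) *ᵥ f)
      = H.dirichlet ((H.lazyWalk ^ u) *ᵥ f) / 4 := by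
  rw [← degInner_sub_lazyWalk hd, two_mul, add_assoc, degInner_pow_add hd, degInner_pow_add hd,
    pow_succ', Matrix.mulVec_mulVec]

theorem dirichlet_nonneg (f : W → ℝ) : 0 ≤ H.dirichlet f :=
  Finset.sum_nonneg fun _ _ => Finset.sum_nonneg fun _ _ => mul_nonneg (ind_nonneg _) (sq_nonneg _)

theorem degInner_pow_sub_nonneg (hd : ∀ x, 0 < H.rdeg x) (t : ℕ) (f : W → ℝ) :
    0 ≤ H.degInner f ((H.lazyWalk ^ t) *ᵥ f) - H.degInner f ((H.lazyWalk ^ (t + 1)) *ᵥ f) := by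
  rcases Nat.even_or_odd' t with ⟨u, rfl | rfl⟩
  · rw [degInner_pow_sub_even hd]
    linarith [dirichlet_nonneg (H := H) ((H.lazyWalk ^ u) *ᵥ f)]
  · have h1 := degInner_pow_convex hd (2 * u + 1) f
    have h2 := degInner_pow_sub_even hd (u + 1) f
    rw [show 2 * (u + 1) = 2 * u + 1 + 1 by ring] at h2
    linarith [dirichlet_nonneg (H := H) ((H.lazyWalk ^ (u + 1)) *ᵥ f)]

theorem degInner_pow_antitone (hd : ∀ x, 0 < H.rdeg x) (f : W → ℝ) :
    Antitone fun t => H.degInner f ((H.lazyWalk ^ t) *ᵥ f) :=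
  antitone_nat_of_succ_le fun t => by linarith [degInner_pow_sub_nonneg hd t f]

/-- By convexity each decrement is at most the first one, which is `H.dirichlet f / 4`. -/
theorem degInner_sub_pow_le (hd : ∀ x, 0 < H.rdeg x) (t : ℕ) (f : W → ℝ) :
    H.degInner f f - H.degInner f ((H.lazyWalk ^ t) *ᵥ f) ≤ t * (H.dirichlet f / 4) := by
  have hstep : ∀ t, H.degInner f ((H.lazyWalk ^ t) *ᵥ f)
      - H.degInner f ((H.lazyWalk ^ (t + 1)) *ᵥ f) ≤ H.dirichlet f / 4 := by
    intro t
    induction t with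
    | zero =>
      rw [← degInner_sub_lazyWalk hd]
      simp
    | succ t ih => exact (degInner_pow_convex hd t f).trans ih
  induction t with
  | zero => simp
  | succ t ih =>
    have := hstep t
    push_cast
    linarith

theorem rdeg_mul_pow_comm (hd : ∀ x, 0 < H.rdeg x) (t : ℕ) (x y : W) :
    H.rdeg x * (H.lazyWalk ^ t) x y = H.rdeg y * (H.lazyWalk ^ t) y x := by
  have h := degInner_pow_comm hd t (Pi.single x 1) (Pi.single y 1)
  rw [degInner_comm ((H.lazyWalk ^ t) *ᵥ _)] at h
  simp only [degInner, Pi.single_apply, ite_mul, one_mul, zero_mul, mul_ite, mul_zero,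
    Finset.sum_ite_eq', Finset.mem_univ, if_true, Matrix.mulVec_single_one] at h
  simpa using h

theorem lazyWalk_pow_row_sum (hd : ∀ x, 0 < H.rdeg x) (t : ℕ) (x : W) :
    ∑ y, (H.lazyWalk ^ t) x y = 1 := by
  have := congrFun (lazyWalk_pow_mulVec_one hd t) x
  simpa [Matrix.mulVec, dotProduct] using this

theorem degInner_sub_pow_eq (hd : ∀ x, 0 < H.rdeg x) (t : ℕ) (f : W → ℝ) :
    2 * (H.degInner f f - H.degInner f ((H.lazyWalk ^ t) *ᵥ f))
      = ∑ x, ∑ y, H.rdeg x * (H.lazyWalk ^ t) x y * (f x - f y) ^ 2 := by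
  have h1 : H.degInner f f = ∑ x, ∑ y, H.rdeg x * (H.lazyWalk ^ t) x y * f x ^ 2 := by
    refine Finset.sum_congr rfl fun x _ => ?_
    rw [← Finset.sum_mul, ← Finset.mul_sum, lazyWalk_pow_row_sum hd]
    ring
  have h2 : H.degInner f f = ∑ x, ∑ y, H.rdeg x * (H.lazyWalk ^ t) x y * f y ^ 2 := by
    rw [h1, Finset.sum_comm]
    exact Finset.sum_congr rfl fun _ _ => Finset.sum_congr rfl fun _ _ => by
      rw [rdeg_mul_pow_comm hd]
  have h3 : H.degInner f ((H.lazyWalk ^ t) *ᵥ f)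
      = ∑ x, ∑ y, H.rdeg x * (H.lazyWalk ^ t) x y * (f x * f y) := by
    refine Finset.sum_congr rfl fun x _ => ?_
    simp only [Matrix.mulVec, dotProduct, Finset.mul_sum]
    exact Finset.sum_congr rfl fun _ _ => by ring
  have h4 : ∑ x, ∑ y, H.rdeg x * (H.lazyWalk ^ t) x y * (f x - f y) ^ 2
      = ∑ x, ∑ y, H.rdeg x * (H.lazyWalk ^ t) x y * f x ^ 2
      + ∑ x, ∑ y, H.rdeg x * (H.lazyWalk ^ t) x y * f y ^ 2
      - 2 * ∑ x, ∑ y, H.rdeg x * (H.lazyWalk ^ t) x y * (f x * f y) := by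
    simp only [Finset.mul_sum, ← Finset.sum_add_distrib, ← Finset.sum_sub_distrib]
    exact Finset.sum_congr rfl fun _ _ => Finset.sum_congr rfl fun _ _ => by ring
  rw [h4, ← h1, ← h2, ← h3]
  ring

/-- If all laws at time `t` give mass at most `1 / 2` to `U`, then a function which is `1` on `S`
and vanishes off `U` yields a lower bound for `t`. -/
theorem sum_rdeg_le_mul_dirichlet (hd : ∀ x, 0 < H.rdeg x) (t : ℕ) (f : W → ℝ) (S U : Finset W)
    (hS : ∀ x ∈ S, f x = 1) (hU : ∀ x, x ∉ U → f x = 0)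
    (ht : ∀ x, ∑ y ∈ U, (H.lazyWalk ^ t) x y ≤ 1 / 2) :
    ∑ x ∈ S, H.rdeg x ≤ t * H.dirichlet f := by
  have h1 := degInner_sub_pow_le hd t f
  have h2 := degInner_sub_pow_eq hd t f
  -- From a point of `S`, at least half of the mass at time `t` lies off `U`, where `f` differs by
  -- 1. The resulting half matches the `t / 2` obtained from twice the convexity bound.
  have h3 : ∑ x ∈ S, H.rdeg x * (1 / 2)
      ≤ ∑ x, ∑ y, H.rdeg x * (H.lazyWalk ^ t) x y * (f x - f y) ^ 2 := by
    have h0 : ∀ x y, 0 ≤ H.rdeg x * (H.lazyWalk ^ t) x y * (f x - f y) ^ 2 := fun x y =>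
      mul_nonneg (mul_nonneg (rdeg_nonneg x) (lazyWalk_pow_nonneg t x y)) (sq_nonneg _)
    refine le_trans (Finset.sum_le_sum fun x hx => ?_) (Finset.sum_le_sum_of_subset_of_nonneg
      (Finset.subset_univ S) fun x _ _ => Finset.sum_nonneg fun y _ => h0 x y)
    refine le_trans ?_ (Finset.sum_le_sum_of_subset_of_nonneg
      (Finset.subset_univ Uᶜ) fun y _ _ => h0 x y)
    have h4 : ∑ y ∈ Uᶜ, H.rdeg x * (H.lazyWalk ^ t) x y * (f x - f y) ^ 2
        = H.rdeg x * ∑ y ∈ Uᶜ, (H.lazyWalk ^ t) x y := by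
      rw [Finset.mul_sum]
      refine Finset.sum_congr rfl fun y hy => ?_
      rw [hS x hx, hU y (Finset.mem_compl.1 hy)]
      ring
    rw [h4]
    refine mul_le_mul_of_nonneg_left ?_ (rdeg_nonneg x)
    have h5 := Finset.sum_add_sum_compl U fun y => (H.lazyWalk ^ t) x y
    rw [lazyWalk_pow_row_sum hd] at h5
    linarith [ht x]
  rw [← Finset.sum_mul] at h3
  linarith

/-- Cauchy–Schwarz for the telescoping sum along a walk, proved edge by edge. -/
theorem Walk.sq_sub_le (f : W → ℝ) : ∀ {x z : W} (p : H.Walk x z),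
    (f x - f z) ^ 2 ≤ p.length * (p.darts.map fun d => (f d.fst - f d.snd) ^ 2).sum
  | _, _, .nil => by simp
  | x, z, .cons (v := y) h p => by
    have ih := p.sq_sub_le f
    rw [Walk.length_cons, Walk.darts_cons, List.map_cons, List.sum_cons]
    set s := (p.darts.map fun d => (f d.fst - f d.snd) ^ 2).sum with hs
    have hs0 : 0 ≤ s := List.sum_nonneg fun a ha => by
      obtain ⟨d, -, rfl⟩ := List.mem_map.1 ha
      exact sq_nonneg _
    push_cast
    set l : ℝ := (p.length : ℝ)
    have hl : 0 ≤ l := Nat.cast_nonneg _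
    set a := f x - f y
    set b := f y - f z
    have : f x - f z = a + b := by simp only [a, b]; ring
    rw [this]
    rcases hl.eq_or_lt with h0 | h0
    · have hb : b = 0 := by
        rw [← h0, zero_mul] at ih
        exact pow_eq_zero_iff (two_ne_zero) |>.1 (le_antisymm ih (sq_nonneg _))
      rw [hb, ← h0]
      nlinarith
    · have h1 : 2 * a * b ≤ l * a ^ 2 + b ^ 2 / l := by
        have : 0 ≤ (l * a - b) ^ 2 / l := by positivity
        have e : (l * a - b) ^ 2 / l = l * a ^ 2 - 2 * a * b + b ^ 2 / l := by
          field_simp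
          ring
        linarith
      have h2 : b ^ 2 / l ≤ s := by rw [div_le_iff₀ h0]; linarith
      nlinarith

/-- A path traverses each oriented edge at most once, so its energy is part of the Dirichlet sum. -/
theorem Walk.IsPath.sq_sub_le {x z : W} {p : H.Walk x z} (hp : p.IsPath) (f : W → ℝ) :
    (f x - f z) ^ 2 ≤ p.length * H.dirichlet f := by
  classical
  refine (p.sq_sub_le f).trans (mul_le_mul_of_nonneg_left ?_ (Nat.cast_nonneg _))
  have hnd : p.darts.Nodup := by
    have := hp.isTrail.edges_nodup
    exact List.Nodup.of_map _ this
  have hinj : Function.Injective (fun d : H.Dart => d.toProd) := Dart.toProd_injective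
  have h1 : (p.darts.map fun d => (f d.fst - f d.snd) ^ 2).sum
      = ∑ q ∈ (p.darts.toFinset.image fun d => d.toProd),
        H.adjInd q.1 q.2 * (f q.1 - f q.2) ^ 2 := by
    rw [Finset.sum_image hinj.injOn, ← List.sum_toFinset _ hnd]
    refine Finset.sum_congr rfl fun d _ => ?_
    rw [adjInd, ind_of d.adj, one_mul]
  rw [h1, dirichlet, ← Finset.sum_product', Finset.univ_product_univ]
  exact Finset.sum_le_sum_of_subset_of_nonneg (Finset.subset_univ _)
    fun q _ _ => mul_nonneg (ind_nonneg _) (sq_nonneg _)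

/-- Discrete form of `u' ≤ -u²/R`. The induction step uses `(R - u T)(R - u) ≥ 0` for the current
value `u`. -/
theorem decay_of_sq_le {u : ℕ → ℝ} {R : ℝ} (hR : 0 < R) (h0 : ∀ t, 0 ≤ u t)
    (h : ∀ t, u t ^ 2 ≤ R * (u t - u (t + 1))) (T : ℕ) : u T * T ≤ R := by
  induction T with
  | zero => simpa using hR.le
  | succ T ih =>
    have h1 := h T
    have h2 := h0 T
    have h3 := h0 (T + 1)
    push_cast
    rcases T.eq_zero_or_pos with rfl | hT
    · simp only [Nat.cast_zero, zero_add, mul_one] at *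
      have h4 : R * u 1 ≤ R * R := by nlinarith [sq_nonneg (u 0 - R / 2)]
      exact le_of_mul_le_mul_left h4 hR
    · have hT1 : (1 : ℝ) ≤ T := by exact_mod_cast hT
      have h4 : u T ≤ R := by nlinarith
      have h5 : 0 ≤ (R - u T * T) * (R - u T) := mul_nonneg (by linarith) (by linarith)
      have h6 : R * (u (T + 1) * (T + 1)) ≤ R * R := by nlinarith
      exact le_of_mul_le_mul_left h6 hR

theorem sum_rdeg (H : SimpleGraph W) : ∑ x, H.rdeg x = 2 * H.edgeSet.ncard := by
  classical
  have h := H.sum_degrees_eq_twice_card_edges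
  have h1 : ∀ x, H.rdeg x = H.degree x := by
    intro x
    rw [rdeg, ← card_neighborSet_eq_degree, Set.ncard_eq_toFinset_card', Set.toFinset_card]
  simp only [h1]
  rw [← coe_edgeFinset, Set.ncard_coe_finset]
  exact_mod_cast h

/-- Decay of the distance to stationarity in `L²`. -/
theorem Connected.sum_sq_sub_stationary_le (hH : H.Connected) (hd : ∀ x, 0 < H.rdeg x) {R : ℕ}
    (hR0 : 0 < R) (hR : ∀ x y, H.dist x y ≤ R) (x : W) (t : ℕ) :
    (∑ y, H.rdeg y * ((H.lazyWalk ^ t) x y / H.rdeg y - 1 / (2 * H.edgeSet.ncard)) ^ 2) * (t : ℝ)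
      ≤ 4 * (R : ℝ) := by
  set c : ℝ := 1 / (2 * H.edgeSet.ncard) with hc
  have hm : c * ∑ x, H.rdeg x = 1 := by
    have : 0 < ∑ x, H.rdeg x :=
      Finset.sum_pos (fun x _ => hd x) ⟨x, Finset.mem_univ x⟩
    rw [hc, ← sum_rdeg]
    field_simp
  -- The density of the point mass at `x` with respect to degrees, minus the equilibrium density
  -- `c`. It is orthogonal to constants.
  let g : W → ℝ := fun y => (if y = x then 1 / H.rdeg x else 0) - c
  have hg1 : ∀ t, H.degInner (fun _ => 1) ((H.lazyWalk ^ t) *ᵥ g) = 0 := by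
    intro t
    rw [degInner_pow_comm hd, lazyWalk_pow_mulVec_one hd]
    simp only [degInner, g, one_mul, mul_sub, Finset.sum_sub_distrib, mul_ite, mul_zero,
      Finset.sum_ite_eq', Finset.mem_univ, if_true]
    rw [← Finset.sum_mul, mul_comm _ c, hm, mul_one_div_cancel (hd x).ne', sub_self]
  have hgx : ∀ t, H.degInner g ((H.lazyWalk ^ t) *ᵥ g) = ((H.lazyWalk ^ t) *ᵥ g) x := by
    intro t
    have h2 : H.degInner g ((H.lazyWalk ^ t) *ᵥ g) = H.rdeg x * (1 / H.rdeg x) *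
        ((H.lazyWalk ^ t) *ᵥ g) x - c * H.degInner (fun _ => 1) ((H.lazyWalk ^ t) *ᵥ g) := by
      simp only [degInner, g, sub_mul, mul_sub, Finset.sum_sub_distrib, ite_mul, zero_mul, mul_ite,
        mul_zero, Finset.sum_ite_eq', Finset.mem_univ, if_true, Finset.mul_sum]
      congr 1
      · ring
      · exact Finset.sum_congr rfl fun _ _ => by ring
    rw [h2, hg1, mul_one_div_cancel (hd x).ne']
    ring
  have hgy : ∀ t y, ((H.lazyWalk ^ t) *ᵥ g) y = (H.lazyWalk ^ t) x y / H.rdeg y - c := by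
    intro t y
    have h3 : ((H.lazyWalk ^ t) *ᵥ g) y = (H.lazyWalk ^ t) y x * (1 / H.rdeg x) - c := by
      simp only [Matrix.mulVec, dotProduct, g, mul_sub, Finset.sum_sub_distrib, mul_ite, mul_zero,
        Finset.sum_ite_eq', Finset.mem_univ, if_true, ← Finset.sum_mul, lazyWalk_pow_row_sum hd,
        one_mul]
    rw [h3, mul_one_div, div_eq_div_iff (hd x).ne' (hd y).ne' |>.2]
    linarith [rdeg_mul_pow_comm hd t x y]
  let u : ℕ → ℝ := fun t => H.degInner g ((H.lazyWalk ^ (2 * t)) *ᵥ g)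
  have hu : ∀ t, u t = ∑ y, H.rdeg y * ((H.lazyWalk ^ t) x y / H.rdeg y - c) ^ 2 := by
    intro t
    simp only [u]
    rw [two_mul, degInner_pow_add hd, degInner]
    refine Finset.sum_congr rfl fun y _ => ?_
    rw [hgy]
    ring
  rw [← hu]
  refine decay_of_sq_le (by positivity) (fun t => degInner_pow_nonneg hd _ g) (fun t => ?_) t
  have hanti := degInner_pow_antitone hd g
  have h1 : u t ≤ ((H.lazyWalk ^ t) *ᵥ g) x := by
    rw [← hgx]
    exact hanti (by omega : t ≤ 2 * t)
  have hu0 : 0 ≤ u t := degInner_pow_nonneg hd _ g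
  -- Since `P^t g` has mean zero it is nonpositive at some `z`, so `u t` is at most its drop from
  -- `x` to `z`. A geodesic of length at most `R` bounds the squared drop by `R` times the energy,
  -- and the energy is at most four times the decrement of `u`.
  obtain ⟨z, hz⟩ : ∃ z, ((H.lazyWalk ^ t) *ᵥ g) z ≤ 0 := by
    by_contra hcon
    push Not at hcon
    have : 0 < H.degInner (fun _ => 1) ((H.lazyWalk ^ t) *ᵥ g) :=
      Finset.sum_pos (fun y _ => mul_pos (hd y) (by simpa using hcon y)) ⟨x, Finset.mem_univ x⟩
    linarith [hg1 t]
  obtain ⟨p, hp, hlen⟩ := hH.exists_path_of_dist x z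
  have h2 := hp.sq_sub_le ((H.lazyWalk ^ t) *ᵥ g)
  have h3 : (p.length : ℝ) ≤ R := by rw [hlen]; exact_mod_cast hR x z
  have h4 : u t ^ 2 ≤ (((H.lazyWalk ^ t) *ᵥ g) x - ((H.lazyWalk ^ t) *ᵥ g) z) ^ 2 :=
    pow_le_pow_left₀ hu0 (by linarith) 2
  have h5 : H.dirichlet ((H.lazyWalk ^ t) *ᵥ g) / 4 ≤ u t - u (t + 1) := by
    rw [← degInner_pow_sub_even hd]
    have := hanti (by omega : 2 * t + 1 ≤ 2 * (t + 1))
    simp only [u]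
    linarith
  have h6 := mul_le_mul_of_nonneg_right h3 (dirichlet_nonneg (H := H) ((H.lazyWalk ^ t) *ᵥ g))
  have h7 : (0 : ℝ) ≤ R := by positivity
  nlinarith [mul_le_mul_of_nonneg_left h5 h7]

end WalkOperator

/-! ### Bounds for the mixing time: volume times diameter, and volume over energy -/

section MixingTime

variable {H}

/-- Matrix powers involve a finiteness and a decidability instance; any two choices agree, so the
ambient ones can replace those of the definition. -/
theorem mixingTime_eq : H.mixingTime =
    sInf {t : ℕ | ∀ x : W, tvDist (fun y => (H.lazyWalk ^ t) x y) H.walkStationary ≤ 1 / 4} := by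
  have key : ∀ (i i' : Fintype W) (j j' : DecidableEq W),
      sInf {t : ℕ | ∀ x : W, tvDist (fun y => (letI := i; letI := j; H.lazyWalk ^ t) x y)
        H.walkStationary ≤ 1 / 4} =
      sInf {t : ℕ | ∀ x : W, tvDist (fun y => (letI := i'; letI := j'; H.lazyWalk ^ t) x y)
        H.walkStationary ≤ 1 / 4} := by
    intro i i' j j'
    obtain rfl : i = i' := Subsingleton.elim _ _
    obtain rfl : j = j' := Subsingleton.elim _ _
    rfl
  exact key (Fintype.ofFinite W) _ (fun a b => Classical.propDecidable (a = b)) _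

theorem abs_sum_sub_le_tvDist (μ ν : W → ℝ) (A : Finset W) :
    |∑ x ∈ A, μ x - ∑ x ∈ A, ν x| ≤ tvDist μ ν :=
  le_ciSup (f := fun A : Finset W => |∑ x ∈ A, μ x - ∑ x ∈ A, ν x|)
    (Set.finite_range _).bddAbove A

theorem walkStationary_eq (x : W) :
    H.walkStationary x = H.rdeg x * (1 / (2 * H.edgeSet.ncard)) := by
  rw [walkStationary, rdeg, mul_one_div]

/-- Cauchy–Schwarz bounds the squared difference on a set by `2m u`, with `u` the squared `L²`
distance. At `t = 128 m R` the decay gives `u ≤ 4R/t = 1/(32m)`, so the square is at most `1/16`. -/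
theorem Connected.tvDist_le (hH : H.Connected) (hd : ∀ x, 0 < H.rdeg x) {R : ℕ}
    (hR0 : 0 < R) (hR : ∀ x y, H.dist x y ≤ R) (x : W) :
    tvDist (fun y => (H.lazyWalk ^ (128 * H.edgeSet.ncard * R)) x y) H.walkStationary ≤ 1 / 4 := by
  set m := H.edgeSet.ncard with hm
  set t := 128 * m * R with ht
  have hsum : ∑ x, H.rdeg x = 2 * m := sum_rdeg H
  have hm0 : (0 : ℝ) < m := by
    have : 0 < ∑ x, H.rdeg x := Finset.sum_pos (fun x _ => hd x) ⟨x, Finset.mem_univ x⟩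
    linarith
  have hR' : (0 : ℝ) < R := by exact_mod_cast hR0
  have h1 := hH.sum_sq_sub_stationary_le hd hR0 hR x t
  rw [← hm] at h1
  set c : ℝ := 1 / (2 * m)
  set u := ∑ y, H.rdeg y * ((H.lazyWalk ^ t) x y / H.rdeg y - c) ^ 2 with hu
  have h2 : u * (32 * m) ≤ 1 := by
    have : (t : ℝ) = 128 * m * R := by rw [ht]; push_cast; ring
    rw [this] at h1
    have : 4 * R * (u * (32 * m)) ≤ 4 * R * 1 := by linarith
    exact le_of_mul_le_mul_left this (by positivity)
  have : Nonempty (Finset W) := ⟨∅⟩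
  refine ciSup_le fun A => ?_
  have h3 : ∑ y ∈ A, (H.lazyWalk ^ t) x y - ∑ y ∈ A, H.walkStationary y
      = ∑ y ∈ A, H.rdeg y * ((H.lazyWalk ^ t) x y / H.rdeg y - c) := by
    rw [← Finset.sum_sub_distrib]
    refine Finset.sum_congr rfl fun y _ => ?_
    rw [walkStationary_eq, mul_sub, mul_div_cancel₀ _ (hd y).ne']
  have h4 : (∑ y ∈ A, H.rdeg y * ((H.lazyWalk ^ t) x y / H.rdeg y - c)) ^ 2 ≤ 2 * m * u := by
    have hcs := Finset.sum_mul_sq_le_sq_mul_sq A (fun y => √(H.rdeg y))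
      fun y => √(H.rdeg y) * ((H.lazyWalk ^ t) x y / H.rdeg y - c)
    simp only [mul_pow, ← mul_assoc, Real.mul_self_sqrt (rdeg_nonneg _),
      Real.sq_sqrt (rdeg_nonneg _)] at hcs
    refine hcs.trans (mul_le_mul ?_ ?_ ?_ (by positivity))
    · rw [← hsum]
      exact Finset.sum_le_sum_of_subset_of_nonneg (Finset.subset_univ A) fun y _ _ => rdeg_nonneg y
    · exact Finset.sum_le_sum_of_subset_of_nonneg (Finset.subset_univ A)
        fun y _ _ => mul_nonneg (rdeg_nonneg y) (sq_nonneg _)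
    · exact Finset.sum_nonneg fun y _ => mul_nonneg (rdeg_nonneg y) (sq_nonneg _)
  rw [h3]
  refine abs_le_of_sq_le_sq (h4.trans ?_) (by norm_num)
  nlinarith

theorem Connected.mixingTime_le (hH : H.Connected) (hd : ∀ x, 0 < H.rdeg x) {R : ℕ}
    (hR0 : 0 < R) (hR : ∀ x y, H.dist x y ≤ R) :
    H.mixingTime ≤ 128 * H.edgeSet.ncard * R := by
  rw [mixingTime_eq]
  exact Nat.sInf_le fun x => hH.tvDist_le hd hR0 hR x

theorem Connected.sum_rdeg_le_mixingTime_mul (hH : H.Connected) (hd : ∀ x, 0 < H.rdeg x)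
    (f : W → ℝ) (S U : Finset W) (hS : ∀ x ∈ S, f x = 1) (hU : ∀ x, x ∉ U → f x = 0)
    (hπ : 2 * ∑ x ∈ U, H.rdeg x ≤ H.edgeSet.ncard) :
    ∑ x ∈ S, H.rdeg x ≤ H.mixingTime * H.dirichlet f := by
  obtain ⟨x₀⟩ := hH.nonempty
  have hmem : H.mixingTime ∈
      {t : ℕ | ∀ x : W, tvDist (fun y => (H.lazyWalk ^ t) x y) H.walkStationary ≤ 1 / 4} := by
    rw [mixingTime_eq]
    -- The upper bound shows that the set of mixed times is nonempty, so the infimum is attained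
    -- rather than a default value. Adding 1 to the diameter supplies a positive radius.
    refine Nat.sInf_mem ⟨_, fun x => hH.tvDist_le hd (R := H.diam + 1) (Nat.succ_pos _) ?_ x⟩
    intro x y
    have : Nonempty W := ⟨x₀⟩
    exact (dist_le_diam (connected_iff_ediam_ne_top.1 hH)).trans (Nat.le_succ _)
  refine sum_rdeg_le_mul_dirichlet hd _ f S U hS hU fun x => ?_
  have h1 := (abs_le.1 ((abs_sum_sub_le_tvDist _ _ U).trans (hmem x))).2
  have hsum : ∑ x, H.rdeg x = 2 * H.edgeSet.ncard := sum_rdeg H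
  have hm0 : (0 : ℝ) < H.edgeSet.ncard := by
    have : 0 < ∑ x, H.rdeg x := Finset.sum_pos (fun x _ => hd x) ⟨x, Finset.mem_univ x⟩
    linarith
  -- Stationary mass `1/4` plus total variation error `1/4` gives the bound `1/2` needed at the
  -- mixing time.
  have h2 : ∑ y ∈ U, H.walkStationary y ≤ 1 / 4 := by
    simp only [walkStationary_eq]
    rw [← Finset.sum_mul, mul_one_div, div_le_iff₀ (by positivity)]
    linarith
  linarith

end MixingTime

end SimpleGraph

namespace SimpleGraph

/-! ### A test function of small energy built from lanes -/

section TestFunction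

variable {V : Type*} [Fintype V] [DecidableEq V] (H : SimpleGraph V)

/-- The vertices which are connected to the complement of the ball of radius `R` by a walk off the
ball of radius `i`. -/
def farSide (v : V) (R i : ℕ) : Set V :=
  {z | ∃ u, u ∉ H.bfsBall v R ∧ ∃ p : H.Walk z u, ∀ x ∈ p.support, x ∉ H.bfsBall v i}

/-- The proportion of the radii `i ∈ [s, 2s)` for which `x` is on the inner side of the cut formed
by the lanes leaving the ball of radius `i`. -/
noncomputable def laneFun (v : V) (s : ℕ) (x : V) : ℝ :=
  1 - (∑ i ∈ Finset.Ico s (2 * s), ind (x ∈ H.farSide v (3 * s) i)) / s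

variable {H}

theorem notMem_bfsBall_of_mem_farSide {v z : V} {R i : ℕ} (h : z ∈ H.farSide v R i) :
    z ∉ H.bfsBall v i := by
  obtain ⟨u, -, p, hp⟩ := h
  exact hp z p.start_mem_support

theorem laneFun_eq_one {v x : V} {s : ℕ} (h : x ∈ H.bfsBall v s) : H.laneFun v s x = 1 := by
  rw [laneFun, Finset.sum_eq_zero, zero_div, sub_zero]
  intro i hi
  exact ind_of_not fun hx => notMem_bfsBall_of_mem_farSide hx
    (bfsBall_mono v (Finset.mem_Ico.1 hi).1 h)

theorem laneFun_eq_zero {v x : V} {s : ℕ} (hs : 0 < s) (h : x ∉ H.bfsBall v (3 * s)) :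
    H.laneFun v s x = 0 := by
  have h1 : ∀ i ∈ Finset.Ico s (2 * s), ind (x ∈ H.farSide v (3 * s) i) = 1 := by
    intro i hi
    rw [Finset.mem_Ico] at hi
    refine ind_of ⟨x, h, .nil, fun y hy => ?_⟩
    obtain rfl : y = x := by simpa using hy
    exact fun hy' => h (bfsBall_mono v (by omega) hy')
  have hs' : (0 : ℝ) < s := by exact_mod_cast hs
  rw [laneFun, Finset.sum_congr rfl h1]
  simp only [Finset.sum_const, Nat.card_Ico, nsmul_eq_mul, mul_one]
  rw [show 2 * s - s = s by omega, div_self hs'.ne', sub_self]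

/-- Off the ball of radius `i`, `x` could be prepended to the walk of `z` and would be on the far
side. So `x` is in the ball, and having the neighbour `z` outside puts it on the sphere. -/
theorem mem_bfsLevel_of_farSide {v x z : V} {R i : ℕ} (ha : H.Adj x z)
    (hz : z ∈ H.farSide v R i) (hx : x ∉ H.farSide v R i) : x ∈ H.bfsLevel v i := by
  have hxi : x ∈ H.bfsBall v i := by
    by_contra hxi
    obtain ⟨u, hu, p, hp⟩ := hz
    refine hx ⟨u, hu, .cons ha p, fun y hy => ?_⟩
    rw [Walk.support_cons, List.mem_cons] at hy
    rcases hy with rfl | hy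
    · exact hxi
    · exact hp y hy
  refine mem_bfsLevel.2 ⟨hxi, fun hx' => notMem_bfsBall_of_mem_farSide hz ?_⟩
  cases i with
  | zero => simp [bfsInner] at hx'
  | succ i => exact mem_bfsBall_succ.2 (Or.inr ⟨x, hx', ha⟩)

theorem survives_of_mem_farSide {v z : V} {R i : ℕ} (hz : z ∈ H.farSide v R i)
    (hzi : z ∈ H.bfsBall v (i + 1)) {t : ℕ} (ht : t + i ≤ R) :
    H.Survives t (H.bfsBall v i) z := by
  obtain ⟨u, hu, p, hp⟩ := hz
  refine (p.toPath : H.Walk z u).survives p.toPath.2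
    (fun x hx => hp x (p.support_toPath_subset_support hx)) ?_
  by_contra hlt
  exact hu (bfsBall_mono v (by omega) ((p.toPath : H.Walk z u).mem_bfsBall hzi))

/-- The oriented edges crossing the cut at radius `i` outwards are lanes. -/
theorem sum_cut_le_bfsLanes (v : V) {s i : ℕ} (hi : i ∈ Finset.Ico s (2 * s)) :
    ∑ x, ∑ z, H.adjInd x z * ind (z ∈ H.farSide v (3 * s) i ∧ x ∉ H.farSide v (3 * s) i)
      ≤ H.bfsLanes v i s := by
  classical
  rw [Finset.mem_Ico] at hi
  let F : Finset (V × V) := (H.bfsLevel v i).biUnion fun x =>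
    ((H.nbrsOff (H.bfsBall v i) x).filter fun y => H.Survives s (H.bfsBall v i) y).image
      fun y => (x, y)
  have hcard : F.card ≤ H.bfsLanes v i s := by
    refine Finset.card_biUnion_le.trans (le_trans (Finset.sum_le_sum fun x _ =>
      Finset.card_image_le) (le_of_eq ?_))
    rw [bfsLanes]
  have h1 : ∀ q : V × V, H.adjInd q.1 q.2 *
      ind (q.2 ∈ H.farSide v (3 * s) i ∧ q.1 ∉ H.farSide v (3 * s) i) ≤ if q ∈ F then 1 else 0 := by
    rintro ⟨x, z⟩
    rw [adjInd, ← ind_and]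
    by_cases h : H.Adj x z ∧ z ∈ H.farSide v (3 * s) i ∧ x ∉ H.farSide v (3 * s) i
    · rw [ind_of h, if_pos]
      obtain ⟨ha, hz, hx⟩ := h
      have hxl := mem_bfsLevel_of_farSide ha hz hx
      refine Finset.mem_biUnion.2 ⟨x, hxl, Finset.mem_image_of_mem _ (Finset.mem_filter.2 ⟨?_, ?_⟩)⟩
      · exact mem_nbrsOff.2 ⟨notMem_bfsBall_of_mem_farSide hz, ha⟩
      · exact survives_of_mem_farSide hz
          (mem_bfsBall_succ.2 (Or.inr ⟨x, (mem_bfsLevel.1 hxl).1, ha⟩)) (by omega)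
    · rw [ind_of_not h]
      split_ifs <;> norm_num
  rw [← Finset.sum_product', Finset.univ_product_univ]
  refine (Finset.sum_le_sum fun q _ => h1 q).trans ?_
  rw [Finset.sum_ite_mem, Finset.univ_inter, Finset.sum_const, nsmul_eq_mul, mul_one]
  exact_mod_cast hcard

/-- An edge crosses the cut of at most one radius, because a crossing joins the sphere of that
radius to the outside of its ball. Hence the square of a sum of increments is the sum of their
squares, and averaging over `s` radii gains `1/s^2` per crossing edge. The factor 2 counts
orientations. -/
theorem dirichlet_laneFun_le (v : V) {s : ℕ} (hs : 0 < s) :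
    H.dirichlet (H.laneFun v s)
      ≤ 2 / (s : ℝ) ^ 2 * ∑ i ∈ Finset.Ico s (2 * s), (H.bfsLanes v i s : ℝ) := by
  have hs' : (0 : ℝ) < s := by exact_mod_cast hs
  let a : ℕ → V → ℝ := fun i x => ind (x ∈ H.farSide v (3 * s) i)
  let cut : V → V → ℕ → Prop := fun x z i => z ∈ H.farSide v (3 * s) i ∧ x ∉ H.farSide v (3 * s) i
  have hdiff : ∀ x z i, (a i z - a i x) ^ 2 = ind (cut x z i) + ind (cut z x i) := by
    intro x z i
    by_cases h1 : x ∈ H.farSide v (3 * s) i <;> by_cases h2 : z ∈ H.farSide v (3 * s) i <;>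
      simp [a, cut, ind, h1, h2]
  have hlow : ∀ x z i, H.Adj x z → a i z - a i x ≠ 0 →
      (x ∈ H.bfsLevel v i ∧ z ∉ H.bfsBall v i) ∨ (z ∈ H.bfsLevel v i ∧ x ∉ H.bfsBall v i) := by
    intro x z i ha hne
    by_cases h1 : x ∈ H.farSide v (3 * s) i <;> by_cases h2 : z ∈ H.farSide v (3 * s) i
    · simp [a, ind, h1, h2] at hne
    · exact Or.inr ⟨mem_bfsLevel_of_farSide ha.symm h1 h2, notMem_bfsBall_of_mem_farSide h1⟩
    · exact Or.inl ⟨mem_bfsLevel_of_farSide ha h2 h1, notMem_bfsBall_of_mem_farSide h2⟩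
    · simp [a, ind, h1, h2] at hne
  have huniq : ∀ x z i j, H.Adj x z → i < j → a i z - a i x = 0 ∨ a j z - a j x = 0 := by
    intro x z i j ha hij
    by_contra! hcon
    have key : ∀ {x z}, x ∈ H.bfsLevel v i → H.Adj x z →
        ((x ∈ H.bfsLevel v j ∧ z ∉ H.bfsBall v j) ∨ (z ∈ H.bfsLevel v j ∧ x ∉ H.bfsBall v j)) →
        False := by
      intro x z hx ha h
      have hxi := (mem_bfsLevel.1 hx).1
      have hz : z ∈ H.bfsBall v (i + 1) := mem_bfsBall_succ.2 (Or.inr ⟨x, hxi, ha⟩)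
      rcases h with ⟨-, h⟩ | ⟨-, h⟩
      · exact h (bfsBall_mono v hij hz)
      · exact h (bfsBall_mono v hij.le hxi)
    rcases hlow x z i ha hcon.1 with ⟨h, -⟩ | ⟨h, -⟩
    · exact key h ha (hlow x z j ha hcon.2)
    · exact key h ha.symm (hlow x z j ha hcon.2).symm
  have hsq : ∀ x z, H.Adj x z → (∑ i ∈ Finset.Ico s (2 * s), (a i z - a i x)) ^ 2
      = ∑ i ∈ Finset.Ico s (2 * s), (a i z - a i x) ^ 2 := by
    intro x z ha
    rw [sq, Finset.sum_mul_sum]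
    refine Finset.sum_congr rfl fun i hi => ?_
    rw [Finset.sum_eq_single_of_mem i hi, sq]
    intro j _ hji
    rcases lt_or_gt_of_ne hji with h | h
    · rcases huniq x z j i ha h with h | h <;> rw [h] <;> ring
    · rcases huniq x z i j ha h with h | h <;> rw [h] <;> ring
  have hterm : ∀ x z, H.adjInd x z * (H.laneFun v s x - H.laneFun v s z) ^ 2
      = 1 / (s : ℝ) ^ 2 * ∑ i ∈ Finset.Ico s (2 * s),
        (H.adjInd x z * ind (cut x z i) + H.adjInd x z * ind (cut z x i)) := by
    intro x z
    by_cases ha : H.Adj x z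
    · have e : H.laneFun v s x - H.laneFun v s z
          = (∑ i ∈ Finset.Ico s (2 * s), (a i z - a i x)) / s := by
        rw [laneFun, laneFun, Finset.sum_sub_distrib, sub_div]
        ring
      rw [adjInd, ind_of ha, e, div_pow, hsq x z ha, Finset.sum_congr rfl fun i _ => hdiff x z i]
      simp only [one_mul]
      ring
    · simp [adjInd, ind_of_not ha]
  have htot : H.dirichlet (H.laneFun v s) = 2 / (s : ℝ) ^ 2 * ∑ i ∈ Finset.Ico s (2 * s),
      ∑ x, ∑ z, H.adjInd x z * ind (cut x z i) := by
    have e : ∀ i, ∑ x, ∑ z, H.adjInd x z * ind (cut z x i)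
        = ∑ x, ∑ z, H.adjInd x z * ind (cut x z i) := fun i =>
      (sum_adjInd_comm fun x z => ind (cut x z i)).symm
    have e2 : ∑ x, ∑ z, ∑ i ∈ Finset.Ico s (2 * s),
        (H.adjInd x z * ind (cut x z i) + H.adjInd x z * ind (cut z x i))
        = 2 * ∑ i ∈ Finset.Ico s (2 * s), ∑ x, ∑ z, H.adjInd x z * ind (cut x z i) := by
      rw [Finset.sum_congr rfl fun x _ => Finset.sum_comm, Finset.sum_comm, Finset.mul_sum]
      refine Finset.sum_congr rfl fun i _ => ?_
      simp only [Finset.sum_add_distrib]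
      rw [e]
      ring
    rw [dirichlet, Finset.sum_congr rfl fun x _ => Finset.sum_congr rfl fun z _ => hterm x z]
    simp only [← Finset.mul_sum]
    rw [e2]
    ring
  rw [htot]
  exact mul_le_mul_of_nonneg_left (Finset.sum_le_sum fun i hi => sum_cut_le_bfsLanes v hi)
    (by positivity)

end TestFunction

/-! ### Transfer between a component and the ambient graph; splitting a component at an edge -/

section Component

variable {V : Type*} [Fintype V] [DecidableEq V] {H : SimpleGraph V}

open Classical in
/-- The sum of the degrees in the component of `v`. -/
noncomputable def degSum (H : SimpleGraph V) (v : V) : ℕ :=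
  ∑ x ∈ Finset.univ.filter (H.Reachable v), (H.nbrsOff ∅ x).card

theorem rdeg_eq_card_nbrsOff (x : V) : H.rdeg x = (H.nbrsOff ∅ x).card := by
  classical
  have : H.neighborSet x = (H.nbrsOff ∅ x : Set V) := by
    ext y; simp [mem_nbrsOff]
  rw [rdeg, this, Set.ncard_coe_finset]

namespace ConnectedComponent

variable (C : H.ConnectedComponent)

open Classical in
/-- The vertices of a component as a finset. -/
noncomputable def verts : Finset V := Finset.univ.filter (· ∈ C.supp)

variable {C}

theorem mem_verts {x : V} : x ∈ C.verts ↔ x ∈ C.supp := by simp [verts]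

theorem ncard_supp : C.supp.ncard = C.verts.card := by
  rw [← Set.ncard_coe_finset]
  congr 1
  ext x
  simp [verts]

theorem verts_eq {v : V} [DecidablePred (H.Reachable v)] (hv : v ∈ C.supp) :
    C.verts = Finset.univ.filter (H.Reachable v) := by
  ext x
  simp only [mem_verts, Finset.mem_filter, Finset.mem_univ, true_and]
  refine ⟨fun hx => C.reachable_of_mem_supp hv hx, fun hx => ?_⟩
  rw [mem_supp_iff] at *
  rw [← hv]
  exact ConnectedComponent.sound hx.symm

theorem sum_verts [Fintype C] (F : V → ℝ) : ∑ x ∈ C.verts, F x = ∑ x : C, F x := by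
  refine (Finset.sum_bij (fun (x : C) _ => (x : V)) ?_ ?_ ?_ ?_).symm
  · exact fun x _ => mem_verts.2 x.2
  · exact fun x _ y _ h => Subtype.ext h
  · exact fun x hx => ⟨⟨x, mem_verts.1 hx⟩, Finset.mem_univ _, rfl⟩
  · exact fun _ _ => rfl

theorem rdeg_toSimpleGraph (x : C) : C.toSimpleGraph.rdeg x = H.rdeg (x : V) := by
  rw [rdeg, rdeg]
  have : H.neighborSet (x : V) = Subtype.val '' (C.toSimpleGraph.neighborSet x) := by
    ext y
    simp only [mem_neighborSet, Set.mem_image]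
    constructor
    · intro h
      exact ⟨⟨y, C.mem_supp_of_adj_mem_supp x.2 h⟩, h, rfl⟩
    · rintro ⟨z, hz, rfl⟩
      exact hz
  rw [this, Set.ncard_image_of_injective _ Subtype.val_injective]

theorem two_mul_ncard_edgeSet {v : V} (hv : v ∈ C.supp) :
    2 * C.toSimpleGraph.edgeSet.ncard = H.degSum v := by
  classical
  have := sum_rdeg C.toSimpleGraph
  simp only [rdeg_toSimpleGraph] at this
  rw [← sum_verts H.rdeg, verts_eq hv] at this
  simp only [rdeg_eq_card_nbrsOff] at this
  rw [degSum]
  exact_mod_cast this.symm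

theorem mem_bfsBall_toSimpleGraph [Fintype C] [DecidableEq C] {v w : C} {j : ℕ} :
    w ∈ C.toSimpleGraph.bfsBall v j ↔ (w : V) ∈ H.bfsBall (v : V) j := by
  induction j generalizing w with
  | zero => rw [bfsBall, bfsBall, Finset.mem_singleton, Finset.mem_singleton, Subtype.ext_iff]
  | succ j ih =>
    rw [mem_bfsBall_succ, mem_bfsBall_succ, ih]
    refine or_congr_right ⟨?_, ?_⟩
    · rintro ⟨u, hu, ha⟩
      exact ⟨u, ih.1 hu, ha⟩
    · rintro ⟨u, hu, ha⟩
      have hu' : u ∈ C.supp := C.mem_supp_of_adj_mem_supp w.2 ha.symm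
      exact ⟨⟨u, hu'⟩, ih.2 hu, ha⟩

theorem dist_toSimpleGraph_le_iff {v w : C} {j : ℕ} :
    C.toSimpleGraph.dist v w ≤ j ↔ (w : V) ∈ H.bfsBall (v : V) j := by
  classical
  rw [← mem_bfsBall_toSimpleGraph,
    mem_bfsBall_iff_of_reachable (C.connected_toSimpleGraph.preconnected v w)]

/-- If the sphere of radius `R = k + 1` were empty, every vertex would be within `k` of `v`, and the
diameter would be at most `2k`. -/
theorem bfsLevel_nonempty_of_le_diam {v : V} (hv : v ∈ C.supp) {R : ℕ}
    (hR : 2 * R ≤ C.toSimpleGraph.diam + 1) : (H.bfsLevel v R).Nonempty := by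
  rcases R with _ | k
  · exact ⟨v, by simp [bfsLevel, bfsBall, bfsInner]⟩
  by_contra hcon
  rw [Finset.not_nonempty_iff_eq_empty] at hcon
  have : Nonempty C := ⟨⟨v, hv⟩⟩
  obtain ⟨x, y, hxy⟩ := C.toSimpleGraph.exists_dist_eq_diam
  have hle : ∀ w : C, C.toSimpleGraph.dist ⟨v, hv⟩ w ≤ k := fun w =>
    dist_toSimpleGraph_le_iff.2
      (mem_bfsBall_of_reachable_of_level_empty hcon (C.reachable_of_mem_supp hv w.2))
  have := C.connected_toSimpleGraph.dist_triangle (u := x) (v := ⟨v, hv⟩) (w := y)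
  have h1 := hle x
  have h2 := hle y
  rw [dist_comm] at h1
  omega

theorem card_verts_le_of_diam_le {v : V} (hv : v ∈ C.supp) {k : ℕ}
    (hk : C.toSimpleGraph.diam ≤ k) : C.verts.card ≤ (H.bfsBall v k).card := by
  refine Finset.card_le_card fun x hx => ?_
  have : Nonempty C := ⟨⟨v, hv⟩⟩
  refine dist_toSimpleGraph_le_iff (v := ⟨v, hv⟩) (w := ⟨x, mem_verts.1 hx⟩) |>.1 (le_trans ?_ hk)
  exact dist_le_diam (connected_iff_ediam_ne_top.1 C.connected_toSimpleGraph)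

theorem nontrivial_of_two_le (h : 2 ≤ C.verts.card) : Nontrivial C := by
  obtain ⟨a, ha, b, hb, hab⟩ := Finset.one_lt_card.1 h
  exact ⟨⟨⟨a, mem_verts.1 ha⟩, ⟨b, mem_verts.1 hb⟩, fun h => hab (congrArg Subtype.val h)⟩⟩

theorem rdeg_ge_one (h : 2 ≤ C.verts.card) (x : C) : 1 ≤ C.toSimpleGraph.rdeg x := by
  have := nontrivial_of_two_le h
  obtain ⟨y, hy⟩ : ∃ y, C.toSimpleGraph.Adj x y := by
    obtain ⟨z, hz⟩ := exists_ne x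
    obtain ⟨p⟩ := C.connected_toSimpleGraph.preconnected x z
    cases p with
    | nil => exact absurd rfl hz
    | cons ha _ => exact ⟨_, ha⟩
  rw [rdeg]
  have : 0 < (C.toSimpleGraph.neighborSet x).ncard :=
    (Set.ncard_pos (Set.toFinite _)).2 ⟨y, hy⟩
  exact_mod_cast this

theorem card_verts_le (h : 2 ≤ C.verts.card) :
    C.verts.card ≤ 2 * C.toSimpleGraph.edgeSet.ncard := by
  classical
  have h1 := sum_rdeg C.toSimpleGraph
  have h2 : ∑ x : C, (1 : ℝ) ≤ ∑ x : C, C.toSimpleGraph.rdeg x :=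
    Finset.sum_le_sum fun x _ => rdeg_ge_one h x
  rw [h1, ← sum_verts fun _ => (1 : ℝ), Finset.sum_const, nsmul_eq_mul, mul_one] at h2
  exact_mod_cast h2

theorem mixingTime_le (h : 2 ≤ C.verts.card) :
    C.toSimpleGraph.mixingTime ≤
      128 * C.toSimpleGraph.edgeSet.ncard * C.toSimpleGraph.diam := by
  classical
  have := nontrivial_of_two_le h
  have htop := connected_iff_ediam_ne_top.1 C.connected_toSimpleGraph
  exact C.connected_toSimpleGraph.mixingTime_le
    (fun x => zero_lt_one.trans_le (rdeg_ge_one h x))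
    (Nat.pos_of_ne_zero (diam_ne_zero_of_ediam_ne_top htop)) fun x y => dist_le_diam htop

theorem dirichlet_toSimpleGraph_le [Fintype C] [DecidableEq C] (f : V → ℝ) :
    C.toSimpleGraph.dirichlet (fun x => f x) ≤ H.dirichlet f := by
  have h0 : ∀ x y, 0 ≤ H.adjInd x y * (f x - f y) ^ 2 := fun x y =>
    mul_nonneg (ind_nonneg _) (sq_nonneg _)
  have h1 : C.toSimpleGraph.dirichlet (fun x => f x)
      = ∑ x ∈ C.verts, ∑ y ∈ C.verts, H.adjInd x y * (f x - f y) ^ 2 := by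
    rw [sum_verts]
    refine Finset.sum_congr rfl fun x _ => ?_
    rw [sum_verts]
    rfl
  rw [h1, dirichlet]
  refine (Finset.sum_le_sum fun x _ => Finset.sum_le_sum_of_subset_of_nonneg
    (Finset.subset_univ _) fun y _ _ => h0 x y).trans ?_
  exact Finset.sum_le_sum_of_subset_of_nonneg (Finset.subset_univ _) fun x _ _ =>
    Finset.sum_nonneg fun y _ => h0 x y

/-- The lane function is tested on the balls of radii `s` and `3s`. The degree sum of the larger
ball is at most twice its forward edges, so `hvol` makes its stationary mass at most `1/4`. -/
theorem card_bfsBall_mul_le {v : V} (hv : v ∈ C.supp) (h : 2 ≤ C.verts.card) {s : ℕ} (hs : 0 < s)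
    (hvol : 4 * ∑ i ∈ Finset.range (3 * s + 1), H.bfsForward v i
      ≤ C.toSimpleGraph.edgeSet.ncard) :
    ((H.bfsBall v s).card : ℝ) * (s : ℝ) ^ 2 ≤
      C.toSimpleGraph.mixingTime * (2 * ∑ i ∈ Finset.Ico s (2 * s), (H.bfsLanes v i s : ℝ)) := by
  classical
  have hs' : (0 : ℝ) < s := by exact_mod_cast hs
  let S : Finset C := Finset.univ.filter fun x => (x : V) ∈ H.bfsBall v s
  let U : Finset C := Finset.univ.filter fun x => (x : V) ∈ H.bfsBall v (3 * s)
  have hball : ∀ j, ∀ x ∈ H.bfsBall v j, x ∈ C.supp := by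
    intro j x hx
    rw [mem_supp_iff] at *
    rw [← hv]
    exact ConnectedComponent.sound (reachable_of_mem_bfsBall hx).symm
  have hsum : ∀ (j : ℕ) (F : V → ℝ),
      ∑ x ∈ Finset.univ.filter (fun x : C => (x : V) ∈ H.bfsBall v j), F x
        = ∑ x ∈ H.bfsBall v j, F x := by
    intro j F
    refine Finset.sum_bij (fun (x : C) _ => (x : V)) ?_ ?_ ?_ ?_
    · exact fun x hx => (Finset.mem_filter.1 hx).2
    · exact fun x _ y _ h => Subtype.ext h
    · exact fun x hx => ⟨⟨x, hball j x hx⟩, by simpa using hx, rfl⟩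
    · exact fun _ _ => rfl
  have hU : 2 * ∑ x ∈ U, C.toSimpleGraph.rdeg x ≤ C.toSimpleGraph.edgeSet.ncard := by
    simp only [rdeg_toSimpleGraph, U]
    rw [hsum]
    simp only [rdeg_eq_card_nbrsOff]
    have := sum_degree_bfsBall_le (H := H) v (3 * s)
    exact_mod_cast (by omega : 2 * ∑ x ∈ H.bfsBall v (3 * s), (H.nbrsOff ∅ x).card
      ≤ C.toSimpleGraph.edgeSet.ncard)
  have key := C.connected_toSimpleGraph.sum_rdeg_le_mixingTime_mul
    (fun x => zero_lt_one.trans_le (rdeg_ge_one h x)) (fun x => H.laneFun v s x) S U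
    (fun x hx => laneFun_eq_one (Finset.mem_filter.1 hx).2)
    (fun x hx => laneFun_eq_zero hs fun h' => hx (by simpa [U] using h')) hU
  have h1 : ((H.bfsBall v s).card : ℝ) ≤ ∑ x ∈ S, C.toSimpleGraph.rdeg x := by
    refine le_trans (le_of_eq ?_) (Finset.sum_le_sum fun x _ => rdeg_ge_one h x)
    rw [hsum s fun _ => (1 : ℝ)]
    simp
  have h2 := (dirichlet_toSimpleGraph_le (C := C) (H.laneFun v s)).trans
    (dirichlet_laneFun_le v hs)
  have h3 : ((H.bfsBall v s).card : ℝ) ≤ C.toSimpleGraph.mixingTime *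
      (2 / (s : ℝ) ^ 2 * ∑ i ∈ Finset.Ico s (2 * s), (H.bfsLanes v i s : ℝ)) :=
    h1.trans (key.trans (mul_le_mul_of_nonneg_left h2 (Nat.cast_nonneg _)))
  have h4 := mul_le_mul_of_nonneg_right h3 (sq_nonneg (s : ℝ))
  refine h4.trans (le_of_eq ?_)
  field_simp

end ConnectedComponent

theorem degSum_mono {H' : SimpleGraph V} (h : H ≤ H') (v : V) : H.degSum v ≤ H'.degSum v := by
  classical
  refine le_trans (Finset.sum_le_sum fun x _ => Finset.card_le_card fun y hy => ?_)
    (Finset.sum_le_sum_of_subset fun x hx => ?_)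
  · rw [mem_nbrsOff] at *
    exact ⟨hy.1, h hy.2⟩
  · simp only [Finset.mem_filter, Finset.mem_univ, true_and] at *
    exact hx.mono h

theorem degSum_le_of_level_empty {v : V} {k : ℕ} (hk : H.bfsLevel v (k + 1) = ∅) :
    H.degSum v ≤ 2 * ∑ i ∈ Finset.range (k + 1), H.bfsForward v i := by
  classical
  refine le_trans (Finset.sum_le_sum_of_subset fun x hx => ?_) (sum_degree_bfsBall_le v k)
  exact mem_bfsBall_of_reachable_of_level_empty hk (Finset.mem_filter.1 hx).2

/-- Removing an edge at `v` splits the component of `v` into at most two. -/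
theorem degSum_le_of_adj_le {H' : SimpleGraph V} {v w : V}
    (h : ∀ x y, H.Adj x y → H'.Adj x y ∨ s(x, y) = s(v, w)) :
    H.degSum v ≤ H'.degSum v + H'.degSum w + 2 := by
  classical
  have hreach : ∀ x, H.Reachable v x → H'.Reachable v x ∨ H'.Reachable w x := by
    rintro x ⟨p⟩
    suffices ∀ u x (p : H.Walk u x), (H'.Reachable v u ∨ H'.Reachable w u) →
        (H'.Reachable v x ∨ H'.Reachable w x) from this _ _ p (Or.inl (Reachable.refl v))
    intro u x p
    induction p with
    | nil => exact id
    | @cons u u' x ha p ih =>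
      intro hu
      refine ih ?_
      rcases h u u' ha with ha' | ha'
      · exact hu.imp (fun hr => hr.trans ha'.reachable) (fun hr => hr.trans ha'.reachable)
      · rcases Sym2.eq_iff.1 ha' with ⟨-, rfl⟩ | ⟨-, rfl⟩
        · exact Or.inr (Reachable.refl _)
        · exact Or.inl (Reachable.refl _)
  have hdeg : ∀ x, (H.nbrsOff ∅ x).card ≤ (H'.nbrsOff ∅ x).card
      + ((if x = v then 1 else 0) + (if x = w then 1 else 0)) := by
    intro x
    have : H.nbrsOff ∅ x ⊆ H'.nbrsOff ∅ x ∪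
        ((if x = v then {w} else ∅) ∪ (if x = w then {v} else ∅)) := by
      intro y hy
      rw [mem_nbrsOff] at hy
      simp only [Finset.mem_union, mem_nbrsOff]
      rcases h x y hy.2 with ha | ha
      · exact Or.inl ⟨hy.1, ha⟩
      · rcases Sym2.eq_iff.1 ha with ⟨rfl, rfl⟩ | ⟨rfl, rfl⟩
        · simp
        · simp
    refine (Finset.card_le_card this).trans ((Finset.card_union_le _ _).trans
      (Nat.add_le_add_left ((Finset.card_union_le _ _).trans (Nat.add_le_add ?_ ?_)) _))
    · split_ifs <;> simp
    · split_ifs <;> simp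
  calc H.degSum v ≤ ∑ x ∈ Finset.univ.filter (H'.Reachable v) ∪
        Finset.univ.filter (H'.Reachable w), (H.nbrsOff ∅ x).card := by
        refine Finset.sum_le_sum_of_subset fun x hx => ?_
        simp only [Finset.mem_union, Finset.mem_filter, Finset.mem_univ, true_and] at *
        exact hreach x hx
    _ ≤ ∑ x ∈ Finset.univ.filter (H'.Reachable v) ∪ Finset.univ.filter (H'.Reachable w),
        ((H'.nbrsOff ∅ x).card + ((if x = v then 1 else 0) + (if x = w then 1 else 0))) :=
        Finset.sum_le_sum fun x _ => hdeg x
    _ ≤ _ := by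
        rw [Finset.sum_add_distrib, Finset.sum_add_distrib, Finset.sum_ite_eq', Finset.sum_ite_eq']
        refine Nat.add_le_add ?_ ?_
        · rw [degSum, degSum, ← Finset.sum_union_inter]
          exact Nat.le_add_right _ _
        · split_ifs <;> omega

end Component

end SimpleGraph

/-! ### First-moment estimates for components in the critical window -/

namespace SimpleGraph

variable {V : Type*} [Fintype V] [DecidableEq V]

/-- Near-critical percolation on a graph with `L ^ 3` vertices, such that powers of the mean
offspring stay bounded by `E` on the scale `L`. -/
structure CriticalWindow (G : SimpleGraph V) (P : Sym2 V → ℝ) (D : ℕ) (p M L E : ℝ) : Prop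
    extends NearCritical G P D p M where
  card_eq : (Fintype.card V : ℝ) = L ^ 3
  two_le_scale : 2 ≤ L
  pow_le : ∀ k : ℕ, (k : ℝ) ≤ 4 * L → M ^ k ≤ E

variable {G : SimpleGraph V} {P : Sym2 V → ℝ} {D : ℕ} {p M L E : ℝ}

namespace CriticalWindow

theorem one_le_bound (h : CriticalWindow G P D p M L E) : 1 ≤ E := by
  have := h.pow_le 0 (by have := h.two_le_scale; simp; linarith)
  simpa using this

theorem le_bound (h : CriticalWindow G P D p M L E) : M ≤ E := by
  have := h.pow_le 1 (by have := h.two_le_scale; simp; linarith)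
  simpa using this

theorem level_le (h : CriticalWindow G P D p M L E) (v : V) {k : ℕ} (hk : 1 ≤ k)
    (hkL : (k : ℝ) ≤ 4 * L) :
    bernPr P (fun S => ((G.retain S).bfsLevel v k).Nonempty) ≤ 16 * E / k := by
  refine (h.bernPr_bfsLevel_nonempty_le v hk).trans ?_
  have := h.pow_le k hkL
  gcongr

theorem forward_le (h : CriticalWindow G P D p M L E) (v : V) {m : ℕ} (hm : (m : ℝ) ≤ 4 * L)
    {τ : ℝ} (hτ : 0 < τ) :
    bernPr P (fun S => τ ≤ ∑ i ∈ Finset.range m, ((G.retain S).bfsForward v i : ℝ))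
      ≤ 4 * E * m / τ := by
  refine (bernPr_le_div h.mem (f := fun S => ∑ i ∈ Finset.range m,
    ((G.retain S).bfsForward v i : ℝ)) (fun S => by positivity) hτ _ fun S hS => hS).trans ?_
  refine div_le_div_of_nonneg_right ?_ hτ.le
  rw [bernEx_sum, mul_comm, ← nsmul_eq_mul]
  refine (Finset.sum_le_card_nsmul _ _ (4 * E) fun i hi => ?_).trans (by rw [Finset.card_range])
  refine (h.bernEx_bfsForward_le v i).trans (mul_le_mul_of_nonneg_left (h.pow_le _ ?_) (by norm_num))
  have : ((i + 1 : ℕ) : ℝ) ≤ m := by exact_mod_cast Finset.mem_range.1 hi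
  linarith

theorem ball_le (h : CriticalWindow G P D p M L E) (v : V) {k : ℕ} (hk : (k : ℝ) ≤ 4 * L)
    {τ : ℝ} (hτ : 0 < τ) :
    bernPr P (fun S => τ ≤ ((G.retain S).bfsBall v k).card) ≤ 2 * E * (k + 1) / τ := by
  refine (bernPr_le_div h.mem (f := fun S => ∑ i ∈ Finset.range (k + 1),
    (((G.retain S).bfsLevel v i).card : ℝ)) (fun S => by positivity) hτ _ fun S hS => ?_).trans ?_
  · exact hS.trans (by exact_mod_cast card_bfsBall_le v k)
  refine div_le_div_of_nonneg_right ?_ hτ.le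
  rw [bernEx_sum]
  refine (Finset.sum_le_card_nsmul _ _ (2 * E) fun i hi => ?_).trans (le_of_eq ?_)
  · refine (h.bernEx_card_bfsLevel_le v i).trans
      (mul_le_mul_of_nonneg_left (h.pow_le _ ?_) (by norm_num))
    have : (i : ℝ) ≤ k := by exact_mod_cast Nat.lt_succ_iff.1 (Finset.mem_range.1 hi)
    linarith
  · rw [Finset.card_range, nsmul_eq_mul]
    push_cast
    ring

theorem small_level_le (h : CriticalWindow G P D p M L E) (v : V) {a b t R : ℕ}
    (ha : 1 ≤ a) (ht : 1 ≤ t) (haL : (a : ℝ) ≤ 4 * L) (htL : (t : ℝ) ≤ 4 * L) (hR : b + t ≤ R)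
    {s : ℝ} (hs : 0 ≤ s) :
    bernPr P (fun S => ((G.retain S).bfsLevel v R).Nonempty ∧
        ∃ j, a ≤ j ∧ j ≤ b ∧ (((G.retain S).bfsLevel v j).card : ℝ) ≤ s)
      ≤ s * (16 * E / t) * (16 * E / a) := by
  have hE := h.one_le_bound
  refine (h.bernPr_small_level_le v ht hR hs).trans
    (mul_le_mul ?_ (h.level_le v ha haL) (bernPr_nonneg h.mem _) (by positivity))
  have := h.pow_le t htL
  gcongr

/-- If each vertex is bad with small probability then large components contain good vertices. -/
theorem exists_component_bad_le (h : CriticalWindow G P D p M L E)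
    (Bad : V → Finset (Sym2 V) → Prop) {η β : ℝ} (hβ : 0 < β)
    (hbad : ∀ v, bernPr P (Bad v) ≤ η / L) :
    bernPr P (fun S => ∃ C : (G.retain S).ConnectedComponent, β * L ^ 2 < (C.verts.card : ℝ) ∧
      ∀ v ∈ C.supp, Bad v S) ≤ η / β := by
  have hL : 0 < L := by linarith [h.two_le_scale]
  refine (bernPr_le_div h.mem (f := fun S => ∑ v, ind (Bad v S))
    (fun S => Finset.sum_nonneg fun v _ => ind_nonneg _) (a := β * L ^ 2) (by positivity) _
    fun S hS => ?_).trans ?_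
  · obtain ⟨C, hC, hb⟩ := hS
    refine hC.le.trans (le_trans ?_ (Finset.sum_le_sum_of_subset_of_nonneg
      (Finset.subset_univ C.verts) fun v _ _ => ind_nonneg _))
    rw [Finset.sum_congr rfl fun v hv => ind_of (hb v (ConnectedComponent.mem_verts.1 hv))]
    simp
  · rw [bernEx_sum, div_le_div_iff₀ (by positivity) hβ]
    have : ∑ v, bernEx P (fun S => ind (Bad v S)) ≤ L ^ 3 * (η / L) := by
      rw [← h.card_eq, ← nsmul_eq_mul]
      exact Finset.sum_le_card_nsmul _ _ _ fun v _ => hbad v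
    calc _ ≤ L ^ 3 * (η / L) * β := mul_le_mul_of_nonneg_right this hβ.le
      _ = _ := by field_simp

/-- Either the component reaches beyond distance `L`, with probability at most `16E/L`, or it is
exhausted before and its forward edges, of mean `O(L)`, number at least `L^2 / 2`; Markov gives
another `16E/L`. -/
theorem degSum_le (h : CriticalWindow G P D p M L E) (v : V) :
    bernPr P (fun S => L ^ 2 ≤ ((G.retain S).degSum v : ℝ)) ≤ 32 * E / L := by
  have hL2 := h.two_le_scale
  have hL : 0 < L := by linarith
  have hE := h.one_le_bound
  have hk1 : L ≤ (⌊L⌋₊ + 1 : ℕ) := by exact_mod_cast (Nat.lt_floor_add_one L).le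
  have hk2 : ((⌊L⌋₊ + 1 : ℕ) : ℝ) ≤ 2 * L := by
    have := Nat.floor_le hL.le
    push_cast
    linarith
  set k := ⌊L⌋₊
  calc _ ≤ bernPr P (fun S => ((G.retain S).bfsLevel v (k + 1)).Nonempty ∨
        L ^ 2 / 2 ≤ ∑ i ∈ Finset.range (k + 1), ((G.retain S).bfsForward v i : ℝ)) := by
        refine bernPr_mono h.mem fun S hS => ?_
        by_contra! hcon
        have := degSum_le_of_level_empty hcon.1
        have : ((G.retain S).degSum v : ℝ) ≤
            2 * ∑ i ∈ Finset.range (k + 1), ((G.retain S).bfsForward v i : ℝ) := by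
          exact_mod_cast this
        linarith [hcon.2]
    _ ≤ 16 * E / (k + 1 : ℕ) + 4 * E * (k + 1 : ℕ) / (L ^ 2 / 2) :=
        (bernPr_or_le h.mem _ _).trans (add_le_add (h.level_le v (by omega) (by linarith))
          (h.forward_le v (by linarith) (by positivity)))
    _ ≤ 16 * E / L + 4 * E * (2 * L) / (L ^ 2 / 2) := by gcongr
    _ = 32 * E / L := by field_simp; ring

/-- Without the edge `vw`, the degree sum at `v` or at `w` is at least `L^2`, since `2L^2 + 2 <
4L^2`. That event is independent of the edge, so the factor `p` splits off; this factor later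
compensates the large degree when summing over edges. -/
theorem degSum_edge_le (h : CriticalWindow G P D p M L E) (v w : V) :
    bernPr P (fun S => s(v, w) ∈ S ∧ 4 * L ^ 2 ≤ ((G.retain S).degSum v : ℝ))
      ≤ p * (64 * E / L) := by
  have hL2 := h.two_le_scale
  let Q : V → Finset (Sym2 V) → Prop := fun x S =>
    L ^ 2 ≤ ((G.retain (S.erase s(v, w))).degSum x : ℝ)
  have hQ : ∀ x, bernPr P (Q x) ≤ 32 * E / L := fun x =>
    (bernPr_mono h.mem fun S hS => hS.trans (by
      exact_mod_cast degSum_mono (retain_mono (Finset.erase_subset _ S)) x)).trans (h.degSum_le x)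
  calc _ ≤ bernPr P (fun S => s(v, w) ∈ S ∧ (Q v S ∨ Q w S)) := by
        refine bernPr_mono h.mem fun S hS => ⟨hS.1, ?_⟩
        have h1 : (G.retain S).degSum v ≤ (G.retain (S.erase s(v, w))).degSum v
            + (G.retain (S.erase s(v, w))).degSum w + 2 := by
          refine degSum_le_of_adj_le fun x y ha => ?_
          by_cases he : s(x, y) = s(v, w)
          · exact Or.inr he
          · exact Or.inl ⟨ha.1, Finset.mem_erase.2 ⟨he, ha.2⟩⟩
        have h2 : ((G.retain S).degSum v : ℝ) ≤ (G.retain (S.erase s(v, w))).degSum v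
            + (G.retain (S.erase s(v, w))).degSum w + 2 := by exact_mod_cast h1
        by_contra! hcon
        simp only [Q, not_le] at hcon
        nlinarith [hS.2, hcon.1, hcon.2]
    _ = P s(v, w) * bernPr P (fun S => Q v S ∨ Q w S) := by
        rw [bernPr_and_of_depOn (D := {s(v, w)}) (depOn_mem_edge rfl), bernPr_mem]
        intro S T hST
        have : S.erase s(v, w) = T.erase s(v, w) := by
          ext e
          simp only [Finset.mem_erase]
          exact and_congr_right fun he => hST e he
        simp only [Q, this]
    _ ≤ p * (64 * E / L) := by
        refine mul_le_mul (h.le _) ((bernPr_or_le h.mem _ _).trans ?_) (bernPr_nonneg h.mem _)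
          h.nonneg
        have e : 64 * E / L = 32 * E / L + 32 * E / L := by ring
        rw [e]
        exact add_le_add (hQ v) (hQ w)

/-- Components have at most of order `L ^ 2` edges. -/
theorem exists_component_edges_le (h : CriticalWindow G P D p M L E) {A : ℝ} (hA : 2 ≤ A) :
    bernPr P (fun S => ∃ C : (G.retain S).ConnectedComponent,
      A * L ^ 2 < (C.toSimpleGraph.edgeSet.ncard : ℝ)) ≤ 64 * E ^ 2 / A := by
  have hL2 := h.two_le_scale
  have hL : 0 < L := by linarith
  have hE := h.one_le_bound
  have hM := h.one_le
  -- Counts open oriented edges in components of degree sum at least `4L^2`. A component with more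
  -- than `A L^2` edges qualifies because `A ≥ 2`, and contributes more than `2A L^2`.
  refine (bernPr_le_div h.mem (f := fun S => ∑ v, ∑ w ∈ G.nbrsOff ∅ v,
    ind (s(v, w) ∈ S ∧ 4 * L ^ 2 ≤ ((G.retain S).degSum v : ℝ)))
    (fun S => Finset.sum_nonneg fun v _ => Finset.sum_nonneg fun w _ => ind_nonneg _)
    (a := 2 * A * L ^ 2) (by positivity) _ fun S hS => ?_).trans ?_
  · obtain ⟨C, hC⟩ := hS
    have h1 : ∀ v ∈ C.verts, ∑ w ∈ G.nbrsOff ∅ v,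
        ind (s(v, w) ∈ S ∧ 4 * L ^ 2 ≤ ((G.retain S).degSum v : ℝ))
        = ((G.retain S).nbrsOff ∅ v).card := by
      intro v hv
      rw [retain_nbrsOff_card]
      refine Finset.sum_congr rfl fun w _ => ?_
      have h2 : (2 * C.toSimpleGraph.edgeSet.ncard : ℝ) = (G.retain S).degSum v := by
        exact_mod_cast C.two_mul_ncard_edgeSet (ConnectedComponent.mem_verts.1 hv)
      have h3 : 4 * L ^ 2 ≤ ((G.retain S).degSum v : ℝ) := by
        rw [← h2]
        nlinarith [sq_nonneg L]
      rw [ind_and, ind_of h3, mul_one]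
    obtain ⟨v, hv⟩ := C.nonempty_supp
    have h4 : (2 * C.toSimpleGraph.edgeSet.ncard : ℝ)
        = ∑ x ∈ C.verts, (((G.retain S).nbrsOff ∅ x).card : ℝ) := by
      classical
      rw [ConnectedComponent.verts_eq hv]
      have := C.two_mul_ncard_edgeSet hv
      rw [degSum] at this
      exact_mod_cast this
    refine le_trans ?_ (Finset.sum_le_sum_of_subset_of_nonneg (Finset.subset_univ C.verts)
      fun v _ _ => Finset.sum_nonneg fun w _ => ind_nonneg _)
    rw [Finset.sum_congr rfl h1, ← h4]
    linarith
  · have h5 : bernEx P (fun S => ∑ v, ∑ w ∈ G.nbrsOff ∅ v,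
        ind (s(v, w) ∈ S ∧ 4 * L ^ 2 ≤ ((G.retain S).degSum v : ℝ)))
        ≤ L ^ 3 * (2 * E * (64 * E / L)) := by
      rw [bernEx_sum, ← h.card_eq, ← nsmul_eq_mul]
      refine Finset.sum_le_card_nsmul _ _ _ fun v _ => ?_
      rw [bernEx_sum]
      refine (Finset.sum_le_card_nsmul _ _ _ fun w _ => h.degSum_edge_le v w).trans ?_
      rw [nsmul_eq_mul, ← mul_assoc]
      refine mul_le_mul_of_nonneg_right ?_ (by positivity)
      refine le_trans (mul_le_mul_of_nonneg_right ?_ h.nonneg)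
        (h.succ_mul_le.trans (by linarith [h.le_bound]))
      exact_mod_cast h.deg v
    rw [div_le_div_iff₀ (by positivity) (by positivity)]
    calc _ ≤ L ^ 3 * (2 * E * (64 * E / L)) * A := mul_le_mul_of_nonneg_right h5 (by linarith)
      _ = _ := by field_simp

/-- Large components have diameter at least of order `L`. -/
theorem exists_component_diam_lt_le (h : CriticalWindow G P D p M L E) {A β : ℝ} (hβ : 0 < β)
    (hA : 1 ≤ A) (hAL : A ≤ L) :
    bernPr P (fun S => ∃ C : (G.retain S).ConnectedComponent, β * L ^ 2 < (C.verts.card : ℝ) ∧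
      (C.toSimpleGraph.diam : ℝ) < A⁻¹ * L) ≤ 4 * E / (A * β) / β := by
  have hL2 := h.two_le_scale
  have hL : 0 < L := by linarith
  have hE := h.one_le_bound
  have hA0 : 0 < A := by linarith
  have hfl := Nat.floor_le (show 0 ≤ A⁻¹ * L by positivity)
  have hAL1 : 1 ≤ A⁻¹ * L := by rw [inv_mul_eq_div, one_le_div hA0]; exact hAL
  have hAL2 : A⁻¹ * L ≤ L := by
    rw [inv_mul_eq_div]
    exact div_le_self hL.le hA
  set k := ⌊A⁻¹ * L⌋₊ with hk
  -- A component of diameter below `L/A` lies in the ball of radius `k` around each of its vertices,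
  -- so all of them are bad.
  refine le_trans (bernPr_mono h.mem fun S hS => ?_) (h.exists_component_bad_le
    (fun v S => β * L ^ 2 ≤ ((G.retain S).bfsBall v k).card) hβ fun v => ?_)
  · obtain ⟨C, hC, hd⟩ := hS
    refine ⟨C, hC, fun v hv => hC.le.trans ?_⟩
    exact_mod_cast C.card_verts_le_of_diam_le hv (Nat.le_floor hd.le)
  · refine (h.ball_le v (by linarith) (by positivity)).trans ?_
    calc 2 * E * (k + 1) / (β * L ^ 2) ≤ 2 * E * (2 * (A⁻¹ * L)) / (β * L ^ 2) := by
          gcongr; linarith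
      _ = 4 * E / (A * β) / L := by field_simp; ring

/-- Large components with at most of order `L ^ 2` edges have diameter at most of order `L`. -/
theorem exists_component_lt_diam_le (h : CriticalWindow G P D p M L E) {A K Q β : ℝ} (hβ : 0 < β)
    (hK : 0 < K) (hQ : 0 < Q) (hA : 2 * (3 + Q) ≤ A) :
    bernPr P (fun S => ∃ C : (G.retain S).ConnectedComponent, β * L ^ 2 < (C.verts.card : ℝ) ∧
      (C.verts.card : ℝ) ≤ K * L ^ 2 ∧ A * L < (C.toSimpleGraph.diam : ℝ))
      ≤ 1024 * E ^ 2 * K / Q / β := by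
  have hL2 := h.two_le_scale
  have hL : 0 < L := by linarith
  have hE := h.one_le_bound
  have ha1 := Nat.floor_le hL.le
  have ha2 := Nat.lt_floor_add_one L
  set a := ⌊L⌋₊
  have ha3 : L / 2 ≤ a := by linarith
  have ha0 : 1 ≤ a := by
    have : (0 : ℝ) < a := by linarith
    exact_mod_cast this
  have hq1 := Nat.floor_le (show 0 ≤ Q * L by positivity)
  have hq2 := Nat.lt_floor_add_one (Q * L)
  set q := ⌊Q * L⌋₊
  -- The mean size of the `q + 1` spheres of radii in `[a, a + q]` when they share `K L^2` vertices:
  -- one of them has at most `θ`. Reaching radius `a`, then surviving `a` further steps from at most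
  -- `θ` vertices, costs two factors of order `1/L` against `θ = O(K L / Q)`.
  set θ := K * L ^ 2 / (q + 1) with hθ
  refine le_trans (bernPr_mono h.mem fun S hS => ?_) (h.exists_component_bad_le
    (fun v S => ((G.retain S).bfsLevel v (a + q + a)).Nonempty ∧
        ∃ j, a ≤ j ∧ j ≤ a + q ∧ (((G.retain S).bfsLevel v j).card : ℝ) ≤ θ) hβ fun v => ?_)
  · obtain ⟨C, hC, hCK, hd⟩ := hS
    refine ⟨C, hC, fun v hv => ⟨C.bfsLevel_nonempty_of_le_diam hv ?_, ?_⟩⟩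
    · have : (2 * (a + q + a : ℕ) : ℝ) ≤ C.toSimpleGraph.diam := by
        push_cast
        nlinarith
      have : 2 * (a + q + a) ≤ C.toSimpleGraph.diam := by exact_mod_cast this
      omega
    · by_contra! hcon
      have h1 : ∑ j ∈ Finset.Icc a (a + q), (((G.retain S).bfsLevel v j).card : ℝ) ≤ K * L ^ 2 := by
        refine le_trans ?_ hCK
        exact_mod_cast (sum_card_bfsLevel_le v (Finset.Icc a (a + q)) (a + q)
          fun i hi => (Finset.mem_Icc.1 hi).2).trans (Finset.card_le_card fun x hx =>
            ConnectedComponent.mem_verts.2 (by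
              rw [ConnectedComponent.mem_supp_iff] at *
              rw [← hv]
              exact ConnectedComponent.sound (reachable_of_mem_bfsBall hx).symm))
      have h2 : ∑ j ∈ Finset.Icc a (a + q), θ
          < ∑ j ∈ Finset.Icc a (a + q), (((G.retain S).bfsLevel v j).card : ℝ) :=
        Finset.sum_lt_sum_of_nonempty ⟨a, Finset.mem_Icc.2 ⟨le_rfl, by omega⟩⟩ fun j hj =>
          hcon j (Finset.mem_Icc.1 hj).1 (Finset.mem_Icc.1 hj).2
      rw [Finset.sum_const, Nat.card_Icc, show a + q + 1 - a = q + 1 by omega, nsmul_eq_mul, hθ]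
        at h2
      push_cast at h2
      rw [mul_div_cancel₀ _ (by positivity)] at h2
      linarith
  · refine (h.small_level_le v ha0 ha0 (by linarith) (by linarith) le_rfl
      (by positivity)).trans ?_
    have : θ ≤ K * L / Q := by
      rw [hθ, div_le_div_iff₀ (by positivity) hQ]
      have : K * L * (Q * L) ≤ K * L * (q + 1) := by gcongr
      linarith
    calc θ * (16 * E / a) * (16 * E / a) ≤ K * L / Q * (16 * E / (L / 2)) * (16 * E / (L / 2)) := by
          gcongr
      _ = 1024 * E ^ 2 * K / Q / L := by field_simp; ring

/-- Large components have mixing time at least of order `L ^ 3`. -/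
theorem exists_component_mixingTime_lt_le (h : CriticalWindow G P D p M L E)
    {β δ Λ η : ℝ} (hβ : 0 < β) (hβL : 2 ≤ β * L ^ 2) (hδ : 0 < δ) (hδ1 : δ ≤ 1) (hδL : 1 ≤ δ * L)
    (hΛ : 0 < Λ) (hη : 0 < η) :
    bernPr P (fun S => ∃ C : (G.retain S).ConnectedComponent, β * L ^ 2 < (C.verts.card : ℝ) ∧
      (C.toSimpleGraph.mixingTime : ℝ) < η * δ ^ 3 / (16 * Λ) * L ^ 3)
      ≤ (128 * E * δ / β + 128 * E / (Λ * δ) + 2048 * E ^ 2 * η / δ) / β := by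
  have hL2 := h.two_le_scale
  have hL : 0 < L := by linarith
  have hE := h.one_le_bound
  have hs1 := Nat.floor_le (show 0 ≤ δ * L by positivity)
  have hs2 := Nat.lt_floor_add_one (δ * L)
  have hs0 : 1 ≤ ⌊δ * L⌋₊ := Nat.le_floor (by simpa using hδL)
  set s := ⌊δ * L⌋₊
  have hs0' : (1 : ℝ) ≤ s := by exact_mod_cast hs0
  have hs3 : δ * L / 2 ≤ s := by linarith
  have hsL : (s : ℝ) ≤ L := hs1.trans (by nlinarith)
  -- Half of `s`, rounded up: this makes `b` positive and leaves at least `s / 2` radii in `[b, s]`.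
  let b : ℕ := (s + 1) / 2
  have hb1 : (s : ℝ) / 2 ≤ b := by
    rw [div_le_iff₀ (by norm_num)]
    exact_mod_cast (by omega : s ≤ (s + 1) / 2 * 2)
  have hb0 : 1 ≤ b := by omega
  have hbs : b ≤ s := by omega
  have hbs' : (b : ℝ) ≤ s := by exact_mod_cast hbs
  refine le_trans (bernPr_mono h.mem fun S hS => ?_) (h.exists_component_bad_le
    -- A vertex is bad if the ball of radius `3s` has too many forward edges, if there are too many
    -- lanes, or if a thin sphere inside radius `s` survives to radius `2s`. The `β / 8` makes four
    -- times the forward edges at most `|C| / 2`, hence at most the number of edges.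
    (fun v S => (β / 8 * L ^ 2 ≤ ∑ i ∈ Finset.range (3 * s + 1), ((G.retain S).bfsForward v i : ℝ) ∨
      Λ * s ≤ ∑ i ∈ Finset.Ico s (2 * s), ((G.retain S).bfsLanes v i s : ℝ)) ∨
      (((G.retain S).bfsLevel v (s + s)).Nonempty ∧
        ∃ j, b ≤ j ∧ j ≤ s ∧ (((G.retain S).bfsLevel v j).card : ℝ) ≤ 2 * η * s))
    hβ fun v => ?_)
  · obtain ⟨C, hC, hT⟩ := hS
    refine ⟨C, hC, fun v hv => ?_⟩
    by_contra! hcon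
    obtain ⟨⟨hvol, hlane⟩, hlev⟩ := hcon
    have hC2 : 2 ≤ C.verts.card := by
      have : (2 : ℝ) ≤ C.verts.card := by linarith
      exact_mod_cast this
    have hcard : (C.verts.card : ℝ) ≤ 2 * C.toSimpleGraph.edgeSet.ncard := by
      exact_mod_cast C.card_verts_le hC2
    have hvol' : 4 * ∑ i ∈ Finset.range (3 * s + 1), (G.retain S).bfsForward v i
        ≤ C.toSimpleGraph.edgeSet.ncard := by
      have : (4 * ∑ i ∈ Finset.range (3 * s + 1), ((G.retain S).bfsForward v i : ℝ))
        ≤ C.toSimpleGraph.edgeSet.ncard := by linarith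
      exact_mod_cast this
    -- Otherwise the component would lie in the ball of radius `3s`, whose degree sum is at most
    -- half the number of edges.
    have hne : ((G.retain S).bfsLevel v (s + s)).Nonempty := by
      refine bfsLevel_nonempty_of_le (j := 3 * s + 1) (by omega) ?_
      by_contra hemp
      have h1 := degSum_le_of_level_empty (Finset.not_nonempty_iff_eq_empty.1 hemp)
      have h2 := C.two_mul_ncard_edgeSet hv
      have h3 := C.card_verts_le hC2
      omega
    have hball : η * (s : ℝ) ^ 2 ≤ ((G.retain S).bfsBall v s).card := by
      have h1 : ∑ j ∈ Finset.Icc b s, 2 * η * s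
          ≤ ∑ j ∈ Finset.Icc b s, (((G.retain S).bfsLevel v j).card : ℝ) :=
        Finset.sum_le_sum fun j hj =>
          (hlev hne j (Finset.mem_Icc.1 hj).1 (Finset.mem_Icc.1 hj).2).le
      have h2 : ∑ j ∈ Finset.Icc b s, (((G.retain S).bfsLevel v j).card : ℝ)
          ≤ ((G.retain S).bfsBall v s).card := by
        exact_mod_cast sum_card_bfsLevel_le v (Finset.Icc b s) s fun i hi => (Finset.mem_Icc.1 hi).2
      refine le_trans ?_ (h1.trans h2)
      rw [Finset.sum_const, Nat.card_Icc, nsmul_eq_mul]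
      have h3 : (s : ℝ) / 2 ≤ (s + 1 - b : ℕ) := by
        rw [div_le_iff₀ (by norm_num)]
        exact_mod_cast (by omega : s ≤ (s + 1 - (s + 1) / 2) * 2)
      calc η * (s : ℝ) ^ 2 = s / 2 * (2 * η * s) := by ring
        _ ≤ _ := by gcongr
    have key := C.card_bfsBall_mul_le hv hC2 hs0 hvol'
    have h4 : η * (s : ℝ) ^ 2 * (s : ℝ) ^ 2
        ≤ (η * δ ^ 3 / (16 * Λ) * L ^ 3) * (2 * (Λ * s)) := by
      calc η * (s : ℝ) ^ 2 * (s : ℝ) ^ 2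
          ≤ ((G.retain S).bfsBall v s).card * (s : ℝ) ^ 2 := by gcongr
        _ ≤ _ := key
        _ ≤ _ := by gcongr
    -- The constant 16 is 2 from the energy bound times `2^3` from `s ≥ δL/2`, so that the assumed
    -- small mixing time contradicts a ball with `η s^2` vertices.
    have h5 : (η * δ ^ 3 / (16 * Λ) * L ^ 3) * (2 * (Λ * s)) = η * (δ * L / 2) ^ 3 * s := by
      field_simp
      ring
    have h6 : C.toSimpleGraph.mixingTime * (2 * ∑ i ∈ Finset.Ico s (2 * s),
        ((G.retain S).bfsLanes v i s : ℝ)) < (η * δ ^ 3 / (16 * Λ) * L ^ 3) * (2 * (Λ * s)) := by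
      have h7 : (0 : ℝ) ≤ ∑ i ∈ Finset.Ico s (2 * s), ((G.retain S).bfsLanes v i s : ℝ) := by
        positivity
      exact mul_lt_mul'' hT (by linarith) (Nat.cast_nonneg _) (by positivity)
    have h8 : η * (δ * L / 2) ^ 3 * s ≤ η * (s : ℝ) ^ 3 * s := by gcongr
    have h9 : η * (s : ℝ) ^ 2 * (s : ℝ) ^ 2 ≤ ((G.retain S).bfsBall v s).card * (s : ℝ) ^ 2 := by
      gcongr
    rw [h5] at h6
    nlinarith
  · refine (bernPr_or_le h.mem _ _).trans ((add_le_add ((bernPr_or_le h.mem _ _).trans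
      (add_le_add ?_ ?_)) ?_).trans (le_of_eq (by
        rw [add_div, add_div] : 128 * E * δ / β / L + 128 * E / (Λ * δ) / L +
          2048 * E ^ 2 * η / δ / L = _)))
    · refine (h.forward_le v (by push_cast; linarith) (by positivity)).trans ?_
      calc 4 * E * (3 * s + 1 : ℕ) / (β / 8 * L ^ 2)
          ≤ 4 * E * (4 * (δ * L)) / (β / 8 * L ^ 2) := by
            gcongr
            push_cast
            linarith
        _ = 128 * E * δ / β / L := by field_simp; ring
    · refine (bernPr_le_div h.mem (f := fun S => ∑ i ∈ Finset.Ico s (2 * s),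
        ((G.retain S).bfsLanes v i s : ℝ)) (fun S => by positivity) (by positivity) _
        fun S hS => hS).trans ?_
      have h1 : bernEx P (fun S => ∑ i ∈ Finset.Ico s (2 * s),
          ((G.retain S).bfsLanes v i s : ℝ)) ≤ s * (64 * E / s) := by
        rw [bernEx_sum, ← nsmul_eq_mul]
        refine (Finset.sum_le_card_nsmul _ _ (64 * E / s) fun i hi => ?_).trans (le_of_eq ?_)
        · rw [Finset.mem_Ico] at hi
          refine (h.bernEx_bfsLanes_le v i hs0).trans ?_
          have h2 : M ^ (i + 1 + s) ≤ E := by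
            refine h.pow_le _ ?_
            have : ((i + 1 + s : ℕ) : ℝ) ≤ (3 * s : ℕ) := by exact_mod_cast (by omega)
            push_cast at this ⊢
            linarith
          gcongr
        · rw [Nat.card_Ico, show 2 * s - s = s by omega]
      calc _ ≤ s * (64 * E / s) / (Λ * s) := by gcongr
        _ = 64 * E / (Λ * s) := by field_simp
        _ ≤ 64 * E / (Λ * (δ * L / 2)) := by gcongr
        _ = 128 * E / (Λ * δ) / L := by field_simp; ring
    · refine (h.small_level_le v hb0 hs0 (by linarith) (by linarith) le_rfl
        (by positivity)).trans ?_
      calc 2 * η * s * (16 * E / s) * (16 * E / b)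
          ≤ 2 * η * s * (16 * E / s) * (16 * E / (s / 2)) := by gcongr
        _ = 1024 * E ^ 2 * η / s := by field_simp; ring
        _ ≤ 1024 * E ^ 2 * η / (δ * L / 2) := by gcongr
        _ = 2048 * E ^ 2 * η / δ / L := by field_simp; ring

end CriticalWindow

end SimpleGraph

namespace SimpleGraph

/-! ### The percolation measure as a finite Bernoulli sum -/

section Law

variable {V : Type*} [Fintype V] [DecidableEq V]

open Classical in
/-- The retention probabilities of percolation on `G`. -/
noncomputable def edgeProb (G : SimpleGraph V) (p : ℝ) (e : Sym2 V) : ℝ :=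
  if e ∈ G.edgeSet then p else 0

theorem setBernoulli_real_coe {ι : Type*} [Fintype ι] [DecidableEq ι] (u : Set ι)
    [DecidablePred (· ∈ u)] (p : unitInterval) (S : Finset ι) :
    (setBernoulli u p).real {(S : Set ι)} = bernWt (fun e => if e ∈ u then (p : ℝ) else 0) S := by
  by_cases hS : (S : Set ι) ⊆ u
  · rw [setBernoulli_real_singleton p hS (Set.toFinite u), bernWt,
      ← Finset.prod_subset (Finset.subset_univ (Finset.univ.filter (· ∈ u)))]
    · rw [Finset.prod_congr rfl fun e he => by rw [if_pos (Finset.mem_filter.1 he).2],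
        Finset.prod_ite, Finset.prod_const, Finset.prod_const]
      congr 2
      · rw [Set.ncard_coe_finset]
        congr 1
        ext e
        simp only [Finset.mem_filter, Finset.mem_univ, true_and]
        exact ⟨fun h => ⟨hS h, h⟩, fun h => h.2⟩
      · rw [← Set.ncard_coe_finset]
        congr 1
        ext e
        simp
    · intro e _ he
      have he' : e ∉ u := by simpa using he
      rw [if_neg fun h => he' (hS (Finset.mem_coe.2 h)), if_neg he', sub_zero]
  · rw [measureReal_def, setBernoulli_singleton_of_not_subset p hS, ENNReal.toReal_zero]
    obtain ⟨e, heS, heu⟩ := Set.not_subset.1 hS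
    refine (Finset.prod_eq_zero (Finset.mem_univ e) ?_).symm
    simp only [if_pos (Finset.mem_coe.1 heS), if_neg heu]

theorem measurableSet_of_finite (A : Set (SimpleGraph V)) : MeasurableSet A :=
  measurableEmbedding_edgeSet.measurableSet_image.1 (Set.toFinite _).measurableSet

/-- Sets of pairs not contained in the edge set have weight zero; on the others the graph with edge
set `S` is `G.retain S`. -/
theorem percolation_real_eq (G : SimpleGraph V) (p : unitInterval) (Q : SimpleGraph V → Prop) :
    (G.percolation p).real {H | Q H} = bernPr (G.edgeProb p) fun S => Q (G.retain S) := by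
  classical
  let c : Finset (Sym2 V) → Set (Sym2 V) := fun S => S
  have hcoe : Function.Injective c := Finset.coe_injective
  rw [percolation, map_measureReal_apply measurable_fromEdgeSet (measurableSet_of_finite _)]
  have h1 : (fromEdgeSet ⁻¹' {H : SimpleGraph V | Q H} : Set (Set (Sym2 V)))
      = (((Finset.univ.filter fun S : Finset (Sym2 V) => Q (fromEdgeSet (c S))).image
        c : Finset (Set (Sym2 V))) : Set (Set (Sym2 V))) := by
    ext T
    simp only [Set.mem_preimage, Set.mem_ofPred_eq, Finset.coe_image, Finset.coe_filter,
      Finset.mem_univ, true_and, Set.mem_image]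
    constructor
    · intro h
      exact ⟨T.toFinset, by simpa [c] using h, by simp [c]⟩
    · rintro ⟨S, h, rfl⟩
      exact h
  rw [h1, ← sum_measureReal_singleton, Finset.sum_image hcoe.injOn, bernPr, bernEx,
    Finset.sum_filter]
  refine Finset.sum_congr rfl fun S _ => ?_
  simp only [c]
  rw [setBernoulli_real_coe]
  by_cases hS : (S : Set (Sym2 V)) ⊆ G.edgeSet
  · have h2 : fromEdgeSet (S : Set (Sym2 V)) = G.retain S := by
      ext x y
      rw [fromEdgeSet_adj, retain_adj]
      constructor
      · rintro ⟨h, -⟩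
        exact ⟨hS h, h⟩
      · rintro ⟨h, h'⟩
        exact ⟨h', h.ne⟩
    rw [h2]
    by_cases hQ : Q (G.retain S)
    · rw [if_pos hQ, ind_of hQ, mul_one]
      rfl
    · rw [if_neg hQ, ind_of_not hQ, mul_zero]
  · have h3 : bernWt (G.edgeProb p) S = 0 := by
      obtain ⟨e, heS, heu⟩ := Set.not_subset.1 hS
      refine Finset.prod_eq_zero (Finset.mem_univ e) ?_
      rw [if_pos (by simpa using heS), edgeProb, if_neg heu]
    rw [h3, zero_mul]
    split_ifs
    · exact h3
    · rfl

end Law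

/-! ### Combining the estimates for diameters and mixing times -/

section Assembly

variable {V : Type*} [Fintype V] [DecidableEq V] {G : SimpleGraph V} {P : Sym2 V → ℝ} {D : ℕ}
  {p M L E : ℝ}

/-- The diameters of large components are of order `L`. -/
theorem CriticalWindow.diam_bound (h : CriticalWindow G P D p M L E) {β A A' K Q : ℝ} (hβ : 0 < β)
    (hβL : 2 ≤ β * L ^ 2) (hA : 1 ≤ A) (hAL : A ≤ L) (hK : 2 ≤ K) (hQ : 0 < Q)
    (hA' : 2 * (3 + Q) ≤ A') :
    bernPr P (fun S => ∃ C : (G.retain S).ConnectedComponent, β * L ^ 2 < (C.verts.card : ℝ) ∧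
      (C.toSimpleGraph.diam : ℝ) ∉ Set.Icc (A⁻¹ * L) (A' * L)) ≤
      4 * E / (A * β) / β + (1024 * E ^ 2 * (2 * K) / Q / β + 64 * E ^ 2 / K) := by
  refine (bernPr_mono h.mem fun S hS => ?_).trans ((bernPr_or_le h.mem _ _).trans (add_le_add
    (h.exists_component_diam_lt_le hβ hA hAL) ((bernPr_or_le h.mem _ _).trans (add_le_add
    (h.exists_component_lt_diam_le hβ (by linarith : 0 < 2 * K) hQ hA')
    (h.exists_component_edges_le hK)))))
  obtain ⟨C, hC, hd⟩ := hS
  rw [Set.mem_Icc, not_and_or, not_le, not_le] at hd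
  rcases hd with hd | hd
  · exact Or.inl ⟨C, hC, hd⟩
  -- Unless there are more than `K L^2` edges, the component has at most `2K L^2` vertices, and the
  -- bound for large diameters applies with `2K`.
  · by_cases hK' : K * L ^ 2 < (C.toSimpleGraph.edgeSet.ncard : ℝ)
    · exact Or.inr (Or.inr ⟨C, hK'⟩)
    · refine Or.inr (Or.inl ⟨C, hC, ?_, hd⟩)
      have hC2 : 2 ≤ C.verts.card := by
        have : (2 : ℝ) ≤ C.verts.card := by linarith
        exact_mod_cast this
      have : (C.verts.card : ℝ) ≤ 2 * C.toSimpleGraph.edgeSet.ncard := by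
        exact_mod_cast C.card_verts_le hC2
      linarith

/-- The mixing times of large components are of order `L ^ 3`. -/
theorem CriticalWindow.mixingTime_bound (h : CriticalWindow G P D p M L E)
    {β A A' K Q δ Λ η : ℝ} (hβ : 0 < β) (hβL : 2 ≤ β * L ^ 2) (hK : 2 ≤ K) (hQ : 0 < Q)
    (hδ : 0 < δ) (hδ1 : δ ≤ 1) (hδL : 1 ≤ δ * L) (hΛ : 0 < Λ) (hη : 0 < η)
    (hA' : 2 * (3 + Q) ≤ A') (hA : A⁻¹ ≤ η * δ ^ 3 / (16 * Λ)) (hA2 : 128 * K * A' ≤ A) :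
    bernPr P (fun S => ∃ C : (G.retain S).ConnectedComponent, β * L ^ 2 < (C.verts.card : ℝ) ∧
      (C.toSimpleGraph.mixingTime : ℝ) ∉ Set.Icc (A⁻¹ * L ^ 3) (A * L ^ 3)) ≤
      (128 * E * δ / β + 128 * E / (Λ * δ) + 2048 * E ^ 2 * η / δ) / β +
        (1024 * E ^ 2 * (2 * K) / Q / β + 64 * E ^ 2 / K) := by
  have hL : 0 < L := by linarith [h.two_le_scale]
  refine (bernPr_mono h.mem fun S hS => ?_).trans ((bernPr_or_le h.mem _ _).trans (add_le_add
    (h.exists_component_mixingTime_lt_le hβ hβL hδ hδ1 hδL hΛ hη)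
    ((bernPr_or_le h.mem _ _).trans (add_le_add
    (h.exists_component_lt_diam_le hβ (by linarith : 0 < 2 * K) hQ hA')
    (h.exists_component_edges_le hK)))))
  obtain ⟨C, hC, hd⟩ := hS
  rw [Set.mem_Icc, not_and_or, not_le, not_le] at hd
  rcases hd with hd | hd
  · exact Or.inl ⟨C, hC, hd.trans_le (mul_le_mul_of_nonneg_right hA (by positivity))⟩
  · by_cases hK' : K * L ^ 2 < (C.toSimpleGraph.edgeSet.ncard : ℝ)
    · exact Or.inr (Or.inr ⟨C, hK'⟩)
    rw [not_lt] at hK'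
    have hC2 : 2 ≤ C.verts.card := by
      have : (2 : ℝ) ≤ C.verts.card := by linarith
      exact_mod_cast this
    have hcard : (C.verts.card : ℝ) ≤ 2 * C.toSimpleGraph.edgeSet.ncard := by
      exact_mod_cast C.card_verts_le hC2
    refine Or.inr (Or.inl ⟨C, hC, by linarith, ?_⟩)
    -- With at most `K L^2` edges and diameter at most `A' L`, the mixing time is at most `128 K A'
    -- L^3`.
    by_contra! hdiam
    have hT : (C.toSimpleGraph.mixingTime : ℝ) ≤
        128 * C.toSimpleGraph.edgeSet.ncard * C.toSimpleGraph.diam := by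
      exact_mod_cast C.mixingTime_le hC2
    have h1 : (128 * C.toSimpleGraph.edgeSet.ncard * C.toSimpleGraph.diam : ℝ)
        ≤ 128 * (K * L ^ 2) * (A' * L) := by gcongr
    have h2 : 128 * K * A' * L ^ 3 ≤ A * L ^ 3 := by gcongr
    linarith

end Assembly

/-- Degrees are integers, so the real bound `d` may be replaced by its floor, and `D = ⌊d⌋ - 1 ≥ 2`
because `d ≥ 3`. -/
theorem nearCritical_edgeProb {V : Type*} [Fintype V] [DecidableEq V] (G : SimpleGraph V)
    [DecidableRel G.Adj] {d : ℝ} {p : unitInterval} {M : ℝ} (hd : 3 ≤ d)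
    (hdeg : (G.maxDegree : ℝ) ≤ d) (hp : (p : ℝ) ≤ M / (d - 1)) (hM : 1 ≤ M) :
    NearCritical G (G.edgeProb p) (⌊d⌋₊ - 1) p M := by
  have hfl : 3 ≤ ⌊d⌋₊ := Nat.le_floor (by exact_mod_cast hd)
  have hfl' := Nat.floor_le (by linarith : 0 ≤ d)
  refine ⟨fun e => ?_, fun e => ?_, p.2.1, p.2.2, by omega, fun x => ?_, ?_, hM⟩
  · rw [edgeProb]
    split_ifs
    · exact p.2
    · exact ⟨le_rfl, zero_le_one⟩
  · rw [edgeProb]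
    split_ifs
    · exact le_rfl
    · exact p.2.1
  · have h1 : (G.nbrsOff ∅ x).card = G.degree x := by
      rw [← card_neighborFinset_eq_degree]
      congr 1
      ext y
      simp [mem_nbrsOff]
    have h2 : G.maxDegree ≤ ⌊d⌋₊ := Nat.le_floor hdeg
    have h3 := G.degree_le_maxDegree x
    omega
  · rw [le_div_iff₀ (by linarith)] at hp
    rw [Nat.cast_sub (by omega)]
    refine le_trans ?_ hp
    rw [mul_comm]
    refine mul_le_mul_of_nonneg_left ?_ p.2.1
    push_cast
    linarith

end SimpleGraph

/-! ### Choice of constants and proof of the theorem -/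

set_option maxHeartbeats 800000 in
open SimpleGraph in
theorem theorem1p2 (lam ε β : ℝ) (hε : 0 < ε) (hβ : 0 < β) :
    ∃ A : ℝ, 0 < A ∧ ∃ N : ℕ, ∀ n : ℕ, N ≤ n →
      ∀ (V : Type*) [Fintype V] (G : SimpleGraph V) [DecidableRel G.Adj]
        (d : ℝ) (p : unitInterval),
        Fintype.card V = n → d ∈ Set.Icc (3 : ℝ) ((n : ℝ) - 1) → (G.maxDegree : ℝ) ≤ d →
        0 < p → p < 1 → (p : ℝ) ≤ (1 + lam * (n : ℝ) ^ (-(1 / 3 : ℝ))) / (d - 1) →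
        (G.percolation p).real {H : SimpleGraph V | ∃ C : H.ConnectedComponent,
            β * (n : ℝ) ^ (2 / 3 : ℝ) < (C.supp.ncard : ℝ) ∧
            (C.toSimpleGraph.diam : ℝ) ∉
              Set.Icc (A⁻¹ * (n : ℝ) ^ (1 / 3 : ℝ)) (A * (n : ℝ) ^ (1 / 3 : ℝ))} < ε ∧
        (G.percolation p).real {H : SimpleGraph V | ∃ C : H.ConnectedComponent,
            A * (n : ℝ) ^ (2 / 3 : ℝ) < (C.toSimpleGraph.edgeSet.ncard : ℝ)} < ε ∧
        (G.percolation p).real {H : SimpleGraph V | ∃ C : H.ConnectedComponent,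
            β * (n : ℝ) ^ (2 / 3 : ℝ) < (C.supp.ncard : ℝ) ∧
            (C.toSimpleGraph.mixingTime : ℝ) ∉ Set.Icc (A⁻¹ * (n : ℝ)) (A * (n : ℝ))} < ε := by
  classical
  obtain ⟨E, hE⟩ : ∃ x : ℝ, x = Real.exp (4 * |lam|) := ⟨_, rfl⟩
  have hE1 : 1 ≤ E := hE ▸ Real.one_le_exp (by positivity)
  -- The error budget is `ε / 4` for each of: too many edges (`K`), large diameter (`Q`), small
  -- mixing time (`δ`, `Λ`, `η`), small diameter (`A₀`). At most three of these occur in any one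
  -- claim.
  obtain ⟨K, hKdef⟩ : ∃ x : ℝ, x = 2 + 256 * E ^ 2 / ε := ⟨_, rfl⟩
  have hK2 : 2 ≤ K := by
    have : 0 ≤ 256 * E ^ 2 / ε := by positivity
    linarith
  have hKε : 64 * E ^ 2 / K < ε / 4 := by
    rw [div_lt_div_iff₀ (by linarith) (by norm_num), hKdef, mul_add,
      mul_div_cancel₀ _ hε.ne']
    linarith
  obtain ⟨Q, hQdef⟩ : ∃ x : ℝ, x = 8192 * E ^ 2 * K / (β * ε) := ⟨_, rfl⟩
  have hQ : 0 < Q := by rw [hQdef]; positivity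
  have hQε : 1024 * E ^ 2 * (2 * K) / Q / β = ε / 4 := by
    rw [hQdef]
    field_simp
    norm_num
  -- First `δ` bounds the volume term; then `Λ` and `η`, which depend on `δ`, bound the lane and
  -- thin sphere terms. Each receives `ε β / 12`.
  obtain ⟨δ, hδdef⟩ : ∃ x : ℝ, x = min 1 (ε * β ^ 2 / (12 * 128 * E)) := ⟨_, rfl⟩
  have hδ : 0 < δ := hδdef ▸ lt_min zero_lt_one (by positivity)
  have hδ1 : δ ≤ 1 := hδdef ▸ min_le_left _ _
  obtain ⟨Λ, hΛdef⟩ : ∃ x : ℝ, x = 12 * 128 * E / (ε * β * δ) := ⟨_, rfl⟩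
  have hΛ : 0 < Λ := by rw [hΛdef]; positivity
  obtain ⟨η, hηdef⟩ : ∃ x : ℝ, x = ε * β * δ / (12 * 2048 * E ^ 2) := ⟨_, rfl⟩
  have hη : 0 < η := by rw [hηdef]; positivity
  have hmixε : (128 * E * δ / β + 128 * E / (Λ * δ) + 2048 * E ^ 2 * η / δ) / β ≤ ε / 4 := by
    have h1 : 128 * E * δ / β ≤ ε * β / 12 := by
      rw [div_le_div_iff₀ hβ (by norm_num)]
      have := min_le_right 1 (ε * β ^ 2 / (12 * 128 * E))
      rw [← hδdef, le_div_iff₀ (by positivity)] at this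
      linarith
    have h2 : 128 * E / (Λ * δ) = ε * β / 12 := by
      rw [hΛdef]
      field_simp
    have h3 : 2048 * E ^ 2 * η / δ = ε * β / 12 := by
      rw [hηdef]
      field_simp
    rw [div_le_iff₀ hβ, h2, h3]
    linarith
  obtain ⟨A', hA'def⟩ : ∃ x : ℝ, x = 2 * (3 + Q) := ⟨_, rfl⟩
  obtain ⟨A₀, hA₀def⟩ : ∃ x : ℝ, x = 1 + 32 * E / (ε * β ^ 2) := ⟨_, rfl⟩
  obtain ⟨A, hAdef⟩ : ∃ x : ℝ, x = A₀ + 128 * K * A' + 16 * Λ / (η * δ ^ 3) := ⟨_, rfl⟩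
  have hA'0 : 0 < A' := by rw [hA'def]; positivity
  have hA₀1 : 1 ≤ A₀ := by
    have : 0 ≤ 32 * E / (ε * β ^ 2) := by positivity
    linarith
  have hx1 : 0 < 128 * K * A' := by positivity
  have hx2 : 0 < 16 * Λ / (η * δ ^ 3) := by positivity
  have hA1 : 1 ≤ A := by linarith
  have hA0 : 0 < A := by linarith
  have hA'A : A' ≤ A := by nlinarith
  have hKA : K ≤ A := by nlinarith
  have hAmix : A⁻¹ ≤ η * δ ^ 3 / (16 * Λ) := by
    rw [← inv_div, inv_le_inv₀ hA0 hx2]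
    linarith
  have hAdiam : 4 * E / (A * β) / β < ε / 4 := by
    rw [div_div, div_lt_div_iff₀ (by positivity) (by norm_num)]
    have h1 : ε * β ^ 2 * A₀ = ε * β ^ 2 + 32 * E := by
      rw [hA₀def]
      field_simp
    have h2 : ε * β ^ 2 * A₀ ≤ ε * β ^ 2 * A :=
      mul_le_mul_of_nonneg_left (by linarith) (by positivity)
    have h3 : 0 < ε * β ^ 2 := by positivity
    nlinarith
  -- The summands ensure `L ≥ 2`, `A ≤ L`, `δ L ≥ 1` and `β L ≥ 1`; the last two lead to `β L^2 ≥
  -- 2`.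
  obtain ⟨L₀, hL₀⟩ : ∃ x : ℝ, x = 2 + A + δ⁻¹ + β⁻¹ := ⟨_, rfl⟩
  have hL₀0 : 0 < L₀ := by rw [hL₀]; positivity
  refine ⟨A, hA0, ⌈L₀ ^ 3⌉₊, fun n hn V _ G _ d p hcard hd hdeg hp0 hp1 hp => ?_⟩
  obtain ⟨L, hL⟩ : ∃ x : ℝ, x = (n : ℝ) ^ (1 / 3 : ℝ) := ⟨_, rfl⟩
  have hn0 : (0 : ℝ) ≤ n := Nat.cast_nonneg n
  have hL3 : L ^ 3 = n := by
    rw [hL, ← Real.rpow_natCast, ← Real.rpow_mul hn0]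
    norm_num
  have hL2 : (n : ℝ) ^ (2 / 3 : ℝ) = L ^ 2 := by
    rw [hL, ← Real.rpow_natCast, ← Real.rpow_mul hn0]
    norm_num
  have hLL : L₀ ≤ L := by
    have h1 : L₀ ^ 3 ≤ L ^ 3 := by
      rw [hL3]
      exact (Nat.le_ceil _).trans (by exact_mod_cast hn)
    exact le_of_pow_le_pow_left₀ (by norm_num) (hL ▸ Real.rpow_nonneg hn0 _) h1
  have hδi : 0 < δ⁻¹ := inv_pos.2 hδ
  have hβi : 0 < β⁻¹ := inv_pos.2 hβ
  have hLtwo : 2 ≤ L := by linarith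
  have hLpos : 0 < L := by linarith
  have hLinv : (n : ℝ) ^ (-(1 / 3 : ℝ)) = L⁻¹ := by rw [hL, Real.rpow_neg hn0]
  obtain ⟨M, hM⟩ : ∃ x : ℝ, x = 1 + |lam| * L⁻¹ := ⟨_, rfl⟩
  have hM1 : 1 ≤ M := by
    have : 0 ≤ |lam| * L⁻¹ := by positivity
    linarith
  have hpM : (p : ℝ) ≤ M / (d - 1) := by
    refine hp.trans (div_le_div_of_nonneg_right ?_ (by linarith [hd.1]))
    rw [hLinv, hM]
    exact add_le_add_right (mul_le_mul_of_nonneg_right (le_abs_self lam) (inv_pos.2 hLpos).le) 1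
  have hW : CriticalWindow G (G.edgeProb p) (⌊d⌋₊ - 1) p M L E :=
    { nearCritical_edgeProb G hd.1 hdeg hpM hM1 with
      card_eq := by rw [hcard, hL3]
      two_le_scale := hLtwo
      -- `M ≤ exp (|λ| / L)`, so up to `k = 4L` the powers are at most `exp (4 |λ|)`. The range `4L`
      -- accommodates the largest radius used, `3s + 1` with `s ≤ L`.
      pow_le := fun k hk => by
        have h1 : M ≤ Real.exp (|lam| * L⁻¹) := by
          rw [hM, add_comm]
          exact Real.add_one_le_exp _
        calc M ^ k ≤ Real.exp (|lam| * L⁻¹) ^ k := pow_le_pow_left₀ (by linarith) h1 k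
          _ = Real.exp (k * (|lam| * L⁻¹)) := (Real.exp_nat_mul _ _).symm
          _ ≤ E := by
            rw [hE]
            refine Real.exp_le_exp.2 ?_
            calc (k : ℝ) * (|lam| * L⁻¹) ≤ 4 * L * (|lam| * L⁻¹) := by gcongr
              _ = 4 * |lam| := by field_simp }
  have hβL : 2 ≤ β * L ^ 2 := by
    have h1 : 1 ≤ β * L := by
      rw [← mul_inv_cancel₀ hβ.ne']
      exact mul_le_mul_of_nonneg_left (by linarith) hβ.le
    nlinarith
  have hδL : 1 ≤ δ * L := by
    rw [← mul_inv_cancel₀ hδ.ne']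
    exact mul_le_mul_of_nonneg_left (by linarith) hδ.le
  rw [percolation_real_eq, percolation_real_eq, percolation_real_eq]
  simp only [ConnectedComponent.ncard_supp, hL2, ← hL]
  rw [← hL3]
  refine ⟨?_, ?_, ?_⟩
  · have := hW.diam_bound hβ hβL hA1 (by linarith) hK2 hQ (A' := A) (hA'def ▸ hA'A)
    linarith
  · have := hW.exists_component_edges_le (hK2.trans hKA)
    have h2 : 64 * E ^ 2 / A ≤ 64 * E ^ 2 / K := by gcongr
    linarith
  · have := hW.mixingTime_bound hβ hβL hK2 hQ hδ hδ1 hδL hΛ hη hA'def.ge hAmix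
      (by linarith : 128 * K * A' ≤ A)
    linarith
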